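/- **Model.** There are $N_H\ge 1$ type-$H$ users and $N_L\ge 1$ type-$L$ users ($N=N_H+N_L$), with on-chain utilities $R_H\ge R_L$ per transaction and impatience $\gamma>0$, and $M$ miners with mining powers $\alpha_m>0$, $\sum_m\alpha_m=1$, and storage cost $C_s\ge 0$ per byte. Blocks are found at the times of a Poisson process of rate $\mu>0$; each block is won by miner $m$ with probability $\alpha_m$. Transaction sizes are i.i.d., positive, with mean $\bar s<\infty$. The pool of waiting transactions is empty at time $0$. A *mechanism* consists of two fee-per-byte choices $\overline\rho>\underline\rho\ge 0$ and a waiting tax rate vector $(P_{HH},P_{HL},P_{LH},P_{LL})\in\mathbb R^4$, where $P_{ab}$ is what a type-$a$ user pays to each other user of type $b$ for each of his included transactions. *Miners.* In each round every miner selects for his block either nothing or the transaction of highest fee-per-byte in the pool (the earliest one among equals). If transactions of size $s$ and fee-per-byte $\rho$ are selected, miner $m$'s payoff in the round is $\alpha_m\sum_{\text{selected by }m}s\rho-\sum_j\alpha_j\sum_{\text{selected by }j}sC_s$. The miners play a Nash equilibrium of this game in every round, an indifferent miner selecting the transaction. *Users.* User $n$ generates transactions at fee-per-byte $\overline\rho$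 and $\underline\rho$ as independent Poisson processes of rates $\lambda_{n1},\lambda_{n2}\ge 0$ with $\lambda_{n1}+\lambda_{n2}\le\mu/N$. His payoff is his long-run expected payoff per unit time: an own transaction of size $s$, fee-per-byte $\rho$ and waiting time $w$ (from generation to inclusion in a block, $\infty$ if never included) gives him $\mathbf 1\,(R_n-s\rho-\sum_{l\ne n}p_{nl})-\gamma w$, where $\mathbf 1$ indicates inclusion, $R_n$ is the utility of his type and $p_{nl}$ the tax he pays to user $l$; and he receives $p_{ln}$ for each included transaction of another user $l$. The users play a symmetric Nash equilibrium (users of one type use the same rates), the Pareto-dominant one if there are several. *Problem.* The *social welfare* is the sum of the time-average payoffs of all users and all miners. The *mechanism design problem* is to maximize the social welfare at the equilibrium over all mechanisms, subject to the sufficient fee condition $$\frac{\lambda_{n1}\overline\rho+\lambda_{n2}\underline\rho}{\lambda_{n1}+\lambda_{n2}}\ge MC_s\quad\text{for all users } n \text{ with }\lambda_{n1}+\lambda_{n2}>0 .$$ **Theorem 3.** The following mechanisms exist and are optimal solutions of the mechanism design problem. (More precisely: each has a Pareto-dominant symmetric equilibrium, and each of its symmetric equilibria satisfies the sufficient fee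 condition and has a social welfare not smaller than that of any symmetric equilibrium, satisfying the sufficient fee condition, of any mechanism.) (a) If $R_H\le M\bar sC_s+\frac{\gamma}{\mu}$: every mechanism with $(\overline\rho,\underline\rho)=\bigl(MC_s+\frac{\gamma}{\bar s\mu},\,MC_s\bigr)$ and $$(N_H-1)P_{HH}+N_LP_{HL}=0,\qquad N_HP_{LH}+(N_L-1)P_{LL}=0 .$$ (b) If $R_H> M\bar sC_s+\frac{\gamma}{\mu}$: every mechanism with $(\overline\rho,\underline\rho)=\bigl(\frac{R_H}{\bar s}-\frac{\gamma}{\bar s\mu},\,MC_s\bigr)$ and $$(N_H-1)P_{HH}+N_LP_{HL}=R_H-\underline\rho\,\bar s-\frac{\gamma[\mu-(N_H-1)g_1-N_Lg_2]}{(\mu-N_Hg_1-N_Lg_2)^2},$$ $$N_HP_{LH}+(N_L-1)P_{LL}=R_L-\underline\rho\,\bar s-\frac{\gamma[\mu-N_Hg_1-(N_L-1)g_2]}{(\mu-N_Hg_1-N_Lg_2)^2},$$ where $$g_1=\min\Bigl\{\frac{\mu}{N_H+N_L},\ \frac1{N_H}\Bigl(\mu-\sqrt{\frac{\gamma\mu}{R_H-M\bar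 sC_s}}\Bigr)\Bigr\},$$ $$g_2=\begin{cases}0,&\text{if }R_L\le M\bar sC_s+\frac{\gamma(N_H+N_L)^2}{N_L^2\mu},\\[2pt]\frac{\mu}{N_H+N_L}-\frac1{N_L}\sqrt{\frac{\gamma\mu}{R_L-M\bar sC_s}},&\text{otherwise.}\end{cases}$$ -/

import Mathlib

open MeasureTheory Filter
open scoped NNReal ENNReal

noncomputable section

/-- The fixed data of the system: two types of users, miners with normalised mining powers, the
block generation rate, the on-chain utilities, the impatience, the storage cost per byte and the
law of the transaction sizes. -/
structure Blockchain where
  /-- number of type-H users -/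
  numH : ℕ
  /-- number of type-L users -/
  numL : ℕ
  numH_pos : 0 < numH
  numL_pos : 0 < numL
  /-- number of miners -/
  numMiners : ℕ
  /-- normalised mining power of each miner -/
  power : Fin numMiners → ℝ≥0
  power_pos : ∀ m, 0 < power m
  sum_power : ∑ m, power m = 1
  /-- block generation rate -/
  blockRate : ℝ≥0
  blockRate_pos : 0 < blockRate
  /-- on-chain utility of a type-H user -/
  utilH : ℝ
  /-- on-chain utility of a type-L user -/
  utilL : ℝ
  utilL_le_utilH : utilL ≤ utilH
  /-- impatience coefficient -/
  impatience : ℝ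
  impatience_pos : 0 < impatience
  /-- storage cost per byte of one miner -/
  storageCost : ℝ
  storageCost_nonneg : 0 ≤ storageCost
  /-- law of the size of a transaction -/
  sizeLaw : Measure ℝ
  sizeLaw_prob : IsProbabilityMeasure sizeLaw
  sizeLaw_pos : ∀ᵐ s ∂sizeLaw, 0 < s
  sizeLaw_integrable : Integrable (fun s : ℝ => s) sizeLaw

attribute [instance] Blockchain.sizeLaw_prob

/-- The two fee-per-byte choices that a user may attach to a transaction. -/
inductive FeeLevel where
  | high
  | low
  deriving DecidableEq

instance : Fintype FeeLevel := ⟨{.high, .low}, fun x => by cases x <;> simp⟩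

instance : MeasurableSpace FeeLevel := ⊤

/-- A mechanism: the two fee-per-byte choices and the waiting tax rate vector. `taxHL` is what a
type-H user pays to a type-L user, and so on. -/
structure Mechanism where
  feeHigh : ℝ
  feeLow : ℝ
  taxHH : ℝ
  taxHL : ℝ
  taxLH : ℝ
  taxLL : ℝ

/-- The fee-per-byte of a given level. -/
def Mechanism.fee (T : Mechanism) : FeeLevel → ℝ
  | .high => T.feeHigh
  | .low => T.feeLow

/-- The constraint on the fee-per-byte choices. -/
def Mechanism.Admissible (T : Mechanism) : Prop :=
  T.feeLow < T.feeHigh ∧ 0 ≤ T.feeLow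

/-- A transaction pool: transactions are labelled by natural numbers in the order of their
generation, `txs` is the set of labels of the waiting transactions, and `fee`, `size` give their
fee-per-byte and size. -/
structure TxPool where
  txs : Finset ℕ
  fee : ℕ → ℝ
  size : ℕ → ℝ

/-- The transactions of highest fee-per-byte in the pool. -/
def TxPool.highest (Q : TxPool) : Finset ℕ :=
  Q.txs.filter fun k => ∀ j ∈ Q.txs, Q.fee j ≤ Q.fee k

/-- The transaction of highest fee-per-byte in the pool that was generated first, as a singleton;
empty when the pool is empty. -/
def TxPool.candidate (Q : TxPool) : Finset ℕ :=
  Q.highest.filter fun k => ∀ j ∈ Q.highest, k ≤ j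

/-- What a miner may put into a block: nothing, or the highest fee-per-byte transaction. -/
def TxPool.choices (Q : TxPool) : Set (Finset ℕ) :=
  {∅, Q.candidate}

namespace Blockchain

variable (C : Blockchain)

/-- Users: type-H users on the left, type-L users on the right. -/
abbrev User : Type := Fin C.numH ⊕ Fin C.numL

/-- Miners. -/
abbrev Miner : Type := Fin C.numMiners

/-- The expected size of a transaction. -/
def meanSize : ℝ := ∫ s, s ∂C.sizeLaw

/-- The number of users. -/
def numUsers : ℕ := C.numH + C.numL

/-- On-chain utility of one transaction of a user. -/
def util : C.User → ℝ
  | .inl _ => C.utilH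
  | .inr _ => C.utilL

/-- The waiting tax that a user (first argument) pays to another user (second argument) for each
of his included transactions. -/
def tax (T : Mechanism) : C.User → C.User → ℝ
  | .inl _, .inl _ => T.taxHH
  | .inl _, .inr _ => T.taxHL
  | .inr _, .inl _ => T.taxLH
  | .inr _, .inr _ => T.taxLL

/-! ### The transaction selection game of one round of mining -/

/-- Strategies of all miners: what each miner selects, for each state of the pool. -/
abbrev MinerProfile : Type := C.Miner → TxPool → Finset ℕ

/-- Payoff of miner `m` in a round with pool `Q` when the miners select `A`: he collects the fees
of his selection with probability `power m`, and he stores whatever the winner selects. -/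
def roundPayoff (Q : TxPool) (A : C.Miner → Finset ℕ) (m : C.Miner) : ℝ :=
  C.power m * ∑ k ∈ A m, Q.size k * Q.fee k
    - ∑ j, (C.power j : ℝ) * ∑ k ∈ A j, Q.size k * C.storageCost

/-- The miners play a Nash equilibrium of the selection game at every pool, and a miner who is
indifferent between selecting the transaction and selecting nothing selects it. -/
def IsMinerEquilibrium (X : C.MinerProfile) : Prop :=
  ∀ Q : TxPool, ∀ m : C.Miner, X m Q ∈ Q.choices ∧
    ∀ A ∈ Q.choices,
      C.roundPayoff Q (Function.update (fun j => X j Q) m A) m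
          ≤ C.roundPayoff Q (fun j => X j Q) m ∧
      (C.roundPayoff Q (Function.update (fun j => X j Q) m A) m
          = C.roundPayoff Q (fun j => X j Q) m → A.card ≤ (X m Q).card)

/-! ### The stochastic evolution of the system -/

/-- Transaction generation rates of all users. -/
abbrev Rates : Type := C.User → FeeLevel → ℝ≥0

/-- What can happen in the system: a user generates a transaction with one of the two fee-per-byte
choices, or a miner finds a block. -/
abbrev Event : Type := (C.User × FeeLevel) ⊕ C.Miner

/-- One step of the history: the time elapsed since the previous event, the event, and a size (the
size of the new transaction if the event is the generation of a transaction). -/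
abbrev Step : Type := ℝ × C.Event × ℝ

/-- A history of the system from time zero, when the pool is empty. -/
abbrev History : Type := ℕ → C.Step

/-- The total rate of all events. -/
def totalRate (r : C.Rates) : ℝ≥0 := C.blockRate + ∑ n, ∑ c, r n c

/-- The probability that the next event is a given one. -/
def eventProb (r : C.Rates) : C.Event → ℝ≥0
  | .inl (n, c) => r n c / C.totalRate r
  | .inr m => C.blockRate * C.power m / C.totalRate r

theorem totalRate_pos (r : C.Rates) : 0 < C.totalRate r :=
  lt_of_lt_of_le C.blockRate_pos le_self_add

theorem sum_eventProb (r : C.Rates) : ∑ e, C.eventProb r e = 1 := by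
  have h : C.totalRate r ≠ 0 := (C.totalRate_pos r).ne'
  rw [Fintype.sum_sum_type, Fintype.sum_prod_type]
  simp only [eventProb, ← Finset.sum_div, ← Finset.mul_sum, C.sum_power, mul_one]
  rw [← add_div, add_comm]
  exact div_self h

/-- The law of the next event. -/
def eventLaw (r : C.Rates) : PMF C.Event :=
  PMF.ofFintype (fun e => (C.eventProb r e : ℝ≥0∞)) (by
    rw [← ENNReal.ofNNReal_finsetSum, C.sum_eventProb r, ENNReal.coe_one])

instance (r : C.Rates) :
    IsProbabilityMeasure (ProbabilityTheory.expMeasure (C.totalRate r : ℝ)) :=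
  ProbabilityTheory.isProbabilityMeasure_expMeasure (NNReal.coe_pos.2 (C.totalRate_pos r))

/-- The law of one step. -/
def stepLaw (r : C.Rates) : Measure C.Step :=
  (ProbabilityTheory.expMeasure (C.totalRate r : ℝ)).prod
    ((C.eventLaw r).toMeasure.prod C.sizeLaw)

instance (r : C.Rates) : IsProbabilityMeasure (C.stepLaw r) := by
  unfold stepLaw; infer_instance

/-- The law of the history. Each user generates transactions of each fee level by a Poisson
process, the blocks form a Poisson process of rate `blockRate` and the winner of a block is miner
`m` with probability `power m`; sizes are i.i.d.; all these are independent. This is the superposed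
process with exponential gaps and independent marks proportional to the individual rates. -/
def law (r : C.Rates) : Measure C.History :=
  Measure.infinitePi fun _ : ℕ => C.stepLaw r

variable {C}

/-- The `k`-th event of a history. -/
def event (ω : C.History) (k : ℕ) : C.Event := (ω k).2.1

/-- The size of the transaction generated at event `k`. -/
def txSize (ω : C.History) (k : ℕ) : ℝ := (ω k).2.2

/-- The time of event `k`. -/
def eventTime (ω : C.History) (k : ℕ) : ℝ := ∑ i ∈ Finset.range (k + 1), (ω i).1

/-- The fee-per-byte of the transaction generated at event `k`. -/
def txFee (T : Mechanism) (ω : C.History) (k : ℕ) : ℝ :=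
  match event ω k with
  | .inl (_, c) => T.fee c
  | .inr _ => 0

/-- Event `k` is the generation of a transaction by user `n`. -/
def IsTxOf (ω : C.History) (n : C.User) (k : ℕ) : Prop :=
  ∃ c, event ω k = .inl (n, c)

/-- The labels of the transactions that are waiting just before event `k`; a transaction is
labelled by the index of the event at which it was generated. -/
def waiting (T : Mechanism) (X : C.MinerProfile) (ω : C.History) : ℕ → Finset ℕ
  | 0 => ∅
  | k + 1 =>
    match event ω k with
    | .inl _ => insert k (waiting T X ω k)
    | .inr m => waiting T X ω k \ X m ⟨waiting T X ω k, txFee T ω, txSize ω⟩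

/-- The transaction pool just before event `k`. -/
def poolAt (T : Mechanism) (X : C.MinerProfile) (ω : C.History) (k : ℕ) : TxPool :=
  ⟨waiting T X ω k, txFee T ω, txSize ω⟩

/-- The transaction generated at event `k` is included in the block found at event `j`. -/
def IncludedAt (T : Mechanism) (X : C.MinerProfile) (ω : C.History) (k j : ℕ) : Prop :=
  k ∈ waiting T X ω j ∧ k ∉ waiting T X ω (j + 1)

/-- The transaction generated at event `k` is included in the blockchain. -/
def Included (T : Mechanism) (X : C.MinerProfile) (ω : C.History) (k : ℕ) : Prop :=
  ∃ j, IncludedAt T X ω k j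

open scoped Classical in
/-- The waiting time of the transaction generated at event `k`: on-chain time minus generation
time, infinite if it is never included. -/
def waitingTime (T : Mechanism) (X : C.MinerProfile) (ω : C.History) (k : ℕ) : ℝ≥0∞ :=
  if h : Included T X ω k then ENNReal.ofReal (eventTime ω (Nat.find h) - eventTime ω k) else ⊤

/-! ### Time-average payoffs -/

open scoped Classical in
/-- What user `n` receives, apart from waiting costs, on account of event `k`: for an own
transaction that gets included, the on-chain utility minus the fee and the taxes paid to all other
users; for an included transaction of another user, the tax received from him. -/
def txBalance (T : Mechanism) (X : C.MinerProfile) (n : C.User) (ω : C.History) (k : ℕ) : ℝ :=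
  if Included T X ω k then
    match event ω k with
    | .inl (l, c) =>
      if l = n then C.util n - txSize ω k * T.fee c - ∑ j ∈ Finset.univ.erase n, C.tax T n j
      else C.tax T l n
    | .inr _ => 0
  else 0

open scoped Classical in
/-- Expected total of what user `n` receives, apart from waiting costs, on account of the
transactions generated up to time `t`. -/
def expectedBalance (T : Mechanism) (X : C.MinerProfile) (r : C.Rates) (n : C.User) (t : ℝ) : ℝ :=
  ∫ ω, ∑' k, (if eventTime ω k ≤ t then txBalance T X n ω k else 0) ∂C.law r

open scoped Classical in
/-- Expected total waiting time of the transactions that user `n` generates up to time `t`. -/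
def expectedWaiting (T : Mechanism) (X : C.MinerProfile) (r : C.Rates) (n : C.User) (t : ℝ) :
    ℝ≥0∞ :=
  ∫⁻ ω, ∑' k, (if eventTime ω k ≤ t ∧ IsTxOf ω n k then waitingTime T X ω k else 0) ∂C.law r

/-- Time-average payoff of user `n`, which is `⊥` when his average waiting cost is infinite. -/
def userPayoff (T : Mechanism) (X : C.MinerProfile) (r : C.Rates) (n : C.User) : EReal :=
  liminf (fun t : ℝ =>
    ((expectedBalance T X r n t / t : ℝ) : EReal)
      - ((ENNReal.ofReal (C.impatience / t) * expectedWaiting T X r n t : ℝ≥0∞) : EReal)) atTop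

/-- The payoff of miner `m` in the round that ends at event `k` (zero if event `k` is not the
finding of a block). -/
def minerBalance (T : Mechanism) (X : C.MinerProfile) (m : C.Miner) (ω : C.History) (k : ℕ) : ℝ :=
  match event ω k with
  | .inl _ => 0
  | .inr _ => C.roundPayoff (poolAt T X ω k) (fun j => X j (poolAt T X ω k)) m

open scoped Classical in
/-- Time-average payoff of miner `m`. -/
def minerPayoff (T : Mechanism) (X : C.MinerProfile) (r : C.Rates) (m : C.Miner) : EReal :=
  liminf (fun t : ℝ =>
    (((∫ ω, ∑' k, (if eventTime ω k ≤ t then minerBalance T X m ω k else 0) ∂C.law r) / t : ℝ) :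
      EReal)) atTop

/-- Social welfare: the sum of the time-average payoffs of all users and all miners. -/
def socialWelfare (T : Mechanism) (X : C.MinerProfile) (r : C.Rates) : EReal :=
  ∑ n, userPayoff T X r n + ∑ m, minerPayoff T X r m

/-! ### The transaction generation game -/

variable (C) in
/-- The strategy space of a user. -/
def FeasibleRate (a : FeeLevel → ℝ≥0) : Prop :=
  a .high + a .low ≤ C.blockRate / C.numUsers

/-- The users play a Nash equilibrium in generation rates in which users of the same type use the
same rates. -/
def IsUserEquilibrium (T : Mechanism) (X : C.MinerProfile) (r : C.Rates) : Prop :=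
  (∀ n, C.FeasibleRate (r n)) ∧
  (∀ i j, r (.inl i) = r (.inl j)) ∧ (∀ i j, r (.inr i) = r (.inr j)) ∧
  ∀ n, ∀ a : FeeLevel → ℝ≥0, C.FeasibleRate a →
    userPayoff T X (Function.update r n a) n ≤ userPayoff T X r n

/-- Every user is at least as well off as at any other symmetric equilibrium. -/
def IsParetoDominant (T : Mechanism) (X : C.MinerProfile) (r : C.Rates) : Prop :=
  ∀ r', IsUserEquilibrium T X r' → ∀ n, userPayoff T X r' n ≤ userPayoff T X r n

/-- Equilibrium of the two lower stages of the game, given the mechanism. -/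
def IsEquilibrium (T : Mechanism) (X : C.MinerProfile) (r : C.Rates) : Prop :=
  C.IsMinerEquilibrium X ∧ IsUserEquilibrium T X r

/-! ### The mechanism design problem -/

/-- Sufficient fee condition: the average fee-per-byte of every user who generates transactions
covers the total storage cost per byte of all miners. -/
def SufficientFee (T : Mechanism) (r : C.Rates) : Prop :=
  ∀ n, 0 < r n .high + r n .low →
    C.numMiners * C.storageCost
      ≤ (r n .high * T.feeHigh + r n .low * T.feeLow) / (r n .high + r n .low : ℝ)

variable (C) in
/-- The mechanism solves the mechanism design problem: it is admissible, it has a Pareto-dominant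
symmetric equilibrium, and each of its equilibria meets the sufficient fee condition and reaches at
least the social welfare of every equilibrium, meeting the sufficient fee condition, of every
admissible mechanism. -/
def IsOptimal (T : Mechanism) : Prop :=
  T.Admissible ∧
  (∃ X r, C.IsMinerEquilibrium X ∧ IsUserEquilibrium T X r ∧ IsParetoDominant T X r) ∧
  ∀ (X : C.MinerProfile) (r : C.Rates), IsEquilibrium T X r →
    SufficientFee T r ∧
    ∀ (T' : Mechanism) (X' : C.MinerProfile) (r' : C.Rates), T'.Admissible →
      IsEquilibrium T' X' r' → SufficientFee T' r' →
      socialWelfare T' X' r' ≤ socialWelfare T X r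

/-! ### The closed forms -/

variable (C)

/-- Total waiting tax of a type-H user for one transaction. -/
def totalTaxH (T : Mechanism) : ℝ := (C.numH - 1) * T.taxHH + C.numL * T.taxHL

/-- Total waiting tax of a type-L user for one transaction. -/
def totalTaxL (T : Mechanism) : ℝ := C.numH * T.taxLH + (C.numL - 1) * T.taxLL

/-- `g₁` -/
def g₁ : ℝ :=
  min (C.blockRate / (C.numH + C.numL))
    (1 / C.numH * (C.blockRate
      - √(C.impatience * C.blockRate
          / (C.utilH - C.numMiners * C.meanSize * C.storageCost))))

open scoped Classical in
/-- `g₂` -/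
def g₂ : ℝ :=
  if C.utilL ≤ C.numMiners * C.meanSize * C.storageCost
      + C.impatience * (C.numH + C.numL) ^ 2 / (C.numL ^ 2 * C.blockRate) then 0
  else C.blockRate / (C.numH + C.numL)
    - 1 / C.numL * √(C.impatience * C.blockRate
        / (C.utilL - C.numMiners * C.meanSize * C.storageCost))

end Blockchain

end

/-!
The only equilibrium of the miners is that each of them selects the candidate if and only if its fee
covers the storage cost of a single miner (`isMinerEquilibrium_iff`). If the fees in use do so, the
pool is therefore a queue with two priorities, one service per block and service in the order of
arrival within a priority (`waiting_eq_queue`), and the sizes and the identities of the users do not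
matter for its evolution.

Read at the event times, the history is an i.i.d. sequence of letters, independent of the i.i.d.
gaps. The number of transactions ahead of a new one is a birth-death chain whose mean converges to
the mean of a geometric law, or to infinity in the critical case (`tendsto_birthDeathMean`,
`tendsto_birthDeathMean_atTop`). The position of a waiting transaction is a walk with constant drift
until it is absorbed at zero, so that Wald's identity gives its mean waiting time
(`hasSum_prob_waiting`). A Cesàro argument along the Poisson process of all events
(`tendsto_tsum_eventProbUpTo_div`) turns these limits along events into time averages. With block
rate `μ`, rates `Λ₁`, `Λ₂` of the two fee levels and `Λ = Λ₁ + Λ₂ < μ`, the mean waiting times are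
`1 / (μ - Λ₁)` and `μ / ((μ - Λ) (μ - Λ₁))` (`userPayoff_eq`). If the queue is critical or if a fee
in use is too low, some user has payoff `⊥` (`exists_userPayoff_eq_bot`); he would rather generate
nothing, so that every equilibrium is stable.

In a stable system taxes and fees are transfers, and the social welfare is
`∑ λₙ (Rₙ - M s̄ C_s) - γ Λ / (μ - Λ)` (`socialWelfare_eq`), a concave function of the rates `λₙ` of
the users alone. The closed forms satisfy the first-order conditions for its maximum
(`closedForm_firstOrder`, `welfare_le_welfare_lowRates`). It remains to see that the mechanisms of
the theorem implement these rates. Their high fee costs more than it can save in waiting, so that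
only the low fee is used (`IsUserEquilibrium.rate_high_eq_zero`), which meets the sufficient fee
condition by its choice. At the low fee, the taxes make the marginal payoff of each user vanish at
the optimal rates, or be nonpositive where the optimal rate is zero. Marginal waiting costs increase
both in the own and in the total load, so no other rates satisfy the first-order conditions of all
users (`IsUserEquilibrium.eq_lowRates`), and since payoffs are concave the optimal rates do form an
equilibrium (`isUserEquilibrium_lowRates`). Being the only one, it is Pareto-dominant.
-/

set_option linter.unusedSectionVars false

/-! ### Sequences of independent identically distributed marks -/

namespace MeasureTheory

section

variable {ι α β : Type*} [MeasurableSpace α] [MeasurableSpace β]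
  (P : Measure α) (Q : Measure β) [IsProbabilityMeasure P] [IsProbabilityMeasure Q]

/-- An i.i.d. sequence of pairs with independent components is a pair of independent i.i.d.
sequences. -/
theorem infinitePi_map_unzip :
    (Measure.infinitePi fun _ : ι => P.prod Q).map
        (fun ω => ((fun k => (ω k).1, fun k => (ω k).2) : (ι → α) × (ι → β)))
      = (Measure.infinitePi fun _ : ι => P).prod (Measure.infinitePi fun _ : ι => Q) := by
  classical
  have hm : Measurable (fun ω : ι → α × β =>
      ((fun k => (ω k).1, fun k => (ω k).2) : (ι → α) × (ι → β))) := by fun_prop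
  symm
  refine Measure.prod_eq_generateFrom generateFrom_squareCylinders generateFrom_squareCylinders
    (isPiSystem_squareCylinders (fun _ => MeasurableSpace.isPiSystem_measurableSet)
      fun _ => MeasurableSet.univ)
    (isPiSystem_squareCylinders (fun _ => MeasurableSpace.isPiSystem_measurableSet)
      fun _ => MeasurableSet.univ)
    ⟨fun _ => Set.univ, fun _ => ⟨∅, fun _ => Set.univ, by simp, by simp⟩, by simp,
      Set.iUnion_const _⟩
    ⟨fun _ => Set.univ, fun _ => ⟨∅, fun _ => Set.univ, by simp, by simp⟩, by simp,
      Set.iUnion_const _⟩ ?_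
  rintro _ ⟨s, a, ha, rfl⟩ _ ⟨t, b, hb, rfl⟩
  replace ha : ∀ i, MeasurableSet (a i) := fun i => ha i trivial
  replace hb : ∀ i, MeasurableSet (b i) := fun i => hb i trivial
  rw [Measure.map_apply hm ((MeasurableSet.pi s.countable_toSet fun i _ => ha i).prod
    (MeasurableSet.pi t.countable_toSet fun i _ => hb i))]
  have h : (fun ω : ι → α × β => ((fun k => (ω k).1, fun k => (ω k).2) : (ι → α) × (ι → β))) ⁻¹'
      ((s : Set ι).pi a ×ˢ (t : Set ι).pi b)
      = ((s ∪ t : Finset ι) : Set ι).pi fun i =>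
        (if i ∈ s then a i else Set.univ) ×ˢ (if i ∈ t then b i else Set.univ) := by
    ext ω
    simp only [Set.mem_preimage, Set.mem_prod, Set.mem_pi, Finset.mem_coe, Finset.mem_union]
    constructor
    · rintro ⟨h1, h2⟩ i -
      constructor
      · split_ifs with hi
        · exact h1 i hi
        · trivial
      · split_ifs with hi
        · exact h2 i hi
        · trivial
    · intro h
      exact ⟨fun i hi => by simpa [hi] using (h i (Or.inl hi)).1,
        fun i hi => by simpa [hi] using (h i (Or.inr hi)).2⟩
  rw [h, Measure.infinitePi_pi, Measure.infinitePi_pi _ fun i _ => ha i,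
    Measure.infinitePi_pi _ fun i _ => hb i]
  · simp only [Measure.prod_prod, Finset.prod_mul_distrib]
    congr 1
    · rw [← Finset.prod_subset Finset.subset_union_left]
      · exact Finset.prod_congr rfl fun i hi => by simp [hi]
      · intro i _ hi
        simp [hi]
    · rw [← Finset.prod_subset Finset.subset_union_right]
      · exact Finset.prod_congr rfl fun i hi => by simp [hi]
      · intro i _ hi
        simp [hi]
  · intro i _
    refine MeasurableSet.prod ?_ ?_
    · split_ifs
      exacts [ha i, MeasurableSet.univ]
    · split_ifs
      exacts [hb i, MeasurableSet.univ]

variable [DecidableEq ι]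

theorem measurable_update_prod (k : ι) :
    Measurable (fun x : (ι → α) × α => Function.update x.1 k x.2) := by
  refine measurable_pi_lambda _ fun i => ?_
  by_cases h : i = k
  · subst h; simpa using measurable_snd
  · simp only [Function.update_of_ne h]; fun_prop

/-- The law of an i.i.d. sequence is invariant under resampling one of its terms. -/
theorem infinitePi_map_update (k : ι) :
    ((Measure.infinitePi fun _ : ι => P).prod P).map (fun x => Function.update x.1 k x.2)
      = Measure.infinitePi fun _ : ι => P := by
  refine Measure.eq_infinitePi _ fun s t ht => ?_
  rw [Measure.map_apply (measurable_update_prod k)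
    (MeasurableSet.pi s.countable_toSet fun i _ => ht i)]
  have h : (fun x : (ι → α) × α => Function.update x.1 k x.2) ⁻¹' ((s : Set ι).pi t)
      = (((s.erase k : Finset ι) : Set ι).pi t) ×ˢ (if k ∈ s then t k else Set.univ) := by
    ext ⟨ω, x⟩
    simp only [Set.mem_preimage, Set.mem_pi, Finset.mem_coe, Set.mem_prod, Finset.mem_erase]
    constructor
    · intro h
      refine ⟨fun i hi => by simpa [hi.1] using h i hi.2, ?_⟩
      split_ifs with hk
      · simpa using h k hk
      · trivial
    · rintro ⟨h1, h2⟩ i hi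
      by_cases hik : i = k
      · subst hik; simpa [hi] using h2
      · simpa [hik] using h1 i ⟨hik, hi⟩
  rw [h, Measure.prod_prod, Measure.infinitePi_pi _ fun i _ => ht i]
  split_ifs with hk
  · rw [mul_comm, Finset.mul_prod_erase s (fun i => P (t i)) hk]
  · rw [Finset.erase_eq_of_notMem hk, measure_univ, mul_one]

theorem lintegral_infinitePi_eq_update (k : ι) {f : (ι → α) → ℝ≥0∞} (hf : Measurable f) :
    ∫⁻ ω, f ω ∂Measure.infinitePi (fun _ : ι => P)
      = ∫⁻ ω, ∫⁻ x, f (Function.update ω k x) ∂P ∂Measure.infinitePi (fun _ : ι => P) := by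
  conv_lhs => rw [← infinitePi_map_update P k, lintegral_map hf (measurable_update_prod k)]
  exact lintegral_prod _ (hf.comp (measurable_update_prod k)).aemeasurable

/-- A term of an i.i.d. sequence is independent of the functions of the other terms. -/
theorem lintegral_infinitePi_mul_apply {k : ι} {f : (ι → α) → ℝ≥0∞} (hf : Measurable f)
    (hfk : ∀ ω x, f (Function.update ω k x) = f ω) {g : α → ℝ≥0∞} (hg : Measurable g) :
    ∫⁻ ω, f ω * g (ω k) ∂Measure.infinitePi (fun _ : ι => P)
      = (∫⁻ ω, f ω ∂Measure.infinitePi (fun _ : ι => P)) * ∫⁻ x, g x ∂P := by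
  conv_lhs => rw [← infinitePi_map_update P k]
  rw [lintegral_map (by fun_prop) (measurable_update_prod k)]
  simp only [hfk, Function.update_self]
  rw [lintegral_prod_mul hf.aemeasurable hg.aemeasurable]

end

theorem _root_.DependsOn.exists_bound {E : Type*} [Finite E] {F : (ℕ → E) → ℝ} {s : Finset ℕ}
    (hF : DependsOn F s) :
    ∃ c, ∀ e, |F e| ≤ c := by
  classical
  obtain ⟨G, hG⟩ := dependsOn_iff_exists_comp.1 hF
  have : Finite ((i : (s : Set ℕ)) → E) := inferInstance
  obtain ⟨c, hc⟩ := (Set.finite_range fun x => |G x|).bddAbove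
  exact ⟨c, fun e => by rw [hG]; exact hc ⟨_, rfl⟩⟩

section

variable {E β : Type*} [Finite E] [MeasurableSpace E] [DiscreteMeasurableSpace E]

/-- A function of finitely many terms of a sequence over a finite alphabet factors through a finite
type. -/
theorem _root_.DependsOn.measurable_of_finite [MeasurableSpace β] {F : (ℕ → E) → β}
    {s : Finset ℕ} (hF : DependsOn F s) : Measurable F := by
  classical
  rcases isEmpty_or_nonempty (ℕ → E) with h | h
  · exact measurable_of_empty F
  have : Nonempty β := ⟨F h.some⟩
  obtain ⟨G, hG⟩ := dependsOn_iff_exists_comp.1 hF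
  have hG' : Measurable G := by
    have : Finite ((i : (s : Set ℕ)) → E) := inferInstance
    exact _root_.measurable_of_finite G
  rw [hG]
  refine hG'.comp ?_
  exact measurable_pi_lambda _ fun i => measurable_pi_apply _

theorem _root_.DependsOn.integrable_of_finite {F : (ℕ → E) → ℝ} {s : Finset ℕ}
    (hF : DependsOn F s) (μ : Measure (ℕ → E)) [IsFiniteMeasure μ] : Integrable F μ := by
  obtain ⟨c, hc⟩ := hF.exists_bound
  exact Integrable.of_bound hF.measurable_of_finite.aestronglyMeasurable c
    (Eventually.of_forall fun e => by simpa using hc e)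

end

section

variable {E : Type*} [Fintype E] [MeasurableSpace E] [DiscreteMeasurableSpace E]
  (P : Measure E) [IsProbabilityMeasure P]

theorem integral_infinitePi_mul_apply {k : ℕ} {f : (ℕ → E) → ℝ}
    (hfk : ∀ ω x, f (Function.update ω k x) = f ω) (g : E → ℝ) (hf : Measurable f) :
    ∫ ω, f ω * g (ω k) ∂Measure.infinitePi (fun _ : ℕ => P)
      = (∫ ω, f ω ∂Measure.infinitePi (fun _ : ℕ => P)) * ∫ x, g x ∂P := by
  have hg : Measurable g := .of_discrete
  conv_lhs => rw [← infinitePi_map_update P k]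
  rw [integral_map (measurable_update_prod k).aemeasurable
    (Measurable.aestronglyMeasurable (by fun_prop))]
  simp only [hfk, Function.update_self]
  rw [integral_prod_mul]

/-- One step of a process driven by an i.i.d. sequence over a finite alphabet: conditioning on the
letter that is read at time `k`. -/
theorem integral_infinitePi_step {k : ℕ} {F : (ℕ → E) → E → ℝ}
    (hF : ∀ x, DependsOn (fun e => F e x) (Finset.range k : Set ℕ)) :
    ∫ e, F e (e k) ∂Measure.infinitePi (fun _ : ℕ => P)
      = ∑ x, P.real {x} * ∫ e, F e x ∂Measure.infinitePi (fun _ : ℕ => P) := by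
  classical
  have h1 : ∀ e : ℕ → E, F e (e k) = ∑ x, F e x * Set.indicator {x} 1 (e k) := by
    intro e
    rw [Finset.sum_eq_single (e k)]
    · simp
    · intro x _ hx
      simp [Set.indicator, hx.symm]
    · simp
  have hupd : ∀ x ω y, F (Function.update ω k y) x = F ω x := by
    intro x ω y
    refine hF x fun i hi => ?_
    rw [Function.update_of_ne]
    simpa using (Finset.mem_range.1 hi).ne
  simp only [h1]
  rw [integral_finsetSum]
  · refine Finset.sum_congr rfl fun x _ => ?_
    rw [integral_infinitePi_mul_apply P (hupd x) _ (hF x).measurable_of_finite, mul_comm]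
    congr 1
    rw [integral_indicator_one (MeasurableSet.of_discrete)]
  · intro x _
    refine Integrable.mono' ((hF x).integrable_of_finite _).norm ?_ ?_
    · exact ((hF x).measurable_of_finite.mul
        ((Measurable.of_discrete (f := Set.indicator {x} 1)).comp
          (measurable_pi_apply k))).aestronglyMeasurable
    · refine Eventually.of_forall fun e => ?_
      rw [norm_mul]
      refine mul_le_of_le_one_right (norm_nonneg _) ?_
      by_cases h : e k = x <;> simp [Set.indicator, h]

end

end MeasureTheory

/-! ### The Poisson process of events -/

namespace ProbabilityTheory

open MeasureTheory Topology

section Exponential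

variable {θ : ℝ}

theorem expMeasure_eq (θ : ℝ) :
    expMeasure θ = volume.withDensity (exponentialPDF θ) := rfl

theorem expMeasure_Iic (hθ : 0 < θ) (x : ℝ) :
    expMeasure θ (Set.Iic x) = ENNReal.ofReal (if 0 ≤ x then 1 - Real.exp (-(θ * x)) else 0) := by
  rw [expMeasure_eq, withDensity_apply _ measurableSet_Iic,
    lintegral_exponentialPDF_eq_antiDeriv hθ]

theorem expMeasure_Ioi (hθ : 0 < θ) {x : ℝ} (hx : 0 ≤ x) :
    expMeasure θ (Set.Ioi x) = ENNReal.ofReal (Real.exp (-(θ * x))) := by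
  have := isProbabilityMeasure_expMeasure hθ
  have h1 : Real.exp (-(θ * x)) ≤ 1 := Real.exp_le_one_iff.2 (by nlinarith)
  rw [← Set.compl_Iic, prob_compl_eq_one_sub measurableSet_Iic, expMeasure_Iic hθ, if_pos hx,
    ← ENNReal.ofReal_one, ← ENNReal.ofReal_sub _ (by linarith)]
  congr 1; ring

theorem ae_nonneg_expMeasure (hθ : 0 < θ) : ∀ᵐ x ∂expMeasure θ, 0 ≤ x := by
  rw [ae_iff]
  have h : {x : ℝ | ¬ 0 ≤ x} ⊆ Set.Iic 0 := fun x hx => by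
    simp only [Set.mem_ofPred_eq, not_le] at hx; exact hx.le
  refine measure_mono_null h ?_
  rw [expMeasure_Iic hθ]; simp

theorem mul_lintegral_Ioi_expMeasure (hθ : 0 < θ) {s : Set ℝ} (hs : s ⊆ Set.Ici 0)
    (hsm : MeasurableSet s) :
    ENNReal.ofReal θ * ∫⁻ t in s, expMeasure θ (Set.Ioi t) = expMeasure θ s := by
  rw [expMeasure_eq, withDensity_apply _ hsm, ← expMeasure_eq, ← lintegral_const_mul']
  · refine setLIntegral_congr_fun hsm fun t ht => ?_
    rw [expMeasure_Ioi hθ (hs ht), exponentialPDF_of_nonneg (hs ht), ENNReal.ofReal_mul hθ.le]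
  · simp

/-- The mean of an exponential variable capped at `a` is proportional to the probability that the
variable does not exceed `a`. -/
theorem mul_lintegral_min_expMeasure (hθ : 0 < θ) (a : ℝ) :
    ENNReal.ofReal θ * ∫⁻ x, ENNReal.ofReal (min x a) ∂expMeasure θ
      = expMeasure θ (Set.Iic a) := by
  have h1 : ∫⁻ x, ENNReal.ofReal (min x a) ∂expMeasure θ
      = ∫⁻ x, ENNReal.ofReal (max (min x a) 0) ∂expMeasure θ := by
    simp only [ENNReal.ofReal_max, ENNReal.ofReal_zero, zero_le, max_eq_left]
  rw [h1, lintegral_eq_lintegral_meas_lt (f := fun x => max (min x a) 0) _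
    (Eventually.of_forall fun x => le_max_right _ _) (by fun_prop)]
  have h2 : ∫⁻ t in Set.Ioi (0 : ℝ), expMeasure θ {x | t < max (min x a) 0}
      = ∫⁻ t in Set.Ioo 0 a, expMeasure θ (Set.Ioi t) := by
    rw [← Set.Ioi_inter_Iio, Set.inter_comm, ← setLIntegral_indicator measurableSet_Iio]
    refine setLIntegral_congr_fun measurableSet_Ioi fun t ht => ?_
    have ht' : ¬ t < 0 := not_lt.2 (le_of_lt ht)
    by_cases hta : t < a
    · rw [Set.indicator_of_mem (show t ∈ Set.Iio a from hta)]
      congr 1; ext x; simp [hta, ht']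
    · rw [Set.indicator_of_notMem (show t ∉ Set.Iio a from hta)]
      simp [hta, ht']
  rw [h2, mul_lintegral_Ioi_expMeasure hθ (fun x hx => hx.1.le) measurableSet_Ioo]
  refine measure_congr ?_
  rw [expMeasure_eq]
  have h3 : (Set.Ioo 0 a : Set ℝ) =ᵐ[volume.withDensity (exponentialPDF θ)] Set.Ioc 0 a :=
    (withDensity_absolutelyContinuous _ _).ae_le Ioo_ae_eq_Ioc
  refine h3.trans ?_
  have h4 : ∀ᵐ x ∂volume.withDensity (exponentialPDF θ), x ≠ 0 :=
    (withDensity_absolutelyContinuous _ _).ae_le (Measure.ae_ne volume 0)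
  filter_upwards [h4, ae_nonneg_expMeasure hθ] with x hx0 hx
  have : 0 < x := lt_of_le_of_ne hx (Ne.symm hx0)
  refine propext ⟨fun h => h.2, fun h => ⟨this, h⟩⟩

theorem lintegral_expMeasure (hθ : 0 < θ) :
    ∫⁻ x, ENNReal.ofReal x ∂expMeasure θ = ENNReal.ofReal (1 / θ) := by
  have := isProbabilityMeasure_expMeasure hθ
  have h1 : ∫⁻ x, ENNReal.ofReal x ∂expMeasure θ
      = ∫⁻ x, ENNReal.ofReal (max x 0) ∂expMeasure θ := by
    simp only [ENNReal.ofReal_max, ENNReal.ofReal_zero, zero_le, max_eq_left]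
  rw [h1, lintegral_eq_lintegral_meas_lt (f := fun x => max x 0) _
    (Eventually.of_forall fun x => le_max_right _ _) (by fun_prop)]
  have h2 : ∫⁻ t in Set.Ioi (0 : ℝ), expMeasure θ {x | t < max x 0}
      = ∫⁻ t in Set.Ioi 0, expMeasure θ (Set.Ioi t) := by
    refine setLIntegral_congr_fun measurableSet_Ioi fun t ht => ?_
    have ht' : ¬ t < 0 := not_lt.2 (le_of_lt ht)
    congr 1; ext x; simp [ht']
  have h3 := mul_lintegral_Ioi_expMeasure hθ (s := Set.Ioi 0) Set.Ioi_subset_Ici_self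
    measurableSet_Ioi
  rw [expMeasure_Ioi hθ le_rfl] at h3
  rw [h2, one_div, ENNReal.ofReal_inv_of_pos hθ]
  refine ENNReal.eq_inv_of_mul_eq_one_left ?_
  rw [mul_comm, h3]; simp

end Exponential

section Renewal

variable {θ : ℝ}

/-- The law of the gaps of a Poisson process of rate `θ`. -/
noncomputable def gapLaw (θ : ℝ) : Measure (ℕ → ℝ) := Measure.infinitePi fun _ => expMeasure θ

theorem isProbabilityMeasure_gapLaw (hθ : 0 < θ) : IsProbabilityMeasure (gapLaw θ) := by
  have := isProbabilityMeasure_expMeasure hθ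
  unfold gapLaw; infer_instance

theorem ae_nonneg_gapLaw (hθ : 0 < θ) : ∀ᵐ τ ∂gapLaw θ, ∀ k, 0 ≤ τ k := by
  have := isProbabilityMeasure_expMeasure hθ
  rw [ae_all_iff]
  intro k
  have h := (measurePreserving_eval_infinitePi (fun _ : ℕ => expMeasure θ) k)
  exact h.quasiMeasurePreserving.ae (ae_nonneg_expMeasure hθ)

theorem mul_lintegral_min_sum_gapLaw (hθ : 0 < θ) {t : ℝ} (ht : 0 ≤ t) (K : ℕ) :
    ENNReal.ofReal θ * ∫⁻ τ, ENNReal.ofReal (min (∑ i ∈ Finset.range K, τ i) t) ∂gapLaw θ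
      = ∑ k ∈ Finset.range K, gapLaw θ {τ | ∑ i ∈ Finset.range (k + 1), τ i ≤ t} := by
  have := isProbabilityMeasure_expMeasure hθ
  have hup : ∀ (k : ℕ) (τ : ℕ → ℝ) (x : ℝ),
      ∑ i ∈ Finset.range k, Function.update τ k x i = ∑ i ∈ Finset.range k, τ i := by
    intro k τ x
    refine Finset.sum_congr rfl fun i hi => ?_
    rw [Function.update_of_ne (Finset.mem_range.1 hi).ne]
  induction K with
  | zero => simp [ht]
  | succ k ih =>
    rw [Finset.sum_range_succ, ← ih]
    have h1 : ∫⁻ τ, ENNReal.ofReal (min (∑ i ∈ Finset.range (k + 1), τ i) t) ∂gapLaw θ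
        = ∫⁻ τ, ENNReal.ofReal (min (∑ i ∈ Finset.range k, τ i) t)
          + ENNReal.ofReal (min (τ k) (t - ∑ i ∈ Finset.range k, τ i)) ∂gapLaw θ := by
      refine lintegral_congr_ae ?_
      filter_upwards [ae_nonneg_gapLaw hθ] with τ hτ
      have hs : 0 ≤ ∑ i ∈ Finset.range k, τ i := Finset.sum_nonneg fun i _ => hτ i
      rw [Finset.sum_range_succ]
      set S := ∑ i ∈ Finset.range k, τ i
      rcases le_total S t with h | h
      · rw [min_eq_left h, ← ENNReal.ofReal_add hs (le_min (hτ k) (by linarith)),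
          ← min_add_add_left]
        simp
      · have h2 : min (τ k) (t - S) ≤ 0 := (min_le_right _ _).trans (by linarith)
        rw [min_eq_right h, min_eq_right (h.trans (by linarith [hτ k])),
          ENNReal.ofReal_of_nonpos h2, add_zero]
    rw [h1, lintegral_add_left (by fun_prop), mul_add]
    congr 1
    have hm : Measurable fun τ : ℕ → ℝ =>
        ENNReal.ofReal (min (τ k) (t - ∑ i ∈ Finset.range k, τ i)) := by fun_prop
    have hms : MeasurableSet {τ : ℕ → ℝ | ∑ i ∈ Finset.range (k + 1), τ i ≤ t} :=
      measurableSet_le (by fun_prop) measurable_const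
    rw [← lintegral_indicator_one hms]
    have hm2 : Measurable ({τ : ℕ → ℝ | ∑ i ∈ Finset.range (k + 1), τ i ≤ t}.indicator
        (1 : (ℕ → ℝ) → ℝ≥0∞)) := measurable_one.indicator hms
    unfold gapLaw
    rw [lintegral_infinitePi_eq_update _ k hm, lintegral_infinitePi_eq_update _ k hm2,
      ← lintegral_const_mul' _ _ (by simp)]
    refine lintegral_congr fun τ => ?_
    simp only [hup, Function.update_self]
    rw [mul_lintegral_min_expMeasure hθ, ← lintegral_indicator_one measurableSet_Iic]
    refine lintegral_congr fun x => ?_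
    simp only [Set.indicator, Set.mem_Iic, Set.mem_ofPred_eq, Finset.sum_range_succ, hup,
      Function.update_self]
    refine if_congr ?_ rfl rfl
    constructor <;> intro h <;> linarith

/-- The probability that event `k` of a Poisson process of rate `θ` occurs up to time `t`. -/
noncomputable def eventProbUpTo (θ t : ℝ) (k : ℕ) : ℝ :=
  (gapLaw θ).real {τ | ∑ i ∈ Finset.range (k + 1), τ i ≤ t}

theorem eventProbUpTo_nonneg (θ t : ℝ) (k : ℕ) : 0 ≤ eventProbUpTo θ t k := measureReal_nonneg

theorem eventProbUpTo_le_one (hθ : 0 < θ) (t : ℝ) (k : ℕ) : eventProbUpTo θ t k ≤ 1 := by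
  have := isProbabilityMeasure_gapLaw hθ
  exact measureReal_le_one

theorem ofReal_eventProbUpTo (hθ : 0 < θ) (t : ℝ) (k : ℕ) :
    ENNReal.ofReal (eventProbUpTo θ t k)
      = gapLaw θ {τ | ∑ i ∈ Finset.range (k + 1), τ i ≤ t} := by
  have := isProbabilityMeasure_gapLaw hθ
  rw [eventProbUpTo, measureReal_def, ENNReal.ofReal_toReal (measure_ne_top _ _)]

/-- A Poisson process of rate `θ` has `θ * t` events on average up to time `t`. By Wald's identity,
`θ` times the mean of the `K`-th event time capped at `t` is the sum of the first `K` terms. -/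
theorem hasSum_eventProbUpTo (hθ : 0 < θ) {t : ℝ} (ht : 0 ≤ t) :
    HasSum (eventProbUpTo θ t) (θ * t) := by
  have := isProbabilityMeasure_gapLaw hθ
  have hle : ∀ K, ∑ k ∈ Finset.range K, gapLaw θ {τ | ∑ i ∈ Finset.range (k + 1), τ i ≤ t}
      ≤ ENNReal.ofReal (θ * t) := by
    intro K
    rw [← mul_lintegral_min_sum_gapLaw hθ ht, ENNReal.ofReal_mul hθ.le]
    gcongr
    calc _ ≤ ∫⁻ _, ENNReal.ofReal t ∂gapLaw θ :=
          lintegral_mono fun τ => ENNReal.ofReal_le_ofReal (min_le_right _ _)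
      _ = _ := by simp
  have hsum : ∀ K, ∑ k ∈ Finset.range K, eventProbUpTo θ t k ≤ θ * t := by
    intro K
    have := hle K
    simp only [← ofReal_eventProbUpTo hθ] at this
    rw [← ENNReal.ofReal_sum_of_nonneg fun k _ => eventProbUpTo_nonneg θ t k] at this
    exact (ENNReal.ofReal_le_ofReal_iff (by positivity)).1 this
  have hs : Summable (eventProbUpTo θ t) :=
    summable_of_sum_range_le (eventProbUpTo_nonneg θ t) hsum
  have hge : ∀ k, θ * (t * (1 - eventProbUpTo θ t k))
      ≤ ∑ k ∈ Finset.range (k + 1), eventProbUpTo θ t k := by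
    intro k
    have h := mul_lintegral_min_sum_gapLaw hθ ht (k + 1)
    simp only [← ofReal_eventProbUpTo hθ] at h
    rw [← ENNReal.ofReal_sum_of_nonneg fun k _ => eventProbUpTo_nonneg θ t k] at h
    have hms : MeasurableSet {τ : ℕ → ℝ | ∑ i ∈ Finset.range (k + 1), τ i ≤ t} :=
      measurableSet_le (by fun_prop) measurable_const
    have h2 : ENNReal.ofReal (t * (1 - eventProbUpTo θ t k))
        ≤ ∫⁻ τ, ENNReal.ofReal (min (∑ i ∈ Finset.range (k + 1), τ i) t) ∂gapLaw θ := by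
      have h3 : ENNReal.ofReal (t * (1 - eventProbUpTo θ t k))
          = ∫⁻ τ, ENNReal.ofReal t
            * {τ : ℕ → ℝ | ∑ i ∈ Finset.range (k + 1), τ i ≤ t}ᶜ.indicator 1 τ ∂gapLaw θ := by
        rw [lintegral_const_mul' _ _ (by simp), lintegral_indicator_one hms.compl,
          prob_compl_eq_one_sub hms, ← ofReal_eventProbUpTo hθ, ← ENNReal.ofReal_one,
          ← ENNReal.ofReal_sub _ (eventProbUpTo_nonneg θ t k), ENNReal.ofReal_mul ht]
      rw [h3]
      refine lintegral_mono fun τ => ?_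
      by_cases hτ : ∑ i ∈ Finset.range (k + 1), τ i ≤ t
      · rw [Set.indicator_of_notMem (by simpa using hτ)]; simp
      · rw [Set.indicator_of_mem (by simpa using hτ), min_eq_right (not_le.1 hτ).le]; simp
    have h4 : ENNReal.ofReal (θ * (t * (1 - eventProbUpTo θ t k)))
        ≤ ENNReal.ofReal (∑ k ∈ Finset.range (k + 1), eventProbUpTo θ t k) := by
      rw [← h, ENNReal.ofReal_mul hθ.le]; gcongr
    exact (ENNReal.ofReal_le_ofReal_iff
      (Finset.sum_nonneg fun k _ => eventProbUpTo_nonneg θ t k)).1 h4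
  have heq : ∑' k, eventProbUpTo θ t k = θ * t := by
    refine le_antisymm ?_ ?_
    · exact le_of_tendsto hs.hasSum.tendsto_sum_nat (Eventually.of_forall hsum)
    · have h1 : Tendsto (fun k => θ * (t * (1 - eventProbUpTo θ t k))) atTop (𝓝 (θ * t)) := by
        have := ((hs.tendsto_atTop_zero.const_sub 1).const_mul t).const_mul θ
        simpa using this
      exact le_of_tendsto_of_tendsto h1
        (hs.hasSum.tendsto_sum_nat.comp (tendsto_add_atTop_nat 1)) (Eventually.of_forall hge)
  rw [← heq]; exact hs.hasSum

theorem summable_eventProbUpTo_mul (hθ : 0 < θ) {t : ℝ} (ht : 0 ≤ t) {x : ℕ → ℝ} {B : ℝ}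
    (hB : ∀ k, |x k| ≤ B) : Summable fun k => eventProbUpTo θ t k * x k := by
  refine Summable.of_norm_bounded ((hasSum_eventProbUpTo hθ ht).summable.mul_right B) fun k => ?_
  rw [Real.norm_eq_abs, abs_mul, abs_of_nonneg (eventProbUpTo_nonneg θ t k)]
  exact mul_le_mul_of_nonneg_left (hB k) (eventProbUpTo_nonneg θ t k)

/-- If rewards are attached to the events of an independent Poisson process, and the mean reward of
event `k` converges to `L`, then the mean reward per unit time converges to `θ * L`. -/
theorem tendsto_tsum_eventProbUpTo_div (hθ : 0 < θ) {x : ℕ → ℝ} {L : ℝ}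
    (hx : Tendsto x atTop (𝓝 L)) :
    Tendsto (fun t => (∑' k, eventProbUpTo θ t k * x k) / t) atTop (𝓝 (θ * L)) := by
  obtain ⟨B, hB⟩ : ∃ B, ∀ k, |x k| ≤ B := by
    obtain ⟨B, hB⟩ := hx.abs.bddAbove_range
    exact ⟨B, fun k => hB ⟨k, rfl⟩⟩
  have hB0 : 0 ≤ B := (abs_nonneg _).trans (hB 0)
  rw [Metric.tendsto_atTop]
  intro ε hε
  have hε' : 0 < ε / (2 * θ) := by positivity
  obtain ⟨K, hK⟩ := (Metric.tendsto_atTop.1 hx) _ hε'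
  set D : ℝ := ∑ k ∈ Finset.range K, |x k - L|
  have hD : 0 ≤ D := Finset.sum_nonneg fun _ _ => abs_nonneg _
  refine ⟨max 1 (2 * D / ε + 1), fun t ht => ?_⟩
  have ht0 : 0 < t := lt_of_lt_of_le one_pos ((le_max_left _ _).trans ht)
  have htD : 2 * D / ε + 1 ≤ t := (le_max_right _ _).trans ht
  have hs := hasSum_eventProbUpTo hθ ht0.le
  have hsx := summable_eventProbUpTo_mul hθ ht0.le hB
  have hdiff : ∑' k, eventProbUpTo θ t k * x k - θ * t * L
      = ∑' k, eventProbUpTo θ t k * (x k - L) := by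
    rw [← hs.tsum_eq, ← tsum_mul_right, ← hsx.tsum_sub (hs.summable.mul_right L)]
    simp only [mul_sub]
  have hbound : ∀ k, |x k - L| ≤ (if k ∈ Finset.range K then |x k - L| else 0) + ε / (2 * θ) := by
    intro k
    split_ifs with hk
    · linarith
    · have := hK k (by simpa using hk)
      rw [Real.dist_eq] at this; linarith
  have hfin : Summable fun k => (if k ∈ Finset.range K then |x k - L| else 0) :=
    summable_of_hasFiniteSupport ((Finset.range K).finite_toSet.subset fun k hk => by
      by_contra h; simp only [Function.mem_support] at hk; exact hk (if_neg (by simpa using h)))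
  have hsumle : |∑' k, eventProbUpTo θ t k * (x k - L)| ≤ D + θ * t * (ε / (2 * θ)) := by
    have h1 : Summable fun k => |eventProbUpTo θ t k * (x k - L)| := by
      have : Summable fun k => eventProbUpTo θ t k * (x k - L) := by
        simp only [mul_sub]; exact hsx.sub (hs.summable.mul_right L)
      exact this.abs
    have h2 : ∑' k, |eventProbUpTo θ t k * (x k - L)|
        ≤ ∑' k, ((if k ∈ Finset.range K then |x k - L| else 0)
          + eventProbUpTo θ t k * (ε / (2 * θ))) := by
      refine h1.tsum_le_tsum (fun k => ?_) (hfin.add (hs.summable.mul_right _))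
      rw [abs_mul, abs_of_nonneg (eventProbUpTo_nonneg θ t k)]
      have h3 := mul_le_mul_of_nonneg_left (hbound k) (eventProbUpTo_nonneg θ t k)
      have h4 : eventProbUpTo θ t k * (if k ∈ Finset.range K then |x k - L| else 0)
          ≤ (if k ∈ Finset.range K then |x k - L| else 0) := by
        refine mul_le_of_le_one_left ?_ (eventProbUpTo_le_one hθ t k)
        split_ifs <;> positivity
      linarith
    rw [hfin.tsum_add (hs.summable.mul_right _), tsum_mul_right, hs.tsum_eq] at h2
    have h5 : ∑' k, (if k ∈ Finset.range K then |x k - L| else 0) = D := by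
      rw [tsum_eq_sum (s := Finset.range K) (fun k hk => if_neg hk)]
      exact Finset.sum_congr rfl fun k hk => if_pos hk
    rw [h5] at h2
    refine le_trans ?_ h2
    exact norm_tsum_le_tsum_norm (f := fun k => eventProbUpTo θ t k * (x k - L)) h1
  rw [Real.dist_eq]
  have h6 : (∑' k, eventProbUpTo θ t k * x k) / t - θ * L
      = (∑' k, eventProbUpTo θ t k * (x k - L)) / t := by
    rw [← hdiff]; field_simp
  rw [h6, abs_div, abs_of_pos ht0, div_lt_iff₀ ht0]
  have h7 : θ * t * (ε / (2 * θ)) = ε * t / 2 := by field_simp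
  have h8 : D < ε * t / 2 := by
    have : 2 * D / ε < t := by linarith
    rw [div_lt_iff₀ hε] at this; linarith
  linarith

end Renewal

end ProbabilityTheory

/-! ### The length of a queue -/

namespace ProbabilityTheory

open MeasureTheory Topology

section TailRecursion

variable {u d : ℝ} {G : ℕ → ℕ → ℝ}

theorem tail_le_pow (hu : 0 ≤ u) (hd : 0 < d) (hs : u + d ≤ 1)
    (h0 : ∀ k, G k 0 = 1) (hinit : ∀ j, G 0 (j + 1) = 0)
    (hrec : ∀ k j, G (k + 1) (j + 1) = u * G k j + d * G k (j + 2) + (1 - u - d) * G k (j + 1))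
    (k j : ℕ) : G k j ≤ (u / d) ^ j := by
  have hρ : 0 ≤ u / d := by positivity
  induction k generalizing j with
  | zero =>
    cases j with
    | zero => simp [h0]
    | succ j => rw [hinit]; positivity
  | succ k ih =>
    cases j with
    | zero => simp [h0]
    | succ j =>
      have hu' : u = (u / d) * d := by field_simp
      calc G (k + 1) (j + 1) = u * G k j + d * G k (j + 2) + (1 - u - d) * G k (j + 1) := hrec k j
        _ ≤ u * (u / d) ^ j + d * (u / d) ^ (j + 2) + (1 - u - d) * (u / d) ^ (j + 1) := by
            gcongr
            · exact ih j
            · exact ih (j + 2)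
            · linarith
            · exact ih (j + 1)
        _ = (u / d) ^ (j + 1) := by
            generalize hr : u / d = ρ at hu'
            rw [hu']; ring

theorem tail_nonneg (hu : 0 ≤ u) (hd : 0 < d) (hs : u + d ≤ 1)
    (h0 : ∀ k, G k 0 = 1) (hinit : ∀ j, G 0 (j + 1) = 0)
    (hrec : ∀ k j, G (k + 1) (j + 1) = u * G k j + d * G k (j + 2) + (1 - u - d) * G k (j + 1))
    (k j : ℕ) : 0 ≤ G k j := by
  induction k generalizing j with
  | zero =>
    cases j with
    | zero => simp [h0]
    | succ j => rw [hinit]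
  | succ k ih =>
    cases j with
    | zero => simp [h0]
    | succ j =>
      rw [hrec]
      have := mul_nonneg hu (ih j)
      have := mul_nonneg hd.le (ih (j + 2))
      have := mul_nonneg (show 0 ≤ 1 - u - d by linarith) (ih (j + 1))
      linarith

theorem tail_mono (hu : 0 ≤ u) (hd : 0 < d) (hs : u + d ≤ 1)
    (h0 : ∀ k, G k 0 = 1) (hinit : ∀ j, G 0 (j + 1) = 0)
    (hrec : ∀ k j, G (k + 1) (j + 1) = u * G k j + d * G k (j + 2) + (1 - u - d) * G k (j + 1))
    (j : ℕ) : Monotone fun k => G k j := by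
  refine monotone_nat_of_le_succ fun k => ?_
  induction k generalizing j with
  | zero =>
    cases j with
    | zero => simp [h0]
    | succ j => rw [hinit]; exact tail_nonneg hu hd hs h0 hinit hrec _ _
  | succ k ih =>
    cases j with
    | zero => simp [h0]
    | succ j =>
      rw [hrec, hrec]
      gcongr
      · exact ih j
      · exact ih (j + 2)
      · linarith
      · exact ih (j + 1)

/-- The tail probabilities of a birth-death chain started at zero increase to those of the geometric
law. The limit solves the stationarity equation, and every solution other than `(u / d) ^ j` leaves
the interval between `0` and `(u / d) ^ j`. -/
theorem tendsto_tail (hu : 0 ≤ u) (hud : u ≤ d) (hd : 0 < d) (hs : u + d ≤ 1)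
    (h0 : ∀ k, G k 0 = 1) (hinit : ∀ j, G 0 (j + 1) = 0)
    (hrec : ∀ k j, G (k + 1) (j + 1) = u * G k j + d * G k (j + 2) + (1 - u - d) * G k (j + 1))
    (j : ℕ) : Tendsto (fun k => G k j) atTop (𝓝 ((u / d) ^ j)) := by
  have hle := tail_le_pow hu hd hs h0 hinit hrec
  have hnn := tail_nonneg hu hd hs h0 hinit hrec
  have hex : ∀ j, ∃ l, Tendsto (fun k => G k j) atTop (𝓝 l) := fun j =>
    ⟨_, tendsto_atTop_ciSup (tail_mono hu hd hs h0 hinit hrec j)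
      ⟨(u / d) ^ j, by rintro _ ⟨k, rfl⟩; exact hle k j⟩⟩
  choose g hg using hex
  have hg0 : g 0 = 1 := tendsto_nhds_unique (hg 0) (by simp [h0])
  have hgle : ∀ j, g j ≤ (u / d) ^ j := fun j => le_of_tendsto' (hg j) fun k => hle k j
  have hgnn : ∀ j, 0 ≤ g j := fun j => ge_of_tendsto' (hg j) fun k => hnn k j
  have hgrec : ∀ j, g (j + 1) = u * g j + d * g (j + 2) + (1 - u - d) * g (j + 1) := by
    intro j
    refine tendsto_nhds_unique ((tendsto_add_atTop_iff_nat 1).2 (hg (j + 1))) ?_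
    simp only [hrec]
    exact (((hg j).const_mul u).add ((hg (j + 2)).const_mul d)).add
      ((hg (j + 1)).const_mul (1 - u - d))
  generalize hr : u / d = ρ at *
  have hu' : u = ρ * d := by rw [← hr]; field_simp
  have hρ0 : 0 ≤ ρ := by rw [← hr]; positivity
  have hρ1 : ρ ≤ 1 := by rw [← hr]; exact (div_le_one hd).2 hud
  suffices h : g j = ρ ^ j by rw [← h]; exact hg j
  have hstep : ∀ j, g (j + 1) - g (j + 2) = ρ * (g j - g (j + 1)) := by
    intro j
    have h1 : d * (g (j + 1) - g (j + 2)) = d * (ρ * (g j - g (j + 1))) := by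
      have := hgrec j
      rw [hu'] at this
      linear_combination this
    exact mul_left_cancel₀ hd.ne' h1
  set D := ρ - g 1 with hD
  have hdiff : ∀ j, g j - g (j + 1) = ρ ^ j - ρ ^ (j + 1) + D * ρ ^ j := by
    intro j
    induction j with
    | zero => rw [hD, hg0]; ring
    | succ j ih => rw [hstep, ih]; ring
  have hform : ∀ j, g j = ρ ^ j - D * ∑ i ∈ Finset.range j, ρ ^ i := by
    intro j
    induction j with
    | zero => simp [hg0]
    | succ j ih =>
      rw [Finset.sum_range_succ]
      have := hdiff j
      linear_combination ih - this
  have hD0 : 0 ≤ D := by have := hgle 1; rw [hD]; linarith [pow_one ρ]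
  rcases eq_or_lt_of_le hρ0 with h | h
  · cases j with
    | zero => simp [hg0]
    | succ j =>
      have h1 := hgle (j + 1)
      have h2 := hgnn (j + 1)
      rw [← h] at h1 ⊢
      simp only [ne_eq, Nat.add_eq_zero_iff, one_ne_zero, and_false, not_false_eq_true,
        zero_pow] at h1 ⊢
      linarith
  · have hDj : ∀ j : ℕ, D * j ≤ 1 := by
      intro j
      have h1 := hgnn j
      rw [hform j] at h1
      have h2 : (j : ℝ) * ρ ^ j ≤ ∑ i ∈ Finset.range j, ρ ^ i := by
        rw [← nsmul_eq_mul, ← Finset.card_range j, ← Finset.sum_const, Finset.card_range]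
        exact Finset.sum_le_sum fun i hi =>
          pow_le_pow_of_le_one hρ0 hρ1 (Finset.mem_range.1 hi).le
      have h3 : D * j * ρ ^ j ≤ 1 * ρ ^ j := by
        have := mul_le_mul_of_nonneg_left h2 hD0
        linarith
      exact le_of_mul_le_mul_right h3 (pow_pos h j)
    have hD1 : D = 0 := by
      refine le_antisymm ?_ hD0
      by_contra hpos
      push Not at hpos
      obtain ⟨n, hn⟩ := exists_nat_gt (1 / D)
      have := hDj n
      rw [div_lt_iff₀ hpos] at hn
      linarith
    rw [hform j, hD1]; ring

end TailRecursion

section BirthDeath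

variable {E : Type*}

/-- The population size at time `k` when the letters `e 0, …, e (k - 1)` are read, where the letter
`x` changes the size by `σ x`, and a death in the empty population has no effect. -/
def birthDeath (σ : E → ℤ) (e : ℕ → E) : ℕ → ℕ
  | 0 => 0
  | k + 1 => (birthDeath σ e k + σ (e k)).toNat

theorem birthDeath_dependsOn (σ : E → ℤ) (k : ℕ) :
    DependsOn (fun e => birthDeath σ e k) (Finset.range k : Set ℕ) := by
  induction k with
  | zero => intro e e' _; rfl
  | succ k ih =>
    intro e e' h
    simp only [birthDeath]
    rw [h k (by simp), show birthDeath σ e k = birthDeath σ e' k from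
      ih fun i hi => h i (by simp at hi ⊢; omega)]

theorem birthDeath_le {σ : E → ℤ} (hσ : ∀ x, σ x ≤ 1) (e : ℕ → E) (k : ℕ) :
    birthDeath σ e k ≤ k := by
  induction k with
  | zero => simp [birthDeath]
  | succ k ih => simp only [birthDeath]; have := hσ (e k); omega

variable [Fintype E] [MeasurableSpace E] [DiscreteMeasurableSpace E]
  {P : Measure E} [IsProbabilityMeasure P] {σ : E → ℤ}

theorem sum_measureReal_singleton_mul_ite (P : Measure E) [IsFiniteMeasure P] (p : E → Prop)
    [DecidablePred p] : ∑ x, P.real {x} * (if p x then 1 else 0) = P.real {x | p x} := by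
  classical
  simp only [mul_ite, mul_one, mul_zero, ← Finset.sum_filter]
  have h := sum_measureReal_singleton (μ := P) (Finset.univ.filter p)
  rw [h]; congr 1; ext x; simp

/-- The probability that the population at time `k` is at least `j`. -/
noncomputable def birthDeathTail (P : Measure E) (σ : E → ℤ) (k j : ℕ) : ℝ :=
  ∫ e, (if j ≤ birthDeath σ e k then 1 else 0) ∂Measure.infinitePi fun _ : ℕ => P

theorem dependsOn_birthDeath_comp {β : Type*} (f : ℕ → β) (k : ℕ) :
    DependsOn (fun e => f (birthDeath σ e k)) (Finset.range k : Set ℕ) :=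
  fun _ _ h => congrArg f (birthDeath_dependsOn σ k h)

theorem integrable_birthDeath_comp (f : ℕ → ℝ) (k : ℕ) :
    Integrable (fun e => f (birthDeath σ e k)) (Measure.infinitePi fun _ : ℕ => P) :=
  (dependsOn_birthDeath_comp f k).integrable_of_finite _

theorem birthDeathTail_zero_right (k : ℕ) : birthDeathTail P σ k 0 = 1 := by
  simp [birthDeathTail]

theorem birthDeathTail_zero_left (j : ℕ) : birthDeathTail P σ 0 (j + 1) = 0 := by
  simp [birthDeathTail, birthDeath]

theorem birthDeathTail_succ (hσ : ∀ x, σ x = -1 ∨ σ x = 0 ∨ σ x = 1) (k j : ℕ) :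
    birthDeathTail P σ (k + 1) (j + 1)
      = P.real {x | σ x = 1} * birthDeathTail P σ k j
        + P.real {x | σ x = -1} * birthDeathTail P σ k (j + 2)
        + (1 - P.real {x | σ x = 1} - P.real {x | σ x = -1}) * birthDeathTail P σ k (j + 1) := by
  classical
  have h1 : birthDeathTail P σ (k + 1) (j + 1)
      = ∑ x, P.real {x} * ∫ e, (if j + 1 ≤ ((birthDeath σ e k : ℤ) + σ x).toNat then (1 : ℝ) else 0)
          ∂Measure.infinitePi fun _ : ℕ => P := by
    rw [← integral_infinitePi_step P (k := k)]
    · rfl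
    · intro x
      exact dependsOn_birthDeath_comp
        (fun q => if j + 1 ≤ ((q : ℤ) + σ x).toNat then (1 : ℝ) else 0) k
  have h2 : ∀ x, ∫ e, (if j + 1 ≤ ((birthDeath σ e k : ℤ) + σ x).toNat then (1 : ℝ) else 0)
          ∂Measure.infinitePi (fun _ : ℕ => P)
      = (if σ x = 1 then 1 else 0) * birthDeathTail P σ k j
        + (if σ x = -1 then 1 else 0) * birthDeathTail P σ k (j + 2)
        + (1 - (if σ x = 1 then 1 else 0) - (if σ x = -1 then 1 else 0))
          * birthDeathTail P σ k (j + 1) := by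
    intro x
    rcases hσ x with h | h | h <;> rw [h] <;> norm_num <;> unfold birthDeathTail <;>
      · refine integral_congr_ae (Eventually.of_forall fun e => ?_)
        exact if_congr (by omega) rfl rfl
  rw [h1]
  simp only [h2]
  rw [← sum_measureReal_singleton_mul_ite P (fun x => σ x = 1),
    ← sum_measureReal_singleton_mul_ite P (fun x => σ x = -1)]
  have h3 : ∑ x, P.real {x} = 1 := by
    have := sum_measureReal_singleton (μ := P) Finset.univ
    rw [this]; simp
  rw [show (1 : ℝ) - ∑ x, P.real {x} * (if σ x = 1 then 1 else 0)
      - ∑ x, P.real {x} * (if σ x = -1 then 1 else 0) = ∑ x, P.real {x}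
      - ∑ x, P.real {x} * (if σ x = 1 then 1 else 0)
      - ∑ x, P.real {x} * (if σ x = -1 then 1 else 0) by rw [h3],
    Finset.sum_mul, Finset.sum_mul, ← Finset.sum_sub_distrib, ← Finset.sum_sub_distrib,
    Finset.sum_mul, ← Finset.sum_add_distrib, ← Finset.sum_add_distrib]
  refine Finset.sum_congr rfl fun x _ => ?_
  ring

theorem birth_add_death_le_one : P.real {x | σ x = 1} + P.real {x | σ x = -1} ≤ 1 := by
  rw [← measureReal_union _ MeasurableSet.of_discrete]
  · exact measureReal_le_one
  · refine Set.disjoint_left.2 fun x h1 h2 => ?_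
    simp only [Set.mem_ofPred_eq] at h1 h2
    omega

/-- The mean population at time `k`. -/
noncomputable def birthDeathMean (P : Measure E) (σ : E → ℤ) (k : ℕ) : ℝ :=
  ∫ e, (birthDeath σ e k : ℝ) ∂Measure.infinitePi fun _ : ℕ => P

theorem birthDeathMean_nonneg (k : ℕ) : 0 ≤ birthDeathMean P σ k :=
  integral_nonneg fun _ => Nat.cast_nonneg _

theorem sum_tail_le_mean (k J : ℕ) :
    ∑ j ∈ Finset.range J, birthDeathTail P σ k (j + 1) ≤ birthDeathMean P σ k := by
  unfold birthDeathTail birthDeathMean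
  rw [← integral_finsetSum]
  · refine integral_mono ?_ (integrable_birthDeath_comp _ k) fun e => ?_
    · exact integrable_finsetSum _ fun j _ =>
        integrable_birthDeath_comp (fun q => if j + 1 ≤ q then (1 : ℝ) else 0) k
    · simp only
      rw [← Finset.sum_filter, Finset.sum_const, nsmul_eq_mul, mul_one, Nat.cast_le]
      calc _ ≤ (Finset.range (birthDeath σ e k)).card := Finset.card_le_card fun j hj => by
              simp at hj ⊢; omega
        _ = _ := Finset.card_range _
  · exact fun j _ => integrable_birthDeath_comp (fun q => if j + 1 ≤ q then (1 : ℝ) else 0) k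

theorem mean_eq_tsum_tail (hσ : ∀ x, σ x ≤ 1) (k : ℕ) :
    birthDeathMean P σ k = ∑' j, birthDeathTail P σ k (j + 1) := by
  rw [tsum_eq_sum (s := Finset.range k)]
  · unfold birthDeathTail birthDeathMean
    rw [← integral_finsetSum]
    · refine integral_congr_ae (Eventually.of_forall fun e => ?_)
      simp only
      rw [← Finset.sum_filter, Finset.sum_const, nsmul_eq_mul, mul_one, Nat.cast_inj]
      have h : (Finset.range k).filter (fun j => j + 1 ≤ birthDeath σ e k)
          = Finset.range (birthDeath σ e k) := by
        have := birthDeath_le hσ e k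
        ext j; simp; omega
      rw [h, Finset.card_range]
    · exact fun j _ => integrable_birthDeath_comp (fun q => if j + 1 ≤ q then (1 : ℝ) else 0) k
  · intro j hj
    unfold birthDeathTail
    refine integral_eq_zero_of_ae (Eventually.of_forall fun e => ?_)
    have := birthDeath_le hσ e k
    have h : ¬ j + 1 ≤ birthDeath σ e k := by
      simp only [Finset.mem_range, not_lt] at hj
      omega
    exact if_neg h

variable (hσ : ∀ x, σ x = -1 ∨ σ x = 0 ∨ σ x = 1)
include hσ

theorem tendsto_birthDeathTail (hud : P.real {x | σ x = 1} ≤ P.real {x | σ x = -1})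
    (hd : 0 < P.real {x | σ x = -1}) (j : ℕ) :
    Tendsto (fun k => birthDeathTail P σ k j) atTop
      (𝓝 ((P.real {x | σ x = 1} / P.real {x | σ x = -1}) ^ j)) :=
  tendsto_tail measureReal_nonneg hud hd birth_add_death_le_one birthDeathTail_zero_right
    birthDeathTail_zero_left (birthDeathTail_succ hσ) j

/-- A subcritical queue settles to a geometric length. -/
theorem tendsto_birthDeathMean (hud : P.real {x | σ x = 1} < P.real {x | σ x = -1}) :
    Tendsto (birthDeathMean P σ) atTop
      (𝓝 (P.real {x | σ x = 1} / (P.real {x | σ x = -1} - P.real {x | σ x = 1}))) := by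
  have hd : 0 < P.real {x | σ x = -1} := lt_of_le_of_lt measureReal_nonneg hud
  have hu : 0 ≤ P.real {x | σ x = 1} := measureReal_nonneg
  set u := P.real {x | σ x = 1}
  set d := P.real {x | σ x = -1}
  have hρ : u / d < 1 := (div_lt_one hd).2 hud
  have hρ0 : 0 ≤ u / d := by positivity
  have hlim : ∑' j : ℕ, (u / d) ^ (j + 1) = u / (d - u) := by
    simp only [pow_succ']
    rw [tsum_mul_left, tsum_geometric_of_lt_one hρ0 hρ]
    have : d - u ≠ 0 := by linarith [hud]
    have : 1 - u / d ≠ 0 := by linarith [hρ]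
    field_simp
  rw [← hlim]
  have hmean : birthDeathMean P σ = fun k => ∑' j, birthDeathTail P σ k (j + 1) :=
    funext fun k => mean_eq_tsum_tail (fun x => by rcases hσ x with h | h | h <;> omega) k
  rw [hmean]
  refine tendsto_tsum_of_dominated_convergence (bound := fun j => (u / d) ^ (j + 1)) ?_
    (fun j => tendsto_birthDeathTail hσ hud.le hd (j + 1)) (Eventually.of_forall fun k j => ?_)
  · exact (summable_nat_add_iff 1).2 (summable_geometric_of_lt_one hρ0 hρ)
  · rw [Real.norm_eq_abs, abs_of_nonneg (tail_nonneg hu hd birth_add_death_le_one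
      birthDeathTail_zero_right birthDeathTail_zero_left (birthDeathTail_succ hσ) k (j + 1))]
    exact tail_le_pow hu hd birth_add_death_le_one birthDeathTail_zero_right
      birthDeathTail_zero_left (birthDeathTail_succ hσ) k (j + 1)

/-- A critical queue grows beyond all bounds on average. -/
theorem tendsto_birthDeathMean_atTop (hud : P.real {x | σ x = 1} = P.real {x | σ x = -1})
    (hd : 0 < P.real {x | σ x = -1}) : Tendsto (birthDeathMean P σ) atTop atTop := by
  refine tendsto_atTop.2 fun b => ?_
  obtain ⟨J, hJ⟩ := exists_nat_gt b
  have h1 : Tendsto (fun k => ∑ j ∈ Finset.range J, birthDeathTail P σ k (j + 1)) atTop (𝓝 J) := by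
    have : (J : ℝ) = ∑ j ∈ Finset.range J,
        (P.real {x | σ x = 1} / P.real {x | σ x = -1}) ^ (j + 1) := by
      rw [hud, div_self hd.ne']; simp
    rw [this]
    exact tendsto_finsetSum _ fun j _ => tendsto_birthDeathTail hσ hud.le hd (j + 1)
  filter_upwards [h1.eventually (lt_mem_nhds hJ)] with k hk
  exact hk.le.trans (sum_tail_le_mean k J)

end BirthDeath

end ProbabilityTheory

/-! ### The two-class priority queue -/

namespace PriorityQueue

variable {E : Type*} (κ : E → Option FeeLevel)

/-- The customer generated at time `j` goes before the one generated at time `k`: either he alone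
has high priority, or both have the same priority and he came first. The kind `κ x` of a letter `x`
is the priority of the customer that it brings, or `none` for a service. -/
def Precedes (e : ℕ → E) (j k : ℕ) : Prop :=
  (κ (e j) = some .high ∧ κ (e k) ≠ some .high) ∨
    ((κ (e j) = some .high ↔ κ (e k) = some .high) ∧ j ≤ k)

open scoped Classical in
/-- The customer that goes before all others of the set `w`, as a set with at most one element. -/
noncomputable def front (e : ℕ → E) (w : Finset ℕ) : Finset ℕ :=
  w.filter fun k => ∀ j ∈ w, Precedes κ e k j

/-- The customers waiting at time `k`, labelled by their arrival times. The queue is empty at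
time `0`. -/
noncomputable def queue (e : ℕ → E) : ℕ → Finset ℕ
  | 0 => ∅
  | k + 1 =>
    match κ (e k) with
    | some _ => insert k (queue e k)
    | none => queue e k \ front κ e (queue e k)

variable {κ} {e : ℕ → E}

theorem precedes_refl (k : ℕ) : Precedes κ e k k := Or.inr ⟨Iff.rfl, le_rfl⟩

theorem precedes_antisymm {j k : ℕ} (h1 : Precedes κ e j k) (h2 : Precedes κ e k j) : j = k := by
  unfold Precedes at h1 h2
  rcases h1 with h1 | h1 <;> rcases h2 with h2 | h2
  · exact absurd h1.1 h2.2
  · exact absurd (h2.1.2 h1.1) h1.2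
  · exact absurd (h1.1.2 h2.1) h2.2
  · omega

theorem precedes_total (j k : ℕ) : Precedes κ e j k ∨ Precedes κ e k j := by
  unfold Precedes
  by_cases h1 : κ (e j) = some .high <;> by_cases h2 : κ (e k) = some .high <;>
    simp only [h1, h2] <;> simp <;> omega

theorem precedes_trans {i j k : ℕ} (h1 : Precedes κ e i j) (h2 : Precedes κ e j k) :
    Precedes κ e i k := by
  unfold Precedes at *
  by_cases hi : κ (e i) = some .high <;> by_cases hj : κ (e j) = some .high <;>
    by_cases hk : κ (e k) = some .high <;> simp_all <;> omega

@[simp] theorem front_empty : front κ e ∅ = ∅ := by simp [front]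

theorem front_subset (w : Finset ℕ) : front κ e w ⊆ w := by
  classical
  exact Finset.filter_subset _ _

theorem mem_front {w : Finset ℕ} {k : ℕ} :
    k ∈ front κ e w ↔ k ∈ w ∧ ∀ j ∈ w, Precedes κ e k j := by
  classical
  simp [front]

theorem exists_front_eq_singleton {w : Finset ℕ} (hw : w.Nonempty) :
    ∃ a ∈ w, front κ e w = {a} := by
  classical
  have h : ∃ a ∈ w, ∀ j ∈ w, Precedes κ e a j := by
    induction hw using Finset.Nonempty.cons_induction with
    | singleton a => exact ⟨a, by simp, by simp [precedes_refl]⟩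
    | cons a s ha hs ih =>
      obtain ⟨b, hb, hb2⟩ := ih
      rcases precedes_total (κ := κ) (e := e) a b with h | h
      · refine ⟨a, by simp, fun j hj => ?_⟩
        rcases Finset.mem_cons.1 hj with rfl | hj
        · exact precedes_refl _
        · exact precedes_trans h (hb2 j hj)
      · refine ⟨b, by simp [hb], fun j hj => ?_⟩
        rcases Finset.mem_cons.1 hj with rfl | hj
        · exact h
        · exact hb2 j hj
  obtain ⟨a, ha, ha2⟩ := h
  refine ⟨a, ha, ?_⟩
  ext k
  rw [mem_front, Finset.mem_singleton]
  constructor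
  · rintro ⟨hk, hk2⟩
    exact precedes_antisymm (hk2 a ha) (ha2 k hk)
  · rintro rfl
    exact ⟨ha, ha2⟩

theorem queue_succ_of_some {k : ℕ} {c : FeeLevel} (h : κ (e k) = some c) :
    queue κ e (k + 1) = insert k (queue κ e k) := by
  rw [queue, h]

theorem queue_succ_of_none {k : ℕ} (h : κ (e k) = none) :
    queue κ e (k + 1) = queue κ e k \ front κ e (queue κ e k) := by
  rw [queue, h]

theorem lt_of_mem_queue {k j : ℕ} (h : j ∈ queue κ e k) : j < k := by
  induction k with
  | zero => simp [queue] at h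
  | succ k ih =>
    rcases hc : κ (e k) with _ | c
    · rw [queue_succ_of_none hc, Finset.mem_sdiff] at h
      have := ih h.1
      omega
    · rw [queue_succ_of_some hc, Finset.mem_insert] at h
      rcases h with rfl | h
      · omega
      · have := ih h
        omega

theorem kind_ne_none_of_mem_queue {k j : ℕ} (h : j ∈ queue κ e k) : κ (e j) ≠ none := by
  induction k with
  | zero => simp [queue] at h
  | succ k ih =>
    rcases hc : κ (e k) with _ | c
    · rw [queue_succ_of_none hc, Finset.mem_sdiff] at h
      exact ih h.1
    · rw [queue_succ_of_some hc, Finset.mem_insert] at h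
      rcases h with rfl | h
      · simp [hc]
      · exact ih h

theorem notMem_queue_self (k : ℕ) : k ∉ queue κ e k := fun h => (lt_of_mem_queue h).false

theorem mem_queue_of_le {k i j : ℕ} (hki : k < i) (hij : i ≤ j) (h : k ∈ queue κ e j) :
    k ∈ queue κ e i := by
  induction j, hij using Nat.le_induction with
  | base => exact h
  | succ j hij ih =>
    refine ih ?_
    rcases hc : κ (e j) with _ | c
    · rw [queue_succ_of_none hc, Finset.mem_sdiff] at h
      exact h.1
    · rw [queue_succ_of_some hc, Finset.mem_insert] at h
      rcases h with rfl | h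
      · omega
      · exact h

theorem front_congr {e e' : ℕ → E} {w : Finset ℕ} (h : ∀ j ∈ w, e j = e' j) :
    front κ e w = front κ e' w := by
  ext k
  simp only [mem_front]
  refine and_congr_right fun hk => forall₂_congr fun j hj => ?_
  rw [Precedes, Precedes, h k hk, h j hj]

theorem queue_congr {e e' : ℕ → E} {k : ℕ} (h : ∀ i < k, e i = e' i) :
    queue κ e k = queue κ e' k := by
  induction k with
  | zero => rfl
  | succ k ih =>
    have h1 := ih fun i hi => h i (by omega)
    have h2 : front κ e (queue κ e k) = front κ e' (queue κ e k) :=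
      front_congr fun j hj => h j ((lt_of_mem_queue hj).trans (by omega))
    rw [queue, queue, h k (by omega), h2, h1]

/-- The change of the number of waiting customers. -/
def change (κ : E → Option FeeLevel) (x : E) : ℤ :=
  match κ x with
  | some _ => 1
  | none => -1

/-- The change of the number of waiting customers of high priority. -/
def changeHigh (κ : E → Option FeeLevel) (x : E) : ℤ :=
  match κ x with
  | some .high => 1
  | some .low => 0
  | none => -1

theorem card_queue (e : ℕ → E) (k : ℕ) :
    (queue κ e k).card = ProbabilityTheory.birthDeath (change κ) e k := by
  induction k with
  | zero => rfl
  | succ k ih =>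
    rw [ProbabilityTheory.birthDeath, ← ih]
    rcases hc : κ (e k) with _ | c
    · rw [queue_succ_of_none hc, Finset.card_sdiff_of_subset (front_subset _), change, hc]
      rcases (queue κ e k).eq_empty_or_nonempty with h | h
      · simp [h]
      · obtain ⟨a, -, h2⟩ := exists_front_eq_singleton (κ := κ) (e := e) h
        have := Finset.card_pos.2 h
        rw [h2, Finset.card_singleton]
        simp only
        omega
    · rw [queue_succ_of_some hc, Finset.card_insert_of_notMem (notMem_queue_self k), change, hc]
      simp only
      omega

/-- The waiting customers of high priority. -/
noncomputable def highQueue (κ : E → Option FeeLevel) (e : ℕ → E) (k : ℕ) : Finset ℕ :=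
  (queue κ e k).filter fun j => κ (e j) = some .high

theorem mem_highQueue {k j : ℕ} :
    j ∈ highQueue κ e k ↔ j ∈ queue κ e k ∧ κ (e j) = some .high := by
  simp [highQueue]

theorem kind_of_mem_front {w : Finset ℕ} {a j : ℕ} (ha : a ∈ front κ e w) (hj : j ∈ w)
    (hjh : κ (e j) = some .high) : κ (e a) = some .high := by
  rcases (mem_front.1 ha).2 j hj with h | h
  · exact h.1
  · exact h.1.2 hjh

theorem card_highQueue (e : ℕ → E) (k : ℕ) :
    (highQueue κ e k).card = ProbabilityTheory.birthDeath (changeHigh κ) e k := by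
  induction k with
  | zero => rfl
  | succ k ih =>
    rw [ProbabilityTheory.birthDeath, ← ih]
    rcases hc : κ (e k) with _ | c
    · rw [changeHigh, hc]
      rcases (highQueue κ e k).eq_empty_or_nonempty with h | h
      · have h2 : highQueue κ e (k + 1) = ∅ := by
          rw [highQueue, queue_succ_of_none hc]
          refine Finset.subset_empty.1 fun j hj => ?_
          rw [← h, mem_highQueue]
          simp only [Finset.mem_filter, Finset.mem_sdiff] at hj
          exact ⟨hj.1.1, hj.2⟩
        simp [h, h2]
      · obtain ⟨b, hb⟩ := h
        have hb' := mem_highQueue.1 hb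
        obtain ⟨a, ha, h2⟩ := exists_front_eq_singleton (κ := κ) (e := e) ⟨b, hb'.1⟩
        have haf : a ∈ front κ e (queue κ e k) := by simp [h2]
        have hah : κ (e a) = some .high := kind_of_mem_front haf hb'.1 hb'.2
        have h3 : highQueue κ e (k + 1) = (highQueue κ e k).erase a := by
          ext j
          rw [highQueue, queue_succ_of_none hc, h2, Finset.mem_erase, mem_highQueue]
          simp only [Finset.mem_filter, Finset.mem_sdiff, Finset.mem_singleton]
          tauto
        have hmem : a ∈ highQueue κ e k := mem_highQueue.2 ⟨ha, hah⟩
        have hpos := Finset.card_pos.2 ⟨a, hmem⟩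
        rw [h3, Finset.card_erase_of_mem hmem]
        simp only
        omega
    · rw [changeHigh, hc]
      cases c with
      | high =>
        have h3 : highQueue κ e (k + 1) = insert k (highQueue κ e k) := by
          ext j
          rw [highQueue, queue_succ_of_some hc, Finset.mem_insert, mem_highQueue]
          simp only [Finset.mem_filter, Finset.mem_insert]
          constructor
          · rintro ⟨rfl | h, h2⟩
            · exact Or.inl rfl
            · exact Or.inr ⟨h, h2⟩
          · rintro (rfl | h)
            · exact ⟨Or.inl rfl, hc⟩
            · exact ⟨Or.inr h.1, h.2⟩
        rw [h3, Finset.card_insert_of_notMem fun h =>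
          notMem_queue_self k (mem_highQueue.1 h).1]
        simp only
        omega
      | low =>
        have h3 : highQueue κ e (k + 1) = highQueue κ e k := by
          ext j
          rw [highQueue, queue_succ_of_some hc, mem_highQueue]
          simp only [Finset.mem_filter, Finset.mem_insert]
          constructor
          · rintro ⟨rfl | h, h2⟩
            · rw [hc] at h2
              simp at h2
            · exact ⟨h, h2⟩
          · rintro h
            exact ⟨Or.inr h.1, h.2⟩
        rw [h3]
        simp

open scoped Classical in
/-- The number of services after time `i` that customer `k` needs to be served himself if no
customer arrives any more: the number of waiting customers that do not go after him, or `0` if he is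
not waiting. -/
noncomputable def position (κ : E → Option FeeLevel) (e : ℕ → E) (k i : ℕ) : ℕ :=
  if k ∈ queue κ e i then ((queue κ e i).filter fun j => Precedes κ e j k).card else 0

theorem position_pos_iff {k i : ℕ} : 0 < position κ e k i ↔ k ∈ queue κ e i := by
  classical
  unfold position
  split_ifs with h
  · refine iff_of_true (Finset.card_pos.2 ⟨k, ?_⟩) h
    exact Finset.mem_filter.2 ⟨h, precedes_refl k⟩
  · exact iff_of_false (lt_irrefl 0) h

theorem position_congr {e e' : ℕ → E} {k i : ℕ} (hki : k < i) (h : ∀ j < i, e j = e' j) :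
    position κ e k i = position κ e' k i := by
  classical
  rw [position, position, queue_congr h]
  congr 2
  refine Finset.filter_congr fun j hj => ?_
  rw [Precedes, Precedes, h k hki, h j (lt_of_mem_queue hj)]

/-- The position of a low-priority customer on arrival. -/
theorem position_succ_self_low {k : ℕ} (h : κ (e k) = some .low) :
    position κ e k (k + 1) = (queue κ e k).card + 1 := by
  classical
  rw [position, queue_succ_of_some h, if_pos (Finset.mem_insert_self _ _),
    ← Finset.card_insert_of_notMem (notMem_queue_self (κ := κ) (e := e) k),
    Finset.filter_true_of_mem]
  intro j hj
  rcases Finset.mem_insert.1 hj with rfl | hj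
  · exact precedes_refl _
  · have := lt_of_mem_queue hj
    unfold Precedes
    rw [h]
    by_cases hh : κ (e j) = some .high <;> simp [hh, this.le]

/-- The position of a high-priority customer on arrival. -/
theorem position_succ_self_high {k : ℕ} (h : κ (e k) = some .high) :
    position κ e k (k + 1) = (highQueue κ e k).card + 1 := by
  classical
  rw [position, queue_succ_of_some h, if_pos (Finset.mem_insert_self _ _),
    ← Finset.card_insert_of_notMem fun h =>
      notMem_queue_self (κ := κ) (e := e) k (mem_highQueue.1 h).1]
  congr 1
  ext j
  simp only [Finset.mem_filter, Finset.mem_insert, mem_highQueue]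
  constructor
  · rintro ⟨rfl | hj, h2⟩
    · exact Or.inl rfl
    · refine Or.inr ⟨hj, ?_⟩
      rcases h2 with h2 | h2
      · exact h2.1
      · exact h2.1.2 h
  · rintro (rfl | ⟨hj, h2⟩)
    · exact ⟨Or.inl rfl, precedes_refl _⟩
    · exact ⟨Or.inr hj, Or.inr ⟨iff_of_true h2 h, (lt_of_mem_queue hj).le⟩⟩

/-- The change of the position of a waiting customer of priority `c` brought by a letter. -/
def drift (κ : E → Option FeeLevel) (c : FeeLevel) (x : E) : ℤ :=
  match κ x with
  | some .high => if c = .low then 1 else 0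
  | some .low => 0
  | none => -1

theorem position_succ {k i : ℕ} {c : FeeLevel} (hki : k < i) (hc : κ (e k) = some c) :
    (position κ e k (i + 1) : ℤ)
      = position κ e k i + if 0 < position κ e k i then drift κ c (e i) else 0 := by
  classical
  simp only [position_pos_iff]
  rcases hi : κ (e i) with _ | c'
  · rw [drift, hi, position, position, queue_succ_of_none hi]
    by_cases hk : k ∈ queue κ e i
    · obtain ⟨a, ha, h2⟩ := exists_front_eq_singleton (κ := κ) (e := e) ⟨k, hk⟩
      have haf : a ∈ front κ e (queue κ e i) := by simp [h2]
      rw [h2]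
      by_cases hka : k = a
      · subst hka
        have h3 : ((queue κ e i).filter fun j => Precedes κ e j k) = {k} := by
          ext j
          simp only [Finset.mem_filter, Finset.mem_singleton]
          constructor
          · rintro ⟨hj, hjk⟩
            exact precedes_antisymm hjk ((mem_front.1 haf).2 j hj)
          · rintro rfl
            exact ⟨hk, precedes_refl _⟩
        simp [hk, h3]
      · have hk' : k ∈ queue κ e i \ {a} := by simp [hk, hka]
        have h3 : ((queue κ e i \ {a}).filter fun j => Precedes κ e j k)
            = ((queue κ e i).filter fun j => Precedes κ e j k).erase a := by
          ext j
          simp only [Finset.mem_filter, Finset.mem_sdiff, Finset.mem_singleton, Finset.mem_erase]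
          tauto
        have hm : a ∈ (queue κ e i).filter fun j => Precedes κ e j k :=
          Finset.mem_filter.2 ⟨ha, (mem_front.1 haf).2 k hk⟩
        have hpos := Finset.card_pos.2 ⟨a, hm⟩
        rw [if_pos hk', if_pos hk, if_pos hk, h3, Finset.card_erase_of_mem hm]
        simp only
        omega
    · simp [hk]
  · rw [drift, hi, position, position, queue_succ_of_some hi]
    by_cases hk : k ∈ queue κ e i
    · rw [if_pos (Finset.mem_insert_of_mem hk), if_pos hk, if_pos hk, Finset.filter_insert]
      have hni : i ∉ (queue κ e i).filter fun j => Precedes κ e j k := fun h =>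
        notMem_queue_self i (Finset.mem_filter.1 h).1
      have h4 : Precedes κ e i k ↔ c' = .high ∧ c = .low := by
        unfold Precedes
        rw [hi, hc]
        cases c <;> cases c' <;> simp <;> omega
      by_cases h5 : Precedes κ e i k
      · rw [if_pos h5, Finset.card_insert_of_notMem hni]
        obtain ⟨rfl, rfl⟩ := h4.1 h5
        simp
      · rw [if_neg h5]
        rw [h4] at h5
        cases c <;> cases c' <;> simp at h5 ⊢
    · have hk' : k ∉ insert i (queue κ e i) := by
        simp [hk, hki.ne]
      simp [hk, hk']

/-- The customer served next has high priority if and only if some waiting customer has. -/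
theorem card_front_high (k : ℕ) :
    ((front κ e (queue κ e k)).filter fun j => κ (e j) = some .high).card
      = if 0 < (highQueue κ e k).card then 1 else 0 := by
  split_ifs with h
  · obtain ⟨b, hb⟩ := Finset.card_pos.1 h
    have hb' := mem_highQueue.1 hb
    obtain ⟨a, ha, h2⟩ := exists_front_eq_singleton (κ := κ) (e := e) ⟨b, hb'.1⟩
    have haf : a ∈ front κ e (queue κ e k) := by simp [h2]
    have hah : κ (e a) = some .high := kind_of_mem_front haf hb'.1 hb'.2
    rw [h2, Finset.filter_singleton, if_pos hah, Finset.card_singleton]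
  · rw [Finset.card_eq_zero, Finset.filter_eq_empty_iff]
    intro j hj hj2
    exact h (Finset.card_pos.2 ⟨j, mem_highQueue.2 ⟨front_subset _ hj, hj2⟩⟩)

theorem card_front (k : ℕ) :
    (front κ e (queue κ e k)).card = if 0 < (queue κ e k).card then 1 else 0 := by
  split_ifs with h
  · obtain ⟨a, ha, h2⟩ := exists_front_eq_singleton (κ := κ) (e := e) (Finset.card_pos.1 h)
    rw [h2, Finset.card_singleton]
  · have : queue κ e k = ∅ := by
      rw [← Finset.card_eq_zero]; omega
    simp [this]

end PriorityQueue

/-! ### Mean waiting times and service rates -/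

namespace PriorityQueue

open ProbabilityTheory Topology

variable {E : Type*} [Fintype E] [MeasurableSpace E] [DiscreteMeasurableSpace E]
  (P : Measure E) [IsProbabilityMeasure P] (κ : E → Option FeeLevel)

/-- If the mean `a` of an absorbed walk with drift `-δ` and its second moment `b` satisfy the usual
recursions, where `p` is the probability of not being absorbed, then the mean absorption time is
`a 0 / δ`. -/
theorem hasSum_survival {a b p : ℕ → ℝ} {δ v : ℝ} (hδ : 0 < δ) (hv : 0 ≤ v) (ha : ∀ i, 0 ≤ a i)
    (hb : ∀ i, 0 ≤ b i) (hp : ∀ i, 0 ≤ p i) (hrec : ∀ i, a (i + 1) = a i - δ * p i)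
    (hrec2 : ∀ i, b (i + 1) = b i - 2 * δ * a i + v * p i) : HasSum p (a 0 / δ) := by
  have h1 : ∀ n, ∑ i ∈ Finset.range n, p i = (a 0 - a n) / δ := by
    intro n
    rw [eq_div_iff hδ.ne']
    induction n with
    | zero => simp
    | succ n ih => rw [Finset.sum_range_succ, add_mul, ih, hrec]; ring
  have h2 : ∀ n, ∑ i ∈ Finset.range n, p i ≤ a 0 / δ := by
    intro n
    rw [h1]
    gcongr
    linarith [ha n]
  have h3 : ∀ n, ∑ i ∈ Finset.range n, a i
      = (b 0 - b n + v * ∑ i ∈ Finset.range n, p i) / (2 * δ) := by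
    intro n
    rw [eq_div_iff (by positivity)]
    induction n with
    | zero => simp
    | succ n ih => rw [Finset.sum_range_succ, add_mul, ih, hrec2, Finset.sum_range_succ]; ring
  have h4 : Summable a := by
    refine summable_of_sum_range_le ha (c := (b 0 + v * (a 0 / δ)) / (2 * δ)) fun n => ?_
    rw [h3]
    gcongr
    · linarith [hb n]
    · exact h2 n
  have h5 : Tendsto (fun n => ∑ i ∈ Finset.range n, p i) atTop (𝓝 (a 0 / δ)) := by
    simp only [h1]
    simpa using (h4.tendsto_atTop_zero.const_sub (a 0)).div_const δ
  exact (hasSum_iff_tendsto_nat_of_nonneg hp _).2 h5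

theorem change_cases (x : E) : change κ x = -1 ∨ change κ x = 0 ∨ change κ x = 1 := by
  unfold change
  rcases κ x with _ | (_ | _) <;> simp

theorem changeHigh_cases (x : E) :
    changeHigh κ x = -1 ∨ changeHigh κ x = 0 ∨ changeHigh κ x = 1 := by
  unfold changeHigh
  rcases κ x with _ | (_ | _) <;> simp

/-- The change of the number of waiting customers that a newly arrived customer of the given
priority would have to let pass. -/
def changeAhead : FeeLevel → E → ℤ
  | .high => changeHigh κ
  | .low => change κ

theorem changeAhead_cases (c : FeeLevel) (x : E) :
    changeAhead κ c x = -1 ∨ changeAhead κ c x = 0 ∨ changeAhead κ c x = 1 := by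
  cases c
  exacts [changeHigh_cases κ x, change_cases κ x]

variable {κ}

theorem position_succ_self {e : ℕ → E} {k : ℕ} {c : FeeLevel} (h : κ (e k) = some c) :
    position κ e k (k + 1) = birthDeath (changeAhead κ c) e k + 1 := by
  cases c with
  | high => rw [position_succ_self_high h, card_highQueue]; rfl
  | low => rw [position_succ_self_low h, card_queue]; rfl

theorem update_eq_of_lt {e : ℕ → E} {i j : ℕ} (y : E) (h : j < i) :
    e j = Function.update e i y j := (Function.update_of_ne h.ne _ _).symm

theorem birthDeath_update (σ : E → ℤ) (e : ℕ → E) (k : ℕ) (y : E) :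
    birthDeath σ (Function.update e k y) k = birthDeath σ e k :=
  birthDeath_dependsOn σ k fun j hj =>
    (update_eq_of_lt (e := e) y (by simpa using hj)).symm

theorem dependsOn_position {x : E} {k i : ℕ} (hki : k < i) (f : ℕ → ℝ) :
    DependsOn (fun e : ℕ → E => Set.indicator {x} 1 (e k) * f (position κ e k i))
      (Finset.range i : Set ℕ) := by
  intro e e' h
  simp only
  rw [h k (by simpa using hki), position_congr hki fun j hj => h j (by simpa using hj)]

/-- The mean waiting time, in number of events, of the customer that arrives at time `k`: it is the
time that a walk with the drift of his position needs from his position on arrival to zero. -/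
theorem hasSum_prob_waiting {c : FeeLevel} {x : E} (hx : κ x = some c)
    (hδ : 0 < -∫ y, (drift κ c y : ℝ) ∂P) (k : ℕ) :
    HasSum (fun i => (Measure.infinitePi fun _ : ℕ => P).real
        {e | e k = x ∧ k ∈ queue κ e (k + 1 + i)})
      (P.real {x} * (birthDeathMean P (changeAhead κ c) k + 1) / -∫ y, (drift κ c y : ℝ) ∂P) := by
  classical
  set μ := Measure.infinitePi fun _ : ℕ => P with hμ
  set δ := -∫ y, (drift κ c y : ℝ) ∂P with hδdef
  set v := ∫ y, ((drift κ c y : ℝ)) ^ 2 ∂P with hvdef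
  set h : (ℕ → E) → ℝ := fun e => Set.indicator {x} 1 (e k) with hh
  have hnn : ∀ e, 0 ≤ h e := fun e => Set.indicator_nonneg (fun _ _ => zero_le_one) _
  set a : ℕ → ℝ := fun i => ∫ e, h e * (position κ e k (k + 1 + i) : ℝ) ∂μ with ha
  set b : ℕ → ℝ := fun i => ∫ e, h e * (position κ e k (k + 1 + i) : ℝ) ^ 2 ∂μ with hb
  set p : ℕ → ℝ := fun i => ∫ e, h e * (if 0 < position κ e k (k + 1 + i) then 1 else 0) ∂μ with hp
  have hint : ∀ (f : ℕ → ℝ) (i : ℕ),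
      Integrable (fun e => h e * f (position κ e k (k + 1 + i))) μ := fun f i =>
    (dependsOn_position (by omega) f).integrable_of_finite _
  have hmul : ∀ (f : ℕ → ℝ) (g : E → ℝ) (i : ℕ),
      ∫ e, h e * f (position κ e k (k + 1 + i)) * g (e (k + 1 + i)) ∂μ
        = (∫ e, h e * f (position κ e k (k + 1 + i)) ∂μ) * ∫ y, g y ∂P := by
    intro f g i
    refine integral_infinitePi_mul_apply P (fun e y => ?_) g
      (dependsOn_position (by omega) f).measurable_of_finite
    simp only [hh]
    rw [← update_eq_of_lt (e := e) y (show k < k + 1 + i by omega),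
      ← position_congr (show k < k + 1 + i by omega) fun j hj => update_eq_of_lt (e := e) y hj]
  have hintm : ∀ (f : ℕ → ℝ) (g : E → ℝ) (i : ℕ),
      Integrable (fun e => h e * f (position κ e k (k + 1 + i)) * g (e (k + 1 + i))) μ := by
    intro f g i
    refine DependsOn.integrable_of_finite (s := Finset.range (k + 1 + i + 1)) (fun e e' hee => ?_) _
    have h1 := dependsOn_position (κ := κ) (x := x) (show k < k + 1 + i by omega) f
      (fun j hj => hee j (by simp at hj ⊢; omega))
    simp only [hh] at h1 ⊢
    rw [h1, hee (k + 1 + i) (by simp)]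
  -- On the event that customer `k` is brought by the letter `x`, his position is a walk.
  have hpos : ∀ i e, h e * (position κ e k (k + 1 + i + 1) : ℝ)
      = h e * (position κ e k (k + 1 + i) : ℝ)
        + h e * (if 0 < position κ e k (k + 1 + i) then 1 else 0)
          * (drift κ c (e (k + 1 + i)) : ℝ) := by
    intro i e
    by_cases hek : e k = x
    · have h1 := position_succ (κ := κ) (e := e) (c := c) (show k < k + 1 + i by omega)
        (by rw [hek, hx])
      have h2 : (position κ e k (k + 1 + i + 1) : ℝ) = position κ e k (k + 1 + i)
          + if 0 < position κ e k (k + 1 + i) then (drift κ c (e (k + 1 + i)) : ℝ) else 0 := by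
        exact_mod_cast h1
      rw [h2]
      split_ifs <;> ring
    · simp [hh, hek]
  have hpos2 : ∀ i e, h e * (position κ e k (k + 1 + i + 1) : ℝ) ^ 2
      = h e * (position κ e k (k + 1 + i) : ℝ) ^ 2
        + h e * (2 * (position κ e k (k + 1 + i) : ℝ)) * (drift κ c (e (k + 1 + i)) : ℝ)
        + h e * (if 0 < position κ e k (k + 1 + i) then 1 else 0)
          * (drift κ c (e (k + 1 + i)) : ℝ) ^ 2 := by
    intro i e
    by_cases hek : e k = x
    · have h1 := hpos i e
      have h3 : h e = 1 := by simp [hh, hek]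
      rw [h3] at h1 ⊢
      simp only [one_mul] at h1 ⊢
      rw [h1]
      by_cases h4 : 0 < position κ e k (k + 1 + i)
      · simp only [h4, if_true]; ring
      · have h5 : position κ e k (k + 1 + i) = 0 := by omega
        simp [h5]
    · simp [hh, hek]
  have hreca : ∀ i, a (i + 1) = a i - δ * p i := by
    intro i
    have h1 : a (i + 1) = a i + ∫ e, h e * (if 0 < position κ e k (k + 1 + i) then 1 else 0)
          * (drift κ c (e (k + 1 + i)) : ℝ) ∂μ := by
      rw [ha]
      simp only
      rw [← integral_add (hint (fun n => (n : ℝ)) i)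
        (hintm (fun n => if 0 < n then 1 else 0) (fun y => (drift κ c y : ℝ)) i)]
      exact integral_congr_ae (Eventually.of_forall fun e => hpos i e)
    rw [h1, hmul (fun n => if 0 < n then 1 else 0) (fun y => (drift κ c y : ℝ)) i, hδdef]
    ring
  have hrecb : ∀ i, b (i + 1) = b i - 2 * δ * a i + v * p i := by
    intro i
    have h1 : b (i + 1) = b i
        + (∫ e, h e * (2 * (position κ e k (k + 1 + i) : ℝ)) * (drift κ c (e (k + 1 + i)) : ℝ) ∂μ)
        + ∫ e, h e * (if 0 < position κ e k (k + 1 + i) then 1 else 0)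
          * (drift κ c (e (k + 1 + i)) : ℝ) ^ 2 ∂μ := by
      rw [hb]
      simp only
      have hadd : Integrable (fun e => h e * (position κ e k (k + 1 + i) : ℝ) ^ 2
          + h e * (2 * (position κ e k (k + 1 + i) : ℝ)) * (drift κ c (e (k + 1 + i)) : ℝ)) μ :=
        (hint (fun n => (n : ℝ) ^ 2) i).add
          (hintm (fun n => 2 * (n : ℝ)) (fun y => (drift κ c y : ℝ)) i)
      rw [← integral_add (hint (fun n => (n : ℝ) ^ 2) i)
        (hintm (fun n => 2 * (n : ℝ)) (fun y => (drift κ c y : ℝ)) i), ← integral_add hadd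
        (hintm (fun n => if 0 < n then 1 else 0) (fun y => (drift κ c y : ℝ) ^ 2) i)]
      exact integral_congr_ae (Eventually.of_forall fun e => hpos2 i e)
    have h2 : ∫ e, h e * (2 * (position κ e k (k + 1 + i) : ℝ)) ∂μ = 2 * a i := by
      rw [ha, ← integral_const_mul]
      exact integral_congr_ae (Eventually.of_forall fun e => by simp only; ring)
    rw [h1, hmul (fun n => if 0 < n then 1 else 0) (fun y => (drift κ c y : ℝ) ^ 2) i,
      hmul (fun n => 2 * (n : ℝ)) (fun y => (drift κ c y : ℝ)) i, h2, hδdef]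
    ring
  have hmain := hasSum_survival (a := a) (b := b) (p := p) (v := v) hδ
    (integral_nonneg fun y => sq_nonneg _)
    (fun i => integral_nonneg fun e => mul_nonneg (hnn e) (Nat.cast_nonneg _))
    (fun i => integral_nonneg fun e => mul_nonneg (hnn e) (sq_nonneg _))
    (fun i => integral_nonneg fun e => mul_nonneg (hnn e) (by split_ifs <;> norm_num)) hreca hrecb
  have ha0 : a 0 = P.real {x} * (birthDeathMean P (changeAhead κ c) k + 1) := by
    have h1 : a 0 = ∫ e, ((birthDeath (changeAhead κ c) e k : ℝ) + 1)
        * Set.indicator {x} 1 (e k) ∂μ := by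
      refine integral_congr_ae (Eventually.of_forall fun e => ?_)
      simp only [hh]
      by_cases hek : e k = x
      · rw [add_zero, position_succ_self (c := c) (by rw [hek, hx])]
        push_cast; ring
      · simp [hek]
    rw [h1, integral_infinitePi_mul_apply P (f := fun e =>
      (birthDeath (changeAhead κ c) e k : ℝ) + 1), integral_indicator_one MeasurableSet.of_discrete,
      mul_comm, integral_add (integrable_birthDeath_comp (fun n => (n : ℝ)) k)
        (integrable_const _)]
    · simp [birthDeathMean]
    · intro e y
      rw [birthDeath_update]
    · exact (dependsOn_birthDeath_comp (fun n => (n : ℝ) + 1) k).measurable_of_finite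
  have hpeq : p = fun i => μ.real {e | e k = x ∧ k ∈ queue κ e (k + 1 + i)} := by
    funext i
    have hset : {e : ℕ → E | e k = x ∧ k ∈ queue κ e (k + 1 + i)}
        = (fun e => h e * (if 0 < position κ e k (k + 1 + i) then (1 : ℝ) else 0)) ⁻¹' {1} := by
      ext e
      simp only [Set.mem_ofPred_eq, Set.mem_preimage, Set.mem_singleton_iff, position_pos_iff, hh]
      by_cases h1 : e k = x <;> by_cases h2 : k ∈ queue κ e (k + 1 + i) <;> simp [h1, h2]
    have hm : MeasurableSet {e : ℕ → E | e k = x ∧ k ∈ queue κ e (k + 1 + i)} := by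
      rw [hset]
      exact (dependsOn_position (κ := κ) (x := x) (show k < k + 1 + i by omega)
        (fun n => if 0 < n then 1 else 0)).measurable_of_finite (measurableSet_singleton 1)
    rw [← integral_indicator_one hm]
    refine integral_congr_ae (Eventually.of_forall fun e => ?_)
    simp only [position_pos_iff, hh]
    by_cases h1 : e k = x <;> by_cases h2 : k ∈ queue κ e (k + 1 + i) <;>
      simp [h1, h2, Set.indicator]
  rw [ha0] at hmain
  rw [← hpeq]
  exact hmain

/-- The probability that the event at time `k` is the service of a customer of priority `c`. -/
noncomputable def serveProb (κ : E → Option FeeLevel) (c : FeeLevel) (k : ℕ) : ℝ :=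
  ∑ j ∈ Finset.range k, (Measure.infinitePi fun _ : ℕ => P).real
    {e | κ (e k) = none ∧ j ∈ front κ e (queue κ e k) ∧ κ (e j) = some c}

theorem measurableSet_served (κ : E → Option FeeLevel) (c : FeeLevel) (k j : ℕ) :
    MeasurableSet {e : ℕ → E | κ (e k) = none ∧ j ∈ front κ e (queue κ e k)
      ∧ κ (e j) = some c} := by
  by_cases hjk : j < k
  · refine (DependsOn.measurable_of_finite (β := Prop) (s := Finset.range (k + 1))
      (fun e e' h => ?_)).setOf
    rw [h k (by simp), queue_congr (κ := κ) fun i hi => h i (by simp; omega),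
      front_congr (κ := κ) fun i hi => h i (by have := lt_of_mem_queue hi; simp; omega),
      h j (by simp; omega)]
  · convert MeasurableSet.empty
    rw [Set.eq_empty_iff_forall_notMem]
    rintro e ⟨-, h, -⟩
    exact hjk (lt_of_mem_queue (front_subset _ h))

theorem serveProb_eq_integral (c : FeeLevel) (k : ℕ) :
    serveProb P κ c k = ∫ e, (((front κ e (queue κ e k)).filter fun j => κ (e j) = some c).card : ℝ)
      * Set.indicator {x | κ x = none} 1 (e k) ∂Measure.infinitePi fun _ : ℕ => P := by
  classical
  unfold serveProb
  simp only [← integral_indicator_one (measurableSet_served κ c k _)]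
  rw [← integral_finsetSum]
  · refine integral_congr_ae (Eventually.of_forall fun e => ?_)
    by_cases h : κ (e k) = none
    · have h1 : ((front κ e (queue κ e k)).filter fun j => κ (e j) = some c)
          = (Finset.range k).filter fun j => j ∈ front κ e (queue κ e k) ∧ κ (e j) = some c := by
        ext j
        simp only [Finset.mem_filter, Finset.mem_range]
        exact ⟨fun h => ⟨lt_of_mem_queue (front_subset _ h.1), h⟩, fun h => h.2⟩
      beta_reduce
      rw [h1, Finset.card_filter]
      simp [Set.indicator, h]
    · simp [Set.indicator, h]
  · exact fun j _ => (integrable_const (1 : ℝ)).indicator (measurableSet_served κ c k j)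

theorem integral_pos_mul_none (σ : E → ℤ) (k : ℕ) :
    ∫ e, (if 0 < birthDeath σ e k then (1 : ℝ) else 0) * Set.indicator {x | κ x = none} 1 (e k)
        ∂Measure.infinitePi (fun _ : ℕ => P)
      = birthDeathTail P σ k 1 * P.real {x | κ x = none} := by
  rw [integral_infinitePi_mul_apply P (f := fun e => if 0 < birthDeath σ e k then (1 : ℝ) else 0),
    integral_indicator_one MeasurableSet.of_discrete]
  · rfl
  · intro e y
    rw [birthDeath_update]
  · exact (dependsOn_birthDeath_comp (fun n => if 0 < n then (1 : ℝ) else 0) k).measurable_of_finite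

theorem serveProb_high (k : ℕ) :
    serveProb P κ .high k = birthDeathTail P (changeHigh κ) k 1 * P.real {x | κ x = none} := by
  rw [serveProb_eq_integral, ← integral_pos_mul_none]
  refine integral_congr_ae (Eventually.of_forall fun e => ?_)
  simp only [card_front_high, card_highQueue]
  split_ifs <;> simp

theorem serveProb_high_add_low (k : ℕ) :
    serveProb P κ .high k + serveProb P κ .low k
      = birthDeathTail P (change κ) k 1 * P.real {x | κ x = none} := by
  have hint : ∀ c, Integrable (fun e : ℕ → E =>
      (((front κ e (queue κ e k)).filter fun j => κ (e j) = some c).card : ℝ)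
      * Set.indicator {x | κ x = none} 1 (e k)) (Measure.infinitePi fun _ : ℕ => P) := by
    intro c
    refine DependsOn.integrable_of_finite (s := Finset.range (k + 1)) (fun e e' h => ?_) _
    have h1 : queue κ e k = queue κ e' k := queue_congr fun i hi => h i (by simp; omega)
    have h2 : front κ e (queue κ e' k) = front κ e' (queue κ e' k) :=
      front_congr (κ := κ) fun i hi => h i (by have := lt_of_mem_queue hi; simp; omega)
    rw [h k (by simp), h1, h2]
    congr 3
    refine Finset.filter_congr fun j hj => ?_
    rw [h j (by have := lt_of_mem_queue (front_subset _ hj); simp; omega)]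
  rw [serveProb_eq_integral, serveProb_eq_integral, ← integral_pos_mul_none,
    ← integral_add (hint _) (hint _)]
  refine integral_congr_ae (Eventually.of_forall fun e => ?_)
  beta_reduce
  rw [← add_mul, ← Nat.cast_add, ← Finset.card_union_of_disjoint, ← Finset.filter_or,
    Finset.filter_true_of_mem, card_front, card_queue]
  · split_ifs <;> simp
  · intro j hj
    have := kind_ne_none_of_mem_queue (front_subset _ hj)
    rcases h : κ (e j) with _ | (_ | _)
    · exact absurd h this
    · simp
    · simp
  · refine Finset.disjoint_left.2 fun j h1 h2 => ?_
    have h3 := (Finset.mem_filter.1 h1).2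
    rw [(Finset.mem_filter.1 h2).2] at h3
    simp at h3

theorem setOf_change_eq_one : {x | change κ x = 1} = {x | κ x ≠ none} := by
  ext x; simp only [change, Set.mem_ofPred_eq]; rcases κ x with _ | c <;> simp

theorem setOf_change_eq_neg_one : {x | change κ x = -1} = {x | κ x = none} := by
  ext x; simp only [change, Set.mem_ofPred_eq]; rcases κ x with _ | c <;> simp

theorem setOf_changeHigh_eq_one : {x | changeHigh κ x = 1} = {x | κ x = some .high} := by
  ext x; simp only [changeHigh, Set.mem_ofPred_eq]; rcases κ x with _ | (_ | _) <;> simp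

theorem setOf_changeHigh_eq_neg_one : {x | changeHigh κ x = -1} = {x | κ x = none} := by
  ext x; simp only [changeHigh, Set.mem_ofPred_eq]; rcases κ x with _ | (_ | _) <;> simp

theorem measureReal_kind_ne_none :
    P.real {x | κ x ≠ none} = P.real {x | κ x = some .high} + P.real {x | κ x = some .low} := by
  rw [← measureReal_union _ MeasurableSet.of_discrete]
  · congr 1
    ext x
    simp only [Set.mem_ofPred_eq, Set.mem_union]
    rcases κ x with _ | (_ | _) <;> simp
  · refine Set.disjoint_left.2 fun x h1 h2 => ?_
    simp only [Set.mem_ofPred_eq] at h1 h2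
    simp [h1] at h2

/-- In the long run customers of each priority are served at the rate at which they arrive. -/
theorem tendsto_serveProb (hle : P.real {x | κ x ≠ none} ≤ P.real {x | κ x = none})
    (hd : 0 < P.real {x | κ x = none}) (c : FeeLevel) :
    Tendsto (serveProb P κ c) atTop (𝓝 (P.real {x | κ x = some c})) := by
  have hhigh : Tendsto (serveProb P κ .high) atTop (𝓝 (P.real {x | κ x = some .high})) := by
    have h1 : P.real {x | κ x = some .high} ≤ P.real {x | κ x = none} := by
      refine le_trans ?_ hle
      exact measureReal_mono fun x (hx : κ x = some .high) => by simp [hx]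
    have h := (tendsto_birthDeathTail (P := P) (changeHigh_cases κ)
      (by rwa [setOf_changeHigh_eq_one, setOf_changeHigh_eq_neg_one])
      (by rwa [setOf_changeHigh_eq_neg_one]) 1).mul_const (P.real {x | κ x = none})
    rw [setOf_changeHigh_eq_one, setOf_changeHigh_eq_neg_one, pow_one,
      div_mul_cancel₀ _ hd.ne'] at h
    exact h.congr fun k => (serveProb_high P k).symm
  cases c with
  | high => exact hhigh
  | low =>
    have h := (tendsto_birthDeathTail (P := P) (change_cases κ)
      (by rwa [setOf_change_eq_one, setOf_change_eq_neg_one])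
      (by rwa [setOf_change_eq_neg_one]) 1).mul_const (P.real {x | κ x = none})
    rw [setOf_change_eq_one, setOf_change_eq_neg_one, pow_one, div_mul_cancel₀ _ hd.ne',
      measureReal_kind_ne_none] at h
    have h2 := h.sub hhigh
    rw [add_sub_cancel_left] at h2
    refine h2.congr fun k => ?_
    rw [← serveProb_high_add_low]
    ring

end PriorityQueue

/-! ### The selection of transactions by the miners -/

theorem TxPool.mem_candidate {Q : TxPool} {k : ℕ} :
    k ∈ Q.candidate ↔ (k ∈ Q.txs ∧ ∀ j ∈ Q.txs, Q.fee j ≤ Q.fee k) ∧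
      ∀ j, (j ∈ Q.txs ∧ ∀ i ∈ Q.txs, Q.fee i ≤ Q.fee j) → k ≤ j := by
  simp [TxPool.candidate, TxPool.highest]

theorem TxPool.candidate_eq_empty_or_singleton (Q : TxPool) :
    Q.candidate = ∅ ∨ ∃ k, Q.candidate = {k} := by
  rcases Q.candidate.eq_empty_or_nonempty with h | ⟨k, hk⟩
  · exact Or.inl h
  · refine Or.inr ⟨k, ?_⟩
    ext j
    rw [Finset.mem_singleton]
    constructor
    · intro hj
      have h1 := TxPool.mem_candidate.1 hk
      have h2 := TxPool.mem_candidate.1 hj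
      exact le_antisymm (h2.2 k h1.1) (h1.2 j h2.1)
    · rintro rfl
      exact hk

namespace Blockchain

open ProbabilityTheory PriorityQueue Topology

variable {C : Blockchain}

/-- The surplus of the fee of a set of transactions over the storage cost of one miner. -/
noncomputable def surplus (C : Blockchain) (Q : TxPool) (A : Finset ℕ) : ℝ :=
  ∑ k ∈ A, (Q.size k * Q.fee k - Q.size k * C.storageCost)

theorem roundPayoff_update (Q : TxPool) (B : C.Miner → Finset ℕ) (m : C.Miner) (A : Finset ℕ) :
    C.roundPayoff Q (Function.update B m A) m
      = C.power m * C.surplus Q A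
        - ∑ j ∈ Finset.univ.erase m, (C.power j : ℝ) * ∑ k ∈ B j, Q.size k * C.storageCost := by
  rw [roundPayoff, Function.update_self, ← Finset.add_sum_erase _ _ (Finset.mem_univ m),
    Function.update_self]
  have h : ∑ j ∈ Finset.univ.erase m,
      (C.power j : ℝ) * ∑ k ∈ Function.update B m A j, Q.size k * C.storageCost
      = ∑ j ∈ Finset.univ.erase m, (C.power j : ℝ) * ∑ k ∈ B j, Q.size k * C.storageCost :=
    Finset.sum_congr rfl fun j hj => by rw [Function.update_of_ne (Finset.ne_of_mem_erase hj)]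
  rw [h, surplus, Finset.sum_sub_distrib]
  ring

/-- The only equilibrium of the miners: a miner selects the candidate if and only if its fee covers
his own storage cost. -/
theorem isMinerEquilibrium_iff (X : C.MinerProfile) :
    C.IsMinerEquilibrium X ↔
      ∀ Q m, X m Q = if 0 ≤ C.surplus Q Q.candidate then Q.candidate else ∅ := by
  have hpow : ∀ m, (0 : ℝ) < C.power m := fun m => C.power_pos m
  have h0 : ∀ Q, C.surplus Q ∅ = 0 := fun Q => by simp [surplus]
  have hself : ∀ Q m, C.roundPayoff Q (fun j => X j Q) m
      = C.roundPayoff Q (Function.update (fun j => X j Q) m (X m Q)) m := fun Q m => by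
    rw [Function.update_eq_self_iff.2 rfl]
  constructor
  · intro h Q m
    obtain ⟨h1, h2⟩ := h Q m
    have h3 := h2 ∅ (by simp [TxPool.choices])
    have h4 := h2 Q.candidate (by simp [TxPool.choices])
    rw [hself, roundPayoff_update, roundPayoff_update, h0] at h3
    rw [hself, roundPayoff_update, roundPayoff_update] at h4
    simp only [TxPool.choices, Set.mem_insert_iff, Set.mem_singleton_iff] at h1
    split_ifs with hs
    · rcases h1 with h1 | h1
      · rw [h1, h0] at h4
        have h5 : (C.power m : ℝ) * C.surplus Q Q.candidate = 0 :=
          le_antisymm (by linarith [h4.1]) (mul_nonneg (hpow m).le hs)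
        have h6 := h4.2 (by rw [h5]; ring)
        rw [Finset.card_empty, Nat.le_zero, Finset.card_eq_zero] at h6
        rw [h1, h6]
      · exact h1
    · rcases h1 with h1 | h1
      · exact h1
      · exfalso
        rw [h1] at h3
        have := mul_neg_of_pos_of_neg (hpow m) (not_le.1 hs)
        linarith [h3.1]
  · intro h Q m
    have hm := h Q m
    refine ⟨?_, fun A hA => ?_⟩
    · rw [hm]
      split_ifs <;> simp [TxPool.choices]
    · rw [hself, roundPayoff_update, roundPayoff_update, hm]
      simp only [TxPool.choices, Set.mem_insert_iff, Set.mem_singleton_iff] at hA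
      split_ifs with hs
      · rcases hA with rfl | rfl
        · rw [h0]
          refine ⟨?_, fun _ => by simp⟩
          have := mul_nonneg (hpow m).le hs
          linarith
        · exact ⟨le_rfl, fun _ => le_rfl⟩
      · rcases hA with rfl | rfl
        · exact ⟨le_rfl, fun _ => le_rfl⟩
        · have := mul_neg_of_pos_of_neg (hpow m) (not_le.1 hs)
          rw [h0]
          exact ⟨by linarith, fun h => absurd h (ne_of_lt (by linarith))⟩

variable (C) in
theorem exists_isMinerEquilibrium : ∃ X, C.IsMinerEquilibrium X := by
  classical
  exact ⟨fun _ Q => if 0 ≤ C.surplus Q Q.candidate then Q.candidate else ∅,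
    (isMinerEquilibrium_iff _).2 fun _ _ => by congr⟩

/-! ### The pool as a priority queue -/

/-- An event seen as a letter of the priority queue: the fee level of a new transaction, or a
service. -/
def kind : C.Event → Option FeeLevel
  | .inl (_, c) => some c
  | .inr _ => none

theorem kind_eq_some {x : C.Event} {c : FeeLevel} : kind x = some c ↔ ∃ n, x = .inl (n, c) := by
  rcases x with ⟨n, c'⟩ | m <;> simp [kind]

theorem kind_eq_none {x : C.Event} : kind x = none ↔ ∃ m, x = .inr m := by
  rcases x with ⟨n, c'⟩ | m <;> simp [kind]

/-- Every transaction of the history has positive size and a fee-per-byte that covers the storage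
cost of one miner. -/
def Served (T : Mechanism) (ω : C.History) : Prop :=
  (∀ k, 0 < txSize ω k) ∧ ∀ k c, kind (event ω k) = some c → C.storageCost ≤ T.fee c

theorem txFee_of_kind {T : Mechanism} {ω : C.History} {k : ℕ} {c : FeeLevel}
    (h : kind (event ω k) = some c) : txFee T ω k = T.fee c := by
  obtain ⟨n, hn⟩ := kind_eq_some.1 h
  rw [txFee, hn]

variable {T : Mechanism} {X : C.MinerProfile} {ω : C.History}

theorem candidate_eq_front (hT : T.feeLow < T.feeHigh) {w : Finset ℕ}
    (hw : ∀ j ∈ w, kind (event ω j) ≠ none) :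
    TxPool.candidate ⟨w, txFee T ω, txSize ω⟩ = front kind (event ω) w := by
  have hfee : ∀ j ∈ w, (kind (event ω j) = some .high ∧ txFee T ω j = T.feeHigh) ∨
      (kind (event ω j) ≠ some .high ∧ txFee T ω j = T.feeLow) := by
    intro j hj
    rcases h : kind (event ω j) with _ | (_ | _)
    · exact absurd h (hw j hj)
    · exact Or.inl ⟨rfl, txFee_of_kind h⟩
    · exact Or.inr ⟨by simp, txFee_of_kind h⟩
  have hle : ∀ i ∈ w, ∀ j ∈ w, txFee T ω i ≤ txFee T ω j ↔
      (kind (event ω i) = some .high → kind (event ω j) = some .high) := by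
    intro i hi j hj
    rcases hfee i hi with ⟨h1, h2⟩ | ⟨h1, h2⟩ <;> rcases hfee j hj with ⟨h3, h4⟩ | ⟨h3, h4⟩ <;>
      rw [h2, h4]
    · simp [h3]
    · simp [h1, h3, hT]
    · simp [h3, hT.le]
    · simp [h1]
  ext k
  rw [TxPool.mem_candidate, mem_front]
  constructor
  · rintro ⟨⟨hk, h1⟩, h2⟩
    refine ⟨hk, fun j hj => ?_⟩
    have h3 := (hle j hj k hk).1 (h1 j hj)
    by_cases h4 : kind (event ω k) = some .high → kind (event ω j) = some .high
    · refine Or.inr ⟨⟨h4, h3⟩, h2 j ⟨hj, fun i hi => (h1 i hi).trans ((hle k hk j hj).2 h4)⟩⟩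
    · push Not at h4
      exact Or.inl h4
  · rintro ⟨hk, h1⟩
    refine ⟨⟨hk, fun j hj => (hle j hj k hk).2 fun h => ?_⟩, fun j hj => ?_⟩
    · rcases h1 j hj with h2 | h2
      · exact h2.1
      · exact h2.1.2 h
    · rcases h1 j hj.1 with h2 | h2
      · exact absurd ((hle k hk j hj.1).1 (hj.2 k hk) h2.1) h2.2
      · exact h2.2

theorem miner_select_eq_front (hX : C.IsMinerEquilibrium X) (hT : T.feeLow < T.feeHigh)
    (hω : Served T ω) {w : Finset ℕ} (hw : ∀ j ∈ w, kind (event ω j) ≠ none) (m : C.Miner) :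
    X m ⟨w, txFee T ω, txSize ω⟩ = front kind (event ω) w := by
  rw [(isMinerEquilibrium_iff X).1 hX, candidate_eq_front hT hw, if_pos]
  refine Finset.sum_nonneg fun k hk => ?_
  obtain ⟨c, hc⟩ := Option.ne_none_iff_exists'.1 (hw k (front_subset _ hk))
  simp only
  rw [txFee_of_kind hc]
  have h1 := hω.2 k c hc
  have h2 := hω.1 k
  nlinarith

theorem waiting_eq_queue (hX : C.IsMinerEquilibrium X) (hT : T.feeLow < T.feeHigh)
    (hω : Served T ω) (k : ℕ) : waiting T X ω k = queue kind (event ω) k := by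
  induction k with
  | zero => rfl
  | succ k ih =>
    rw [waiting]
    rcases he : event ω k with ⟨n, c⟩ | m
    · rw [queue_succ_of_some (c := c) (by rw [he]; rfl), ih]
    · rw [queue_succ_of_none (by rw [he]; rfl)]
      simp only
      rw [miner_select_eq_front hX hT hω
        (fun j hj => kind_ne_none_of_mem_queue (by rwa [ih] at hj)), ih]

/-- A transaction whose fee does not cover the storage cost of one miner is never included. -/
theorem not_included_of_fee_lt (hX : C.IsMinerEquilibrium X) {k : ℕ} {c : FeeLevel}
    (hk : kind (event ω k) = some c) (hs : 0 < txSize ω k) (hc : T.fee c < C.storageCost) :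
    ¬ Included T X ω k := by
  rintro ⟨j, h1, h2⟩
  rw [waiting] at h2
  rcases he : event ω j with ⟨n, c'⟩ | m
  · rw [he] at h2
    exact h2 (Finset.mem_insert_of_mem h1)
  · rw [he] at h2
    simp only [Finset.mem_sdiff, not_and, not_not] at h2
    have h3 := h2 h1
    rw [(isMinerEquilibrium_iff X).1 hX] at h3
    split_ifs at h3 with h4
    · rcases TxPool.candidate_eq_empty_or_singleton ⟨waiting T X ω j, txFee T ω, txSize ω⟩
        with h5 | ⟨i, h5⟩
      · rw [h5] at h3
        simp at h3
      · rw [h5] at h3 h4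
        obtain rfl := Finset.mem_singleton.1 h3
        rw [surplus, Finset.sum_singleton] at h4
        simp only at h4
        rw [txFee_of_kind hk] at h4
        nlinarith
    · simp at h3

theorem mem_waiting_succ_self {k : ℕ} {c : FeeLevel} (hk : kind (event ω k) = some c) :
    k ∈ waiting T X ω (k + 1) := by
  obtain ⟨n, hn⟩ := kind_eq_some.1 hk
  rw [waiting, hn]
  exact Finset.mem_insert_self _ _

/-- A waiting time as the sum of the gaps between the events during which the transaction waits. -/
noncomputable def gapsWaited (ω : C.History) (k : ℕ) : ℝ≥0∞ :=
  ∑' i, Set.indicator {e : ℕ → C.Event | k ∈ queue kind e (k + 1 + i)} 1 (event ω)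
    * ENNReal.ofReal (ω (k + 1 + i)).1

theorem waitingTime_of_included (hX : C.IsMinerEquilibrium X) (hT : T.feeLow < T.feeHigh)
    (hω : Served T ω) (hgap : ∀ k, 0 ≤ (ω k).1) {k : ℕ} (hinc : Included T X ω k) :
    waitingTime T X ω k = gapsWaited ω k := by
  classical
  rw [waitingTime, dif_pos hinc]
  have hf := Nat.find_spec hinc
  set J := Nat.find hinc
  unfold IncludedAt at hf
  rw [waiting_eq_queue hX hT hω, waiting_eq_queue hX hT hω] at hf
  have hkJ : k < J := lt_of_mem_queue hf.1
  have h1 : ∀ i, k ∈ queue kind (event ω) (k + 1 + i) ↔ i < J - k := by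
    intro i
    constructor
    · intro h
      by_contra hi
      exact hf.2 (mem_queue_of_le (by omega) (by omega) h)
    · intro h
      exact mem_queue_of_le (by omega) (by omega) hf.1
  have h2 : gapsWaited ω k = ∑ i ∈ Finset.range (J - k), ENNReal.ofReal (ω (k + 1 + i)).1 := by
    rw [gapsWaited, tsum_eq_sum (s := Finset.range (J - k))]
    · refine Finset.sum_congr rfl fun i hi => ?_
      rw [Set.indicator_of_mem (show event ω ∈ _ from (h1 i).2 (Finset.mem_range.1 hi))]
      simp
    · intro i hi
      rw [Set.indicator_of_notMem (show event ω ∉ _ from fun h =>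
        hi (Finset.mem_range.2 ((h1 i).1 h))), zero_mul]
  rw [h2, ← ENNReal.ofReal_sum_of_nonneg fun i _ => hgap _]
  congr 1
  rw [eventTime, eventTime, show J + 1 = (k + 1) + (J - k) by omega, Finset.sum_range_add]
  ring

theorem gapsWaited_le_waitingTime (hX : C.IsMinerEquilibrium X) (hT : T.feeLow < T.feeHigh)
    (hω : Served T ω) (hgap : ∀ k, 0 ≤ (ω k).1) (k : ℕ) :
    gapsWaited ω k ≤ waitingTime T X ω k := by
  classical
  by_cases hinc : Included T X ω k
  · exact (waitingTime_of_included hX hT hω hgap hinc).ge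
  · rw [waitingTime, dif_neg hinc]
    exact le_top

theorem included_of_notMem_queue (hX : C.IsMinerEquilibrium X) (hT : T.feeLow < T.feeHigh)
    (hω : Served T ω) {k i : ℕ} (hk : kind (event ω k) ≠ none)
    (hi : k ∉ queue kind (event ω) (k + 1 + i)) : Included T X ω k := by
  obtain ⟨c, hc⟩ := Option.ne_none_iff_exists'.1 hk
  induction i with
  | zero =>
    refine absurd ?_ hi
    rw [← waiting_eq_queue hX hT hω]
    exact mem_waiting_succ_self hc
  | succ i ih =>
    by_cases h : k ∈ queue kind (event ω) (k + 1 + i)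
    · refine ⟨k + 1 + i, ?_, ?_⟩
      · rwa [waiting_eq_queue hX hT hω]
      · rw [waiting_eq_queue hX hT hω]
        exact hi
    · exact ih h

end Blockchain

/-! ### The law of the history -/

namespace Blockchain

open ProbabilityTheory PriorityQueue Topology

variable {C : Blockchain} (r : C.Rates)

instance : DiscreteMeasurableSpace C.User where
  forall_measurableSet _ := ⟨trivial, trivial⟩

instance : DiscreteMeasurableSpace C.Event where
  forall_measurableSet _ := ⟨MeasurableSet.of_discrete (α := C.User × FeeLevel), trivial⟩

/-- The law of the sequence of events. -/
noncomputable def eventSeqLaw : Measure (ℕ → C.Event) :=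
  Measure.infinitePi fun _ => (C.eventLaw r).toMeasure

instance : IsProbabilityMeasure (eventSeqLaw r) := by unfold eventSeqLaw; infer_instance

variable (C) in
/-- The law of the sequence of sizes. -/
noncomputable def sizeSeqLaw : Measure (ℕ → ℝ) := Measure.infinitePi fun _ => C.sizeLaw

instance : IsProbabilityMeasure C.sizeSeqLaw := by unfold sizeSeqLaw; infer_instance

theorem totalRate_pos_real : (0 : ℝ) < C.totalRate r := C.totalRate_pos r

instance : IsProbabilityMeasure (gapLaw (C.totalRate r)) :=
  isProbabilityMeasure_gapLaw (totalRate_pos_real r)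

/-- The gaps, the events and the sizes are independent. -/
theorem measurePreserving_split :
    MeasurePreserving (fun ω : C.History =>
        ((fun k => (ω k).1, event ω, txSize ω) : (ℕ → ℝ) × (ℕ → C.Event) × (ℕ → ℝ)))
      (C.law r) ((gapLaw (C.totalRate r)).prod ((eventSeqLaw r).prod C.sizeSeqLaw)) := by
  have h1 : MeasurePreserving (fun ω : C.History =>
      ((fun k => (ω k).1, fun k => (ω k).2) : (ℕ → ℝ) × (ℕ → C.Event × ℝ))) (C.law r)
      ((gapLaw (C.totalRate r)).prod
        (Measure.infinitePi fun _ => (C.eventLaw r).toMeasure.prod C.sizeLaw)) :=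
    ⟨by fun_prop, infinitePi_map_unzip _ _⟩
  have h2 : MeasurePreserving (fun ω : ℕ → C.Event × ℝ =>
      ((fun k => (ω k).1, fun k => (ω k).2) : (ℕ → C.Event) × (ℕ → ℝ)))
      (Measure.infinitePi fun _ => (C.eventLaw r).toMeasure.prod C.sizeLaw)
      ((eventSeqLaw r).prod C.sizeSeqLaw) :=
    ⟨by fun_prop, infinitePi_map_unzip _ _⟩
  exact ((MeasurePreserving.id _).prod h2).comp h1

theorem lintegral_law_mul {f : (ℕ → ℝ) → ℝ≥0∞} (hf : Measurable f) {g : (ℕ → C.Event) → ℝ≥0∞}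
    (hg : Measurable g) {h : (ℕ → ℝ) → ℝ≥0∞} (hh : Measurable h) :
    ∫⁻ ω, f (fun k => (ω k).1) * (g (event ω) * h (txSize ω)) ∂C.law r
      = (∫⁻ τ, f τ ∂gapLaw (C.totalRate r)) * ((∫⁻ e, g e ∂eventSeqLaw r)
        * ∫⁻ s, h s ∂C.sizeSeqLaw) := by
  rw [(measurePreserving_split r).lintegral_comp (f := fun x => f x.1 * (g x.2.1 * h x.2.2))
      (by fun_prop),
    lintegral_prod_mul (g := fun x : (ℕ → C.Event) × (ℕ → ℝ) => g x.1 * h x.2) hf.aemeasurable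
      (by fun_prop), lintegral_prod_mul hg.aemeasurable hh.aemeasurable]

theorem measurableSet_sum_range_le (t : ℝ) (k : ℕ) :
    MeasurableSet {τ : ℕ → ℝ | ∑ i ∈ Finset.range (k + 1), τ i ≤ t} :=
  measurableSet_le (by fun_prop) measurable_const

/-- The indicator that event `k` occurs up to time `t`. -/
noncomputable def occurred (t : ℝ) (k : ℕ) (ω : C.History) : ℝ :=
  Set.indicator {τ : ℕ → ℝ | ∑ i ∈ Finset.range (k + 1), τ i ≤ t} 1 fun i => (ω i).1

theorem occurred_eq (t : ℝ) (k : ℕ) (ω : C.History) [Decidable (eventTime ω k ≤ t)] :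
    occurred t k ω = if eventTime ω k ≤ t then 1 else 0 := by
  classical
  rw [occurred, Set.indicator_apply]
  exact if_congr Iff.rfl rfl rfl

theorem occurred_nonneg (t : ℝ) (k : ℕ) (ω : C.History) : 0 ≤ occurred t k ω :=
  Set.indicator_nonneg (fun _ _ => zero_le_one) _

section Integral

variable {g : (ℕ → C.Event) → ℝ} {h : ℝ → ℝ}

theorem integrable_law_mul (hg : Integrable g (eventSeqLaw r)) (hh : Integrable h C.sizeLaw)
    (t : ℝ) (k j : ℕ) :
    Integrable (fun ω => occurred t k ω * (g (event ω) * h (txSize ω j))) (C.law r) := by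
  have h1 : Integrable (fun s : ℕ → ℝ => h (s j)) C.sizeSeqLaw :=
    (measurePreserving_eval_infinitePi (fun _ : ℕ => C.sizeLaw) j).integrable_comp_of_integrable hh
  have h2 : Integrable (Set.indicator {τ : ℕ → ℝ | ∑ i ∈ Finset.range (k + 1), τ i ≤ t}
      (1 : (ℕ → ℝ) → ℝ)) (gapLaw (C.totalRate r)) :=
    (integrable_const (1 : ℝ)).indicator (measurableSet_sum_range_le t k)
  exact (measurePreserving_split r).integrable_comp_of_integrable (h2.mul_prod (hg.mul_prod h1))

theorem integral_law_mul (hg : Integrable g (eventSeqLaw r)) (hh : Integrable h C.sizeLaw)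
    (t : ℝ) (k j : ℕ) :
    ∫ ω, occurred t k ω * (g (event ω) * h (txSize ω j)) ∂C.law r
      = eventProbUpTo (C.totalRate r) t k * ((∫ e, g e ∂eventSeqLaw r) * ∫ s, h s ∂C.sizeLaw) := by
  have h1 : Integrable (fun s : ℕ → ℝ => h (s j)) C.sizeSeqLaw :=
    (measurePreserving_eval_infinitePi (fun _ : ℕ => C.sizeLaw) j).integrable_comp_of_integrable hh
  have h2 : Integrable (Set.indicator {τ : ℕ → ℝ | ∑ i ∈ Finset.range (k + 1), τ i ≤ t}
      (1 : (ℕ → ℝ) → ℝ)) (gapLaw (C.totalRate r)) :=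
    (integrable_const (1 : ℝ)).indicator (measurableSet_sum_range_le t k)
  have h3 := (h2.mul_prod (hg.mul_prod h1)).aestronglyMeasurable
  have h4 : ∫ ω, occurred t k ω * (g (event ω) * h (txSize ω j)) ∂C.law r
      = ∫ x, Set.indicator {τ : ℕ → ℝ | ∑ i ∈ Finset.range (k + 1), τ i ≤ t} 1 x.1
        * (g x.2.1 * h (x.2.2 j)) ∂(gapLaw (C.totalRate r)).prod
          ((eventSeqLaw r).prod C.sizeSeqLaw) := by
    rw [← (measurePreserving_split r).map_eq, integral_map]
    · rfl
    · exact (measurePreserving_split r).measurable.aemeasurable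
    · rw [(measurePreserving_split r).map_eq]
      exact h3
  rw [h4, integral_prod_mul (g := fun x : (ℕ → C.Event) × (ℕ → ℝ) => g x.1 * h (x.2 j)),
    integral_prod_mul (g := fun s : ℕ → ℝ => h (s j)),
    integral_indicator_one (measurableSet_sum_range_le t k)]
  congr 2
  have h5 := measurePreserving_eval_infinitePi (fun _ : ℕ => C.sizeLaw) j
  conv_rhs => rw [← h5.map_eq, integral_map h5.measurable.aemeasurable
    (by rw [h5.map_eq]; exact hh.aestronglyMeasurable)]
  rfl

end Integral

theorem measureReal_eventLaw_singleton (x : C.Event) :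
    (C.eventLaw r).toMeasure.real {x} = C.eventProb r x := by
  rw [measureReal_def, PMF.toMeasure_apply_singleton _ _ (MeasurableSet.singleton x)]
  simp [eventLaw]

/-- Almost surely no transaction of a user occurs at a fee level that he does not use. -/
theorem ae_rate_pos : ∀ᵐ ω ∂C.law r, ∀ k n c, event ω k = .inl (n, c) → 0 < r n c := by
  have h0 : ∀ᵐ x ∂(C.eventLaw r).toMeasure, ∀ n c, x = .inl (n, c) → 0 < r n c := by
    simp only [ae_all_iff]
    intro n c
    by_cases h : 0 < r n c
    · exact Eventually.of_forall fun _ _ => h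
    · have h1 : (C.eventLaw r).toMeasure {.inl (n, c)} = 0 := by
        rw [PMF.toMeasure_apply_singleton _ _ (MeasurableSet.singleton _)]
        have : r n c = 0 := by simpa using h
        simp [eventLaw, eventProb, this]
      rw [ae_iff]
      refine measure_mono_null (fun x hx => ?_) h1
      simp only [Set.mem_ofPred_eq, Classical.not_imp] at hx
      exact hx.1
  rw [ae_all_iff]
  intro k
  have h1 : ∀ᵐ e ∂eventSeqLaw r, ∀ n c, e k = .inl (n, c) → 0 < r n c :=
    (measurePreserving_eval_infinitePi (fun _ : ℕ => (C.eventLaw r).toMeasure)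
      k).quasiMeasurePreserving.ae h0
  have h2 := (Measure.quasiMeasurePreserving_fst (μ := eventSeqLaw r)
    (ν := C.sizeSeqLaw)).ae h1
  have h3 := (Measure.quasiMeasurePreserving_snd (μ := gapLaw (C.totalRate r))
    (ν := (eventSeqLaw r).prod C.sizeSeqLaw)).ae h2
  exact (measurePreserving_split r).quasiMeasurePreserving.ae h3

theorem ae_size_pos : ∀ᵐ ω ∂C.law r, ∀ k, 0 < txSize ω k := by
  rw [ae_all_iff]
  intro k
  have h1 : ∀ᵐ s ∂C.sizeSeqLaw, 0 < s k :=
    (measurePreserving_eval_infinitePi (fun _ : ℕ => C.sizeLaw)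
      k).quasiMeasurePreserving.ae C.sizeLaw_pos
  have h2 := (Measure.quasiMeasurePreserving_snd (μ := eventSeqLaw r)
    (ν := C.sizeSeqLaw)).ae h1
  have h3 := (Measure.quasiMeasurePreserving_snd (μ := gapLaw (C.totalRate r))
    (ν := (eventSeqLaw r).prod C.sizeSeqLaw)).ae h2
  exact (measurePreserving_split r).quasiMeasurePreserving.ae h3

theorem ae_gap_nonneg : ∀ᵐ ω ∂C.law r, ∀ k, 0 ≤ (ω k).1 := by
  have h3 := (Measure.quasiMeasurePreserving_fst (μ := gapLaw (C.totalRate r))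
    (ν := (eventSeqLaw r).prod C.sizeSeqLaw)).ae (ae_nonneg_gapLaw (totalRate_pos_real r))
  exact (measurePreserving_split r).quasiMeasurePreserving.ae h3

theorem ae_served {T : Mechanism} (hfee : ∀ n c, 0 < r n c → C.storageCost ≤ T.fee c) :
    ∀ᵐ ω ∂C.law r, Served T ω := by
  filter_upwards [ae_rate_pos r, ae_size_pos r] with ω h1 h2
  refine ⟨h2, fun k c hk => ?_⟩
  obtain ⟨n, hn⟩ := kind_eq_some.1 hk
  exact hfee n c (h1 k n c hn)

/-! ### The parameters of the queue -/

/-- The rate at which transactions of a fee level are generated by all users. -/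
noncomputable def levelRate (c : FeeLevel) : ℝ := ∑ n, (r n c : ℝ)

/-- The rate at which transactions are generated that a new transaction of the given fee level
finds ahead of it. -/
noncomputable def load : FeeLevel → ℝ
  | .high => levelRate r .high
  | .low => levelRate r .high + levelRate r .low

/-- The rate at which the number of transactions ahead of a waiting transaction decreases. -/
noncomputable def slack : FeeLevel → ℝ
  | .high => C.blockRate
  | .low => C.blockRate - levelRate r .high

theorem levelRate_nonneg (c : FeeLevel) : 0 ≤ levelRate r c :=
  Finset.sum_nonneg fun _ _ => NNReal.coe_nonneg _

theorem sum_feeLevel (f : FeeLevel → ℝ) : ∑ c, f c = f .high + f .low := by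
  rw [show (Finset.univ : Finset FeeLevel) = {.high, .low} from rfl,
    Finset.sum_pair (by simp)]

theorem measureReal_eventLaw (s : Set C.Event) [DecidablePred (· ∈ s)] :
    (C.eventLaw r).toMeasure.real s = ∑ x, if x ∈ s then (C.eventProb r x : ℝ) else 0 := by
  have h := sum_measureReal_singleton (μ := (C.eventLaw r).toMeasure)
    (Finset.univ.filter (· ∈ s))
  rw [Finset.sum_filter] at h
  simp only [measureReal_eventLaw_singleton] at h
  rw [h]
  congr 1
  ext x
  simp

theorem sum_event {f : C.Event → ℝ} :
    ∑ x, f x = (∑ n, (f (.inl (n, .high)) + f (.inl (n, .low)))) + ∑ m, f (.inr m) := by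
  rw [Fintype.sum_sum_type, Fintype.sum_prod_type]
  simp only [sum_feeLevel fun c => f (.inl (_, c))]

theorem measureReal_kind_some (c : FeeLevel) :
    (C.eventLaw r).toMeasure.real {x | kind x = some c} = levelRate r c / C.totalRate r := by
  classical
  rw [measureReal_eventLaw, sum_event, levelRate, Finset.sum_div]
  cases c <;> simp [kind, eventProb]

theorem measureReal_kind_none :
    (C.eventLaw r).toMeasure.real {x | kind x = none} = C.blockRate / C.totalRate r := by
  classical
  have h : ∑ m, (C.power m : ℝ) = 1 := by exact_mod_cast C.sum_power
  rw [measureReal_eventLaw, sum_event]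
  simp only [kind, eventProb, Set.mem_ofPred_eq]
  simp [← Finset.sum_div, ← Finset.mul_sum, h]

theorem measureReal_ahead_one (c : FeeLevel) :
    (C.eventLaw r).toMeasure.real {x | changeAhead kind c x = 1}
      = load r c / C.totalRate r := by
  cases c with
  | high => exact (congrArg _ setOf_changeHigh_eq_one).trans (measureReal_kind_some r _)
  | low =>
    refine (congrArg _ setOf_change_eq_one).trans ?_
    rw [measureReal_kind_ne_none, measureReal_kind_some, measureReal_kind_some, ← add_div]
    rfl

theorem measureReal_ahead_neg_one (c : FeeLevel) :
    (C.eventLaw r).toMeasure.real {x | changeAhead kind c x = -1}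
      = C.blockRate / C.totalRate r := by
  cases c with
  | high => exact (congrArg _ setOf_changeHigh_eq_neg_one).trans (measureReal_kind_none r)
  | low => exact (congrArg _ setOf_change_eq_neg_one).trans (measureReal_kind_none r)

theorem integral_eventLaw (f : C.Event → ℝ) :
    ∫ x, f x ∂(C.eventLaw r).toMeasure = ∑ x, (C.eventProb r x : ℝ) * f x := by
  rw [integral_fintype Integrable.of_finite]
  simp only [measureReal_eventLaw_singleton, smul_eq_mul]

theorem neg_integral_drift (c : FeeLevel) :
    -∫ x, (drift kind c x : ℝ) ∂(C.eventLaw r).toMeasure = slack r c / C.totalRate r := by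
  have h : ∑ m, (C.power m : ℝ) = 1 := by exact_mod_cast C.sum_power
  rw [integral_eventLaw, sum_event]
  cases c
  · simp [drift, kind, eventProb, slack, ← Finset.sum_div, ← Finset.mul_sum, h]
  · simp [drift, kind, eventProb, slack, ← Finset.sum_div, ← Finset.mul_sum, h, levelRate]
    ring

theorem blockRate_pos_real : (0 : ℝ) < C.blockRate := C.blockRate_pos

theorem slack_pos_of_load_lt (h : load r .low < C.blockRate) (c : FeeLevel) : 0 < slack r c := by
  cases c with
  | high => exact blockRate_pos_real
  | low =>
    have := levelRate_nonneg r .low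
    unfold load at h
    unfold slack
    linarith

theorem load_lt_of_load_low_lt (h : load r .low < C.blockRate) (c : FeeLevel) :
    load r c < C.blockRate := by
  cases c with
  | high =>
    have := levelRate_nonneg r .low
    simp only [load] at h ⊢
    linarith
  | low => exact h

/-- The mean number of transactions that a transaction of the given fee level generated at event `k`
finds ahead of it. -/
noncomputable def meanAhead (c : FeeLevel) (k : ℕ) : ℝ :=
  birthDeathMean (C.eventLaw r).toMeasure (changeAhead kind c) k

theorem meanAhead_nonneg (c : FeeLevel) (k : ℕ) : 0 ≤ meanAhead r c k := birthDeathMean_nonneg k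

theorem tendsto_meanAhead {c : FeeLevel} (h : load r c < C.blockRate) :
    Tendsto (meanAhead r c) atTop (𝓝 (load r c / (C.blockRate - load r c))) := by
  have hθ := totalRate_pos_real r
  have h1 := tendsto_birthDeathMean (P := (C.eventLaw r).toMeasure)
    (changeAhead_cases kind c) (by
      rw [measureReal_ahead_one, measureReal_ahead_neg_one]; gcongr)
  rw [measureReal_ahead_one, measureReal_ahead_neg_one, ← sub_div,
    div_div_div_cancel_right₀ hθ.ne'] at h1
  exact h1

theorem tendsto_meanAhead_atTop {c : FeeLevel} (h : load r c = C.blockRate) :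
    Tendsto (meanAhead r c) atTop atTop := by
  have hθ := totalRate_pos_real r
  refine tendsto_birthDeathMean_atTop (P := (C.eventLaw r).toMeasure)
    (changeAhead_cases kind c) ?_ ?_
  · rw [measureReal_ahead_one, measureReal_ahead_neg_one, h]
  · rw [measureReal_ahead_neg_one]
    exact div_pos blockRate_pos_real hθ

/-- The mean number of events during which a transaction of user `n` that is generated at event `k`
waits. -/
theorem hasSum_prob_tx_waiting {n : C.User} {c : FeeLevel} (hs : 0 < slack r c) (k : ℕ) :
    HasSum (fun i => (eventSeqLaw r).real {e | e k = .inl (n, c) ∧ k ∈ queue kind e (k + 1 + i)})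
      (r n c * (meanAhead r c k + 1) / slack r c) := by
  have hθ := totalRate_pos_real r
  have h := hasSum_prob_waiting (C.eventLaw r).toMeasure (κ := kind) (c := c) (x := .inl (n, c)) rfl
    (by rw [neg_integral_drift]; positivity) k
  rw [neg_integral_drift, measureReal_eventLaw_singleton] at h
  have h1 : (r n c * (meanAhead r c k + 1) / slack r c : ℝ)
      = (C.eventProb r (.inl (n, c)) : ℝ) * (meanAhead r c k + 1)
        / (slack r c / C.totalRate r) := by
    simp only [eventProb]
    push_cast
    field_simp
  rw [h1]
  exact h

end Blockchain

/-! ### Expected waiting times -/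

namespace Blockchain

open ProbabilityTheory PriorityQueue Topology

variable {C : Blockchain} (r : C.Rates) {T : Mechanism} {X : C.MinerProfile}

theorem measurableSet_waits (n : C.User) (c : FeeLevel) (k i : ℕ) :
    MeasurableSet {e : ℕ → C.Event | e k = .inl (n, c) ∧ k ∈ queue kind e (k + 1 + i)} := by
  refine (DependsOn.measurable_of_finite (β := Prop) (s := Finset.range (k + 1 + i))
    (fun e e' h => ?_)).setOf
  rw [h k (by simp; omega), queue_congr (κ := kind) fun i hi => h i (by simpa using hi)]

theorem lintegral_occurred_mul_gap (t : ℝ) (k i : ℕ) :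
    ∫⁻ τ, Set.indicator {τ : ℕ → ℝ | ∑ i ∈ Finset.range (k + 1), τ i ≤ t} 1 τ
        * ENNReal.ofReal (τ (k + 1 + i)) ∂gapLaw (C.totalRate r)
      = ENNReal.ofReal (eventProbUpTo (C.totalRate r) t k * (1 / C.totalRate r)) := by
  have hθ := totalRate_pos_real r
  have hf : Measurable (Set.indicator {τ : ℕ → ℝ | ∑ i ∈ Finset.range (k + 1), τ i ≤ t}
      (1 : (ℕ → ℝ) → ℝ≥0∞)) := measurable_one.indicator (measurableSet_sum_range_le t k)
  have h := lintegral_infinitePi_mul_apply (expMeasure (C.totalRate r : ℝ)) (k := k + 1 + i) hf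
    (fun τ x => by
      have h1 : ∑ j ∈ Finset.range (k + 1), Function.update τ (k + 1 + i) x j
          = ∑ j ∈ Finset.range (k + 1), τ j :=
        Finset.sum_congr rfl fun j hj => by
          rw [Function.update_of_ne (by have := Finset.mem_range.1 hj; omega)]
      classical
      simp only [Set.indicator_apply, Set.mem_ofPred_eq, h1]
      rfl) (g := ENNReal.ofReal) (by fun_prop)
  rw [lintegral_expMeasure hθ, lintegral_indicator_one (measurableSet_sum_range_le t k)] at h
  rw [ENNReal.ofReal_mul (eventProbUpTo_nonneg _ _ _), ofReal_eventProbUpTo hθ]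
  exact h

theorem lintegral_wait_term (t : ℝ) (n : C.User) (c : FeeLevel) (k i : ℕ) :
    ∫⁻ ω, ENNReal.ofReal (occurred t k ω)
        * (Set.indicator {e | e k = .inl (n, c) ∧ k ∈ queue kind e (k + 1 + i)} 1 (event ω)
          * ENNReal.ofReal (ω (k + 1 + i)).1) ∂C.law r
      = ENNReal.ofReal (eventProbUpTo (C.totalRate r) t k * (1 / C.totalRate r))
        * ENNReal.ofReal ((eventSeqLaw r).real
          {e | e k = .inl (n, c) ∧ k ∈ queue kind e (k + 1 + i)}) := by
  have h := lintegral_law_mul r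
    (f := fun τ => Set.indicator {τ : ℕ → ℝ | ∑ i ∈ Finset.range (k + 1), τ i ≤ t} 1 τ
        * ENNReal.ofReal (τ (k + 1 + i)))
    ((measurable_one.indicator (measurableSet_sum_range_le t k)).mul (by fun_prop))
    (g := Set.indicator {e | e k = .inl (n, c) ∧ k ∈ queue kind e (k + 1 + i)} 1)
    (measurable_one.indicator (measurableSet_waits n c k i)) (h := 1) measurable_one
  rw [lintegral_occurred_mul_gap, lintegral_indicator_one (measurableSet_waits n c k i)] at h
  simp only [Pi.one_apply, mul_one, lintegral_const, measure_univ] at h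
  rw [measureReal_def, ENNReal.ofReal_toReal (measure_ne_top _ _), ← h]
  refine lintegral_congr fun ω => ?_
  have h2 : ENNReal.ofReal (occurred t k ω)
      = Set.indicator {τ : ℕ → ℝ | ∑ i ∈ Finset.range (k + 1), τ i ≤ t} 1 fun i => (ω i).1 := by
    classical
    rw [occurred, Set.indicator_apply, Set.indicator_apply]
    split_ifs <;> simp
  rw [h2]
  ring

theorem measurable_event : Measurable (event : C.History → ℕ → C.Event) := by
  unfold event
  fun_prop

theorem measurable_occurred (t : ℝ) (k : ℕ) : Measurable (occurred t k : C.History → ℝ) := by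
  unfold occurred
  exact (measurable_one.indicator (measurableSet_sum_range_le t k)).comp (by fun_prop)

/-- The contribution of event `k` to the waiting times of user `n`, summed over the fee levels and
over the gaps during which the transaction waits. -/
theorem occurred_mul_gapsWaited (t : ℝ) (n : C.User) (k : ℕ) (ω : C.History)
    [Decidable (eventTime ω k ≤ t ∧ IsTxOf ω n k)] :
    (if eventTime ω k ≤ t ∧ IsTxOf ω n k then gapsWaited ω k else 0)
      = ∑ c, ∑' i, ENNReal.ofReal (occurred t k ω)
        * (Set.indicator {e | e k = .inl (n, c) ∧ k ∈ queue kind e (k + 1 + i)} 1 (event ω)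
          * ENNReal.ofReal (ω (k + 1 + i)).1) := by
  classical
  rw [occurred_eq]
  by_cases h1 : eventTime ω k ≤ t
  · by_cases h2 : IsTxOf ω n k
    · rw [if_pos ⟨h1, h2⟩, if_pos h1]
      obtain ⟨c, hc⟩ := h2
      rw [Finset.sum_eq_single c]
      · rw [gapsWaited]
        refine tsum_congr fun i => ?_
        simp [Set.indicator_apply, hc]
      · intro c' _ hc'
        simp [hc, hc'.symm]
      · simp
    · rw [if_neg (fun h => h2 h.2)]
      symm
      refine Finset.sum_eq_zero fun c _ => ?_
      have : event ω k ≠ .inl (n, c) := fun h => h2 ⟨c, h⟩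
      simp [this]
  · simp [h1]

theorem lintegral_gapsWaited [∀ ω k t n, Decidable (eventTime (C := C) ω k ≤ t ∧ IsTxOf ω n k)]
    (t : ℝ) (n : C.User) :
    ∫⁻ ω, ∑' k, (if eventTime ω k ≤ t ∧ IsTxOf ω n k then gapsWaited ω k else 0) ∂C.law r
      = ∑' k, ∑ c, ∑' i, ENNReal.ofReal (eventProbUpTo (C.totalRate r) t k * (1 / C.totalRate r))
        * ENNReal.ofReal ((eventSeqLaw r).real
          {e | e k = .inl (n, c) ∧ k ∈ queue kind e (k + 1 + i)}) := by
  have hm : ∀ k c i, Measurable fun ω : C.History => ENNReal.ofReal (occurred t k ω)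
        * (Set.indicator {e | e k = .inl (n, c) ∧ k ∈ queue kind e (k + 1 + i)} 1 (event ω)
          * ENNReal.ofReal (ω (k + 1 + i)).1) := by
    intro k c i
    refine (measurable_occurred t k).ennreal_ofReal.mul
      (((measurable_one.indicator (measurableSet_waits n c k i)).comp measurable_event).mul
        (by fun_prop))
  simp only [occurred_mul_gapsWaited]
  rw [lintegral_tsum fun k => (Finset.measurable_sum _ fun c _ =>
    Measurable.tsum (hm k c)).aemeasurable]
  refine tsum_congr fun k => ?_
  rw [lintegral_finsetSum _ fun c _ => Measurable.tsum (hm k c)]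
  refine Finset.sum_congr rfl fun c _ => ?_
  rw [lintegral_tsum fun i => (hm k c i).aemeasurable]
  exact tsum_congr fun i => lintegral_wait_term r t n c k i

variable {r}

section Served

variable (hX : C.IsMinerEquilibrium X) (hT : T.feeLow < T.feeHigh)
  (hfee : ∀ n c, 0 < r n c → C.storageCost ≤ T.fee c)
include hX hT hfee

theorem le_expectedWaiting (t : ℝ) (n : C.User) :
    ∑' k, ∑ c, ∑' i, ENNReal.ofReal (eventProbUpTo (C.totalRate r) t k * (1 / C.totalRate r))
        * ENNReal.ofReal ((eventSeqLaw r).real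
          {e | e k = .inl (n, c) ∧ k ∈ queue kind e (k + 1 + i)})
      ≤ expectedWaiting T X r n t := by
  classical
  rw [← lintegral_gapsWaited, expectedWaiting]
  refine lintegral_mono_ae ?_
  filter_upwards [ae_served r hfee, ae_gap_nonneg r] with ω h1 h2
  refine ENNReal.tsum_le_tsum fun k => ?_
  split_ifs
  · exact gapsWaited_le_waitingTime hX hT h1 h2 k
  · exact le_rfl

/-- If the positions of waiting transactions have negative drift, every transaction is included
almost surely, even if the queue is critical. -/
theorem ae_included (h : ∀ c, 0 < slack r c) :
    ∀ᵐ ω ∂C.law r, ∀ k, kind (event ω k) ≠ none → Included T X ω k := by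
  have h1 : ∀ n c k, ∀ᵐ e ∂eventSeqLaw r, ∀ᶠ i in atTop,
      e ∉ {e : ℕ → C.Event | e k = .inl (n, c) ∧ k ∈ queue kind e (k + 1 + i)} := by
    intro n c k
    refine ae_eventually_notMem ?_
    have h2 := (hasSum_prob_tx_waiting r (n := n)
      (h c) k).summable.tsum_ofReal_ne_top
    simpa only [measureReal_def, ENNReal.ofReal_toReal (measure_ne_top _ _)] using h2
  have h3 : ∀ᵐ e ∂eventSeqLaw r, ∀ n c k, ∀ᶠ i in atTop,
      e ∉ {e : ℕ → C.Event | e k = .inl (n, c) ∧ k ∈ queue kind e (k + 1 + i)} := by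
    simp only [ae_all_iff]
    exact h1
  have h4 := (Measure.quasiMeasurePreserving_fst (μ := eventSeqLaw r) (ν := C.sizeSeqLaw)).ae h3
  have h5 := (Measure.quasiMeasurePreserving_snd (μ := gapLaw (C.totalRate r))
    (ν := (eventSeqLaw r).prod C.sizeSeqLaw)).ae h4
  have h6 := (measurePreserving_split r).quasiMeasurePreserving.ae h5
  filter_upwards [h6, ae_served r hfee] with ω h7 h8 k hk
  obtain ⟨c, hc⟩ := Option.ne_none_iff_exists'.1 hk
  obtain ⟨n, hn⟩ := kind_eq_some.1 hc
  obtain ⟨i, hi⟩ := (h7 n c k).exists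
  exact included_of_notMem_queue hX hT h8 hk (i := i) fun h => hi ⟨hn, h⟩

/-- The mean waiting cost that event `k` brings to user `n`, up to the impatience. -/
noncomputable def waitTerm (r : C.Rates) (n : C.User) (k : ℕ) : ℝ :=
  1 / C.totalRate r * ∑ c, (r n c * (meanAhead r c k + 1) / slack r c)

omit hX hT hfee in
/-- The load may be critical at a fee level that the user does not use. -/
theorem tendsto_waitTerm {n : C.User} (h : ∀ c, 0 < r n c → load r c < C.blockRate) :
    Tendsto (waitTerm r n) atTop (𝓝 (1 / C.totalRate r * ∑ c,
      (r n c * (load r c / (C.blockRate - load r c) + 1) / slack r c))) := by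
  refine Tendsto.const_mul _ (tendsto_finsetSum _ fun c _ => ?_)
  rcases eq_zero_or_pos (r n c) with h0 | h0
  · simp [h0]
  · exact (((tendsto_meanAhead r (h c h0)).add_const 1).const_mul _).div_const _

theorem expectedWaiting_eq (hslack : ∀ c, 0 < slack r c) {n : C.User}
    (h : ∀ c, 0 < r n c → load r c < C.blockRate) {t : ℝ} (ht : 0 ≤ t) :
    expectedWaiting T X r n t
      = ENNReal.ofReal (∑' k, eventProbUpTo (C.totalRate r) t k * waitTerm r n k) := by
  classical
  have hθ := totalRate_pos_real r
  have h1 : expectedWaiting T X r n t = ∫⁻ ω, ∑' k,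
      (if eventTime ω k ≤ t ∧ IsTxOf ω n k then gapsWaited ω k else 0) ∂C.law r := by
    rw [expectedWaiting]
    refine lintegral_congr_ae ?_
    filter_upwards [ae_served r hfee, ae_gap_nonneg r, ae_included hX hT hfee hslack]
      with ω h1 h2 h3
    refine tsum_congr fun k => ?_
    by_cases h4 : eventTime ω k ≤ t ∧ IsTxOf ω n k
    · obtain ⟨-, c, hc⟩ := id h4
      rw [if_pos h4, if_pos h4,
        waitingTime_of_included hX hT h1 h2 (h3 k (by rw [hc]; simp [kind]))]
    · rw [if_neg h4, if_neg h4]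
  have hnn : ∀ c k, 0 ≤ r n c * (meanAhead r c k + 1) / slack r c := by
    intro c k
    have := meanAhead_nonneg r c k
    have := hslack c
    positivity
  have h2 : ∀ k, 0 ≤ waitTerm r n k := fun k =>
    mul_nonneg (by positivity) (Finset.sum_nonneg fun c _ => hnn c k)
  have h3 : Summable fun k => eventProbUpTo (C.totalRate r) t k * waitTerm r n k := by
    obtain ⟨B, hB⟩ := (tendsto_waitTerm h).abs.bddAbove_range
    exact summable_eventProbUpTo_mul hθ ht fun k => hB ⟨k, rfl⟩
  rw [h1, lintegral_gapsWaited, ENNReal.ofReal_tsum_of_nonneg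
    (fun k => mul_nonneg (eventProbUpTo_nonneg _ _ _) (h2 k)) h3]
  refine tsum_congr fun k => ?_
  have h4 : ∀ c, ∑' i, ENNReal.ofReal (eventProbUpTo (C.totalRate r) t k * (1 / C.totalRate r))
        * ENNReal.ofReal ((eventSeqLaw r).real
          {e | e k = .inl (n, c) ∧ k ∈ queue kind e (k + 1 + i)})
      = ENNReal.ofReal (eventProbUpTo (C.totalRate r) t k * (1 / C.totalRate r)
        * (r n c * (meanAhead r c k + 1) / slack r c)) := by
    intro c
    have h5 := hasSum_prob_tx_waiting r (n := n) (hslack c) k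
    rw [ENNReal.tsum_mul_left, ← ENNReal.ofReal_tsum_of_nonneg (fun _ => measureReal_nonneg)
      h5.summable, h5.tsum_eq, ← ENNReal.ofReal_mul]
    exact mul_nonneg (eventProbUpTo_nonneg _ _ _) (by positivity)
  simp only [h4]
  rw [← ENNReal.ofReal_sum_of_nonneg]
  · rw [waitTerm, ← Finset.mul_sum, mul_assoc]
  · exact fun c _ => mul_nonneg (mul_nonneg (eventProbUpTo_nonneg _ _ _) (by positivity)) (hnn c k)

/-- A lower bound on the waiting times that also holds in a critical queue, where the mean queue
length is truncated at `J`. -/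
theorem le_expectedWaiting_of_slack_pos {n : C.User} {c : FeeLevel} (hs : 0 < slack r c) {t : ℝ}
    (ht : 0 ≤ t) {J : ℝ} (hJ : 0 ≤ J) :
    ENNReal.ofReal (∑' k, eventProbUpTo (C.totalRate r) t k
        * (1 / C.totalRate r * (r n c * (min (meanAhead r c k) J + 1) / slack r c)))
      ≤ expectedWaiting T X r n t := by
  have hθ := totalRate_pos_real r
  refine le_trans ?_ (le_expectedWaiting hX hT hfee t n)
  have hnn : ∀ k, 0 ≤ 1 / C.totalRate r
      * (r n c * (min (meanAhead r c k) J + 1) / slack r c) := by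
    intro k
    have : 0 ≤ min (meanAhead r c k) J := le_min (meanAhead_nonneg r c k) hJ
    positivity
  have h3 : Summable fun k => eventProbUpTo (C.totalRate r) t k
      * (1 / C.totalRate r * (r n c * (min (meanAhead r c k) J + 1) / slack r c)) := by
    refine summable_eventProbUpTo_mul hθ ht
      (B := 1 / C.totalRate r * (r n c * (J + 1) / slack r c)) fun k => ?_
    rw [abs_of_nonneg (hnn k)]
    gcongr
    exact min_le_right _ _
  rw [ENNReal.ofReal_tsum_of_nonneg
    (fun k => mul_nonneg (eventProbUpTo_nonneg _ _ _) (hnn k)) h3]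
  refine ENNReal.tsum_le_tsum fun k => ?_
  refine le_trans ?_ (Finset.single_le_sum (fun _ _ => zero_le) (Finset.mem_univ c))
  have h5 := hasSum_prob_tx_waiting r (n := n) hs k
  rw [ENNReal.tsum_mul_left, ← ENNReal.ofReal_tsum_of_nonneg (fun _ => measureReal_nonneg)
    h5.summable, h5.tsum_eq, ← ENNReal.ofReal_mul (mul_nonneg (eventProbUpTo_nonneg _ _ _)
    (by positivity)), mul_assoc]
  refine ENNReal.ofReal_le_ofReal (mul_le_mul_of_nonneg_left ?_ (eventProbUpTo_nonneg _ _ _))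
  gcongr
  exact min_le_left _ _

end Served

/-- A user whose transactions are not worth storing for a single miner waits forever. -/
theorem expectedWaiting_eq_top (hX : C.IsMinerEquilibrium X) {n : C.User} {c : FeeLevel}
    (hr : 0 < r n c) (hc : T.fee c < C.storageCost) {t : ℝ} (ht : 0 < t) :
    expectedWaiting T X r n t = ⊤ := by
  classical
  have hθ := totalRate_pos_real r
  obtain ⟨k, hk⟩ : ∃ k, 0 < eventProbUpTo (C.totalRate r) t k := by
    by_contra! h
    have h1 := hasSum_eventProbUpTo hθ ht.le
    have h2 : eventProbUpTo (C.totalRate r) t = fun _ => 0 :=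
      funext fun k => le_antisymm (h k) (eventProbUpTo_nonneg _ _ _)
    rw [h2] at h1
    have := h1.unique hasSum_zero
    have := mul_pos hθ ht
    linarith
  have hset : MeasurableSet {e : ℕ → C.Event | e k = .inl (n, c)} :=
    (measurable_pi_apply k) (MeasurableSet.singleton _)
  have h1 := lintegral_law_mul r
    (f := Set.indicator {τ : ℕ → ℝ | ∑ i ∈ Finset.range (k + 1), τ i ≤ t} 1)
    (measurable_one.indicator (measurableSet_sum_range_le t k))
    (g := Set.indicator {e : ℕ → C.Event | e k = .inl (n, c)} fun _ => ⊤)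
    (measurable_const.indicator hset) (h := 1) measurable_one
  have hP : eventSeqLaw r {e : ℕ → C.Event | e k = .inl (n, c)} ≠ 0 := by
    have h2 := (measurePreserving_eval_infinitePi (fun _ : ℕ => (C.eventLaw r).toMeasure)
      k).measure_preimage (MeasurableSet.singleton (Sum.inl (n, c) : C.Event)).nullMeasurableSet
    have h3 : eventSeqLaw r {e : ℕ → C.Event | e k = .inl (n, c)}
        = (C.eventLaw r).toMeasure {.inl (n, c)} := h2
    rw [h3, PMF.toMeasure_apply_singleton _ _ (MeasurableSet.singleton _)]
    have : 0 < C.eventProb r (.inl (n, c)) := div_pos hr (C.totalRate_pos r)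
    simpa [eventLaw] using this.ne'
  have hG : gapLaw (C.totalRate r) {τ : ℕ → ℝ | ∑ i ∈ Finset.range (k + 1), τ i ≤ t} ≠ 0 := by
    rw [← ofReal_eventProbUpTo hθ]
    simpa using hk
  rw [lintegral_indicator_one (measurableSet_sum_range_le t k), lintegral_indicator hset,
    lintegral_const] at h1
  simp only [Measure.restrict_apply MeasurableSet.univ, Set.univ_inter, Pi.one_apply, mul_one,
    lintegral_const, measure_univ] at h1
  rw [ENNReal.top_mul hP, ENNReal.mul_top hG] at h1
  rw [← top_le_iff, ← h1, expectedWaiting]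
  refine lintegral_mono_ae ?_
  filter_upwards [ae_size_pos r] with ω hω
  refine le_trans ?_ (ENNReal.le_tsum k)
  by_cases h2 : event ω k = .inl (n, c)
  · by_cases h3 : eventTime ω k ≤ t
    · rw [if_pos ⟨h3, c, h2⟩, waitingTime, dif_neg]
      · exact le_top
      · exact not_included_of_fee_lt hX (c := c) (by rw [h2]; rfl) (hω k) hc
    · rw [Set.indicator_of_notMem (show (fun i => (ω i).1) ∉ _ from h3), zero_mul]
      exact zero_le
  · rw [Set.indicator_of_notMem (show event ω ∉ _ from h2), mul_zero]
    exact zero_le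

theorem expectedWaiting_eq_zero {n : C.User} (hr : ∀ c, r n c = 0) (t : ℝ) :
    expectedWaiting T X r n t = 0 := by
  classical
  rw [expectedWaiting]
  refine lintegral_eq_zero_of_ae_eq_zero ?_
  filter_upwards [ae_rate_pos r] with ω hω
  refine ENNReal.tsum_eq_zero.2 fun k => if_neg ?_
  rintro ⟨-, c, hc⟩
  have := hω k n c hc
  rw [hr c] at this
  exact this.false

end Blockchain

/-! ### Expected rewards of the users and the miners -/

namespace Blockchain

open ProbabilityTheory PriorityQueue Topology

variable {C : Blockchain} (r : C.Rates) {T : Mechanism} {X : C.MinerProfile}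

/-- A reward that is brought by event `k`, depends on the type of the event and is affine in the
size of the transaction, as collected up to time `t`. -/
noncomputable def reward (a b : C.Event → ℝ) (t : ℝ) (k : ℕ) (ω : C.History) : ℝ :=
  occurred t k ω * (a (event ω k) * 1) + occurred t k ω * (b (event ω k) * txSize ω k)

theorem integrable_comp_event (a : C.Event → ℝ) (k : ℕ) :
    Integrable (fun e : ℕ → C.Event => a (e k)) (eventSeqLaw r) :=
  (measurePreserving_eval_infinitePi (fun _ : ℕ => (C.eventLaw r).toMeasure)
    k).integrable_comp_of_integrable Integrable.of_finite

theorem integral_comp_event (a : C.Event → ℝ) (k : ℕ) :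
    ∫ e, a (e k) ∂eventSeqLaw r = ∫ x, a x ∂(C.eventLaw r).toMeasure := by
  have h := measurePreserving_eval_infinitePi (fun _ : ℕ => (C.eventLaw r).toMeasure) k
  conv_rhs => rw [← h.map_eq, integral_map h.measurable.aemeasurable
    (Measurable.of_discrete).aestronglyMeasurable]
  rfl

/-- The mean of a reward brought by one event. -/
noncomputable def meanReward (a b : C.Event → ℝ) : ℝ :=
  ∫ x, a x ∂(C.eventLaw r).toMeasure + (∫ x, b x ∂(C.eventLaw r).toMeasure) * C.meanSize

theorem integrable_reward (a b : C.Event → ℝ) (t : ℝ) (k : ℕ) :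
    Integrable (reward a b t k) (C.law r) :=
  (integrable_law_mul r (integrable_comp_event r a k) (integrable_const 1) t k k).add
    (integrable_law_mul r (integrable_comp_event r b k) C.sizeLaw_integrable t k k)

theorem integral_reward (a b : C.Event → ℝ) (t : ℝ) (k : ℕ) :
    ∫ ω, reward a b t k ω ∂C.law r
      = eventProbUpTo (C.totalRate r) t k * meanReward r a b := by
  unfold reward
  rw [integral_add
    (integrable_law_mul r (integrable_comp_event r a k) (integrable_const 1) t k k)
    (integrable_law_mul r (integrable_comp_event r b k) C.sizeLaw_integrable t k k),
    integral_law_mul r (integrable_comp_event r a k) (integrable_const 1) t k k,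
    integral_law_mul r (integrable_comp_event r b k) C.sizeLaw_integrable t k k,
    integral_comp_event, integral_comp_event, meanReward, meanSize]
  simp only [integral_const, probReal_univ, smul_eq_mul, mul_one]
  ring

theorem reward_nonneg {a b : C.Event → ℝ} (ha : ∀ x, 0 ≤ a x) (hb : ∀ x, 0 ≤ b x) (t : ℝ) (k : ℕ)
    {ω : C.History} (hω : 0 < txSize ω k) : 0 ≤ reward a b t k ω := by
  have h1 := occurred_nonneg t k ω
  have h2 := ha (event ω k)
  have h3 := hb (event ω k)
  unfold reward
  positivity

/-- Rewards whose absolute values are bounded by affine functions of the sizes grow at most linearly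
in time. -/
theorem abs_integral_tsum_le {f : C.History → ℕ → ℝ} {a b : C.Event → ℝ} (ha : ∀ x, 0 ≤ a x)
    (hb : ∀ x, 0 ≤ b x) {t : ℝ} (ht : 0 ≤ t)
    (hf : ∀ᵐ ω ∂C.law r, ∀ k, |f ω k| ≤ reward a b t k ω) :
    |∫ ω, ∑' k, f ω k ∂C.law r| ≤ C.totalRate r * t * meanReward r a b := by
  have hθ := totalRate_pos_real r
  have hsum := (hasSum_eventProbUpTo hθ ht).mul_right (meanReward r a b)
  have hnn : ∀ k, 0 ≤ eventProbUpTo (C.totalRate r) t k * meanReward r a b := by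
    intro k
    rw [← integral_reward]
    refine integral_nonneg_of_ae ?_
    filter_upwards [ae_size_pos r] with ω hω
    exact reward_nonneg ha hb t k (hω k)
  have h1 : ‖∫ ω, ∑' k, f ω k ∂C.law r‖ₑ
      ≤ ENNReal.ofReal (C.totalRate r * t * meanReward r a b) := by
    calc ‖∫ ω, ∑' k, f ω k ∂C.law r‖ₑ ≤ ∫⁻ ω, ‖∑' k, f ω k‖ₑ ∂C.law r :=
          enorm_integral_le_lintegral_enorm _
      _ ≤ ∫⁻ ω, ∑' k, ENNReal.ofReal (reward a b t k ω) ∂C.law r := by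
          refine lintegral_mono_ae ?_
          filter_upwards [hf] with ω hω
          refine enorm_tsum_le_tsum_enorm.trans (ENNReal.tsum_le_tsum fun k => ?_)
          rw [← ofReal_norm, Real.norm_eq_abs]
          exact ENNReal.ofReal_le_ofReal (hω k)
      _ = ∑' k, ENNReal.ofReal (eventProbUpTo (C.totalRate r) t k * meanReward r a b) := by
          rw [lintegral_tsum fun k =>
            (integrable_reward r a b t k).aestronglyMeasurable.aemeasurable.ennreal_ofReal]
          refine tsum_congr fun k => ?_
          rw [← integral_reward, ofReal_integral_eq_lintegral_ofReal (integrable_reward r a b t k)]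
          filter_upwards [ae_size_pos r] with ω hω
          exact reward_nonneg ha hb t k (hω k)
      _ = ENNReal.ofReal (C.totalRate r * t * meanReward r a b) := by
          rw [← ENNReal.ofReal_tsum_of_nonneg hnn hsum.summable, hsum.tsum_eq]
  rw [← ofReal_norm, Real.norm_eq_abs] at h1
  refine (ENNReal.ofReal_le_ofReal_iff ?_).1 h1
  rw [← hsum.tsum_eq]
  exact tsum_nonneg hnn

theorem abs_reward_le (a b : C.Event → ℝ) (t : ℝ) (k : ℕ) {ω : C.History} (hω : 0 < txSize ω k) :
    |reward a b t k ω| ≤ reward (fun x => |a x|) (fun x => |b x|) t k ω := by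
  have h1 := occurred_nonneg t k ω
  unfold reward
  refine (abs_add_le _ _).trans (le_of_eq ?_)
  rw [abs_mul, abs_mul, abs_mul, abs_mul, abs_of_nonneg h1, abs_of_pos hω, abs_one]

theorem integral_tsum_reward (a b : C.Event → ℝ) {t : ℝ} (ht : 0 ≤ t) :
    ∫ ω, ∑' k, reward a b t k ω ∂C.law r = C.totalRate r * t * meanReward r a b := by
  have hθ := totalRate_pos_real r
  have h := hasSum_integral_of_summable_integral_norm (fun k => integrable_reward r a b t k) (by
    refine Summable.of_nonneg_of_le (fun k => integral_nonneg fun ω => norm_nonneg _) (fun k => ?_)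
      ((hasSum_eventProbUpTo hθ ht).mul_right
        (meanReward r (fun x => |a x|) fun x => |b x|)).summable
    rw [← integral_reward]
    refine integral_mono_ae (integrable_reward r a b t k).norm (integrable_reward r _ _ t k) ?_
    filter_upwards [ae_size_pos r] with ω hω
    exact abs_reward_le a b t k (hω k))
  simp only [integral_reward] at h
  exact h.unique ((hasSum_eventProbUpTo hθ ht).mul_right _)

/-- Total tax that user `n` pays for one transaction. -/
def taxPaid (T : Mechanism) (n : C.User) : ℝ := ∑ j ∈ Finset.univ.erase n, C.tax T n j

open scoped Classical in
/-- The part of the balance of user `n` that does not depend on the size. -/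
noncomputable def balanceFixed (T : Mechanism) (n : C.User) : C.Event → ℝ
  | .inl (l, _) => if l = n then C.util n - taxPaid T n else C.tax T l n
  | .inr _ => 0

open scoped Classical in
/-- The part of the balance of user `n` that is proportional to the size. -/
noncomputable def balancePerByte (T : Mechanism) (n : C.User) : C.Event → ℝ
  | .inl (l, c) => if l = n then -T.fee c else 0
  | .inr _ => 0

theorem txBalance_of_included {n : C.User} {ω : C.History} {k : ℕ} (h : Included T X ω k) :
    txBalance T X n ω k
      = balanceFixed T n (event ω k) + balancePerByte T n (event ω k) * txSize ω k := by
  classical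
  rw [txBalance, if_pos h]
  rcases event ω k with ⟨l, c⟩ | m
  · simp only [balanceFixed, balancePerByte, taxPaid]
    split_ifs <;> ring
  · simp [balanceFixed, balancePerByte]

theorem abs_txBalance_le {n : C.User} {ω : C.History} {k : ℕ} (hω : 0 < txSize ω k) :
    |txBalance T X n ω k|
      ≤ |balanceFixed T n (event ω k)| + |balancePerByte T n (event ω k)| * txSize ω k := by
  classical
  by_cases h : Included T X ω k
  · rw [txBalance_of_included h]
    refine (abs_add_le _ _).trans (le_of_eq ?_)
    rw [abs_mul, abs_of_pos hω]
  · rw [txBalance, if_neg h, abs_zero]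
    positivity

/-- What user `n` receives per unit time, apart from waiting costs, when all transactions are
included. -/
noncomputable def balanceRate (T : Mechanism) (r : C.Rates) (n : C.User) : ℝ :=
  ∑ c, r n c * (C.util n - C.meanSize * T.fee c - taxPaid T n)
    + ∑ l ∈ Finset.univ.erase n, (∑ c, (r l c : ℝ)) * C.tax T l n

theorem totalRate_mul_meanReward (n : C.User) :
    C.totalRate r * meanReward r (balanceFixed T n) (balancePerByte T n) = balanceRate T r n := by
  classical
  have hθ := (totalRate_pos_real r).ne'
  have h1 : ∀ a : C.Event → ℝ, (∀ m, a (.inr m) = 0) →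
      C.totalRate r * ∑ x, (C.eventProb r x : ℝ) * a x
        = ∑ l, ∑ c, r l c * a (.inl (l, c)) := by
    intro a ha
    rw [Fintype.sum_sum_type, Fintype.sum_prod_type]
    simp only [ha, mul_zero, Finset.sum_const_zero, add_zero, Finset.mul_sum]
    refine Finset.sum_congr rfl fun l _ => Finset.sum_congr rfl fun c _ => ?_
    simp only [eventProb]
    push_cast
    field_simp
  rw [meanReward, integral_eventLaw, integral_eventLaw, mul_add, ← mul_assoc,
    h1 _ fun _ => rfl, h1 _ fun _ => rfl, balanceRate,
    ← Finset.add_sum_erase _ _ (Finset.mem_univ n),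
    ← Finset.add_sum_erase _ (fun l => ∑ c, r l c * balancePerByte T n (.inl (l, c)))
      (Finset.mem_univ n)]
  have h2 : ∑ l ∈ Finset.univ.erase n, ∑ c, (r l c : ℝ) * balanceFixed T n (.inl (l, c))
      = ∑ l ∈ Finset.univ.erase n, (∑ c, (r l c : ℝ)) * C.tax T l n := by
    refine Finset.sum_congr rfl fun l hl => ?_
    simp [balanceFixed, Finset.ne_of_mem_erase hl, Finset.sum_mul]
  have h3 : ∑ l ∈ Finset.univ.erase n, ∑ c, (r l c : ℝ) * balancePerByte T n (.inl (l, c)) = 0 := by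
    refine Finset.sum_eq_zero fun l hl => ?_
    simp [balancePerByte, Finset.ne_of_mem_erase hl]
  rw [h2, h3]
  simp only [balanceFixed, balancePerByte, sum_feeLevel, if_true]
  ring

theorem abs_expectedBalance_le (n : C.User) {t : ℝ} (ht : 0 ≤ t) :
    |expectedBalance T X r n t| ≤ C.totalRate r * t
      * meanReward r (fun x => |balanceFixed T n x|) fun x => |balancePerByte T n x| := by
  classical
  rw [expectedBalance]
  refine abs_integral_tsum_le r (fun _ => abs_nonneg _) (fun _ => abs_nonneg _) ht ?_
  filter_upwards [ae_size_pos r] with ω hω k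
  rw [reward, occurred_eq]
  split_ifs
  · rw [one_mul, one_mul, mul_one]
    exact abs_txBalance_le (hω k)
  · simp

theorem expectedBalance_eq (hX : C.IsMinerEquilibrium X) (hT : T.feeLow < T.feeHigh)
    (hfee : ∀ n c, 0 < r n c → C.storageCost ≤ T.fee c) (h : ∀ c, 0 < slack r c)
    (n : C.User) {t : ℝ} (ht : 0 ≤ t) :
    expectedBalance T X r n t = t * balanceRate T r n := by
  classical
  rw [← totalRate_mul_meanReward, ← mul_assoc, mul_comm t, ← integral_tsum_reward r _ _ ht,
    expectedBalance]
  refine integral_congr_ae ?_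
  filter_upwards [ae_included hX hT hfee h] with ω hω
  refine tsum_congr fun k => ?_
  rw [reward, occurred_eq]
  split_ifs with h1
  · by_cases h2 : kind (event ω k) = none
    · obtain ⟨m, hm⟩ := kind_eq_none.1 h2
      simp [txBalance, hm, balanceFixed, balancePerByte]
    · rw [txBalance_of_included (hω k h2)]
      ring
  · simp

/-! ### The rewards of the miners -/

theorem minerBalance_eq (hX : C.IsMinerEquilibrium X) (hT : T.feeLow < T.feeHigh) {ω : C.History}
    (hω : Served T ω) (m : C.Miner) (k : ℕ) :
    minerBalance T X m ω k = ∑ j ∈ Finset.range k, ∑ c,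
      Set.indicator {e : ℕ → C.Event | kind (e k) = none ∧ j ∈ front kind e (queue kind e k)
        ∧ kind (e j) = some c} 1 (event ω)
      * (txSize ω j * (C.power m * T.fee c - C.storageCost)) := by
  classical
  rcases he : event ω k with ⟨n, c⟩ | m'
  · have h1 : kind (event ω k) ≠ none := by rw [he]; simp [kind]
    rw [minerBalance, he]
    symm
    refine Finset.sum_eq_zero fun j _ => Finset.sum_eq_zero fun c _ => ?_
    rw [Set.indicator_of_notMem (fun h => h1 h.1), zero_mul]
  · have h1 : kind (event ω k) = none := by rw [he]; rfl
    have hw := waiting_eq_queue hX hT hω k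
    rw [minerBalance, he]
    simp only
    have hsel : ∀ j, X j (poolAt T X ω k) = front kind (event ω) (queue kind (event ω) k) := by
      intro j
      rw [poolAt, hw]
      exact miner_select_eq_front hX hT hω (fun i hi => kind_ne_none_of_mem_queue hi) j
    have hpow : ∑ j, (C.power j : ℝ) = 1 := by exact_mod_cast C.sum_power
    rw [roundPayoff]
    simp only [hsel]
    rw [← Finset.sum_mul, hpow, one_mul, Finset.mul_sum, ← Finset.sum_sub_distrib]
    have hsub : front kind (event ω) (queue kind (event ω) k) ⊆ Finset.range k := fun j hj =>
      Finset.mem_range.2 (lt_of_mem_queue (front_subset _ hj))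
    rw [← Finset.sum_subset hsub]
    · refine Finset.sum_congr rfl fun j hj => ?_
      obtain ⟨c, hc⟩ := Option.ne_none_iff_exists'.1
        (kind_ne_none_of_mem_queue (front_subset _ hj))
      rw [Finset.sum_eq_single c]
      · rw [Set.indicator_of_mem (show event ω ∈ {e : ℕ → C.Event | kind (e k) = none
          ∧ j ∈ front kind e (queue kind e k) ∧ kind (e j) = some c} from ⟨h1, hj, hc⟩)]
        simp only [poolAt, txFee_of_kind hc, Pi.one_apply]
        ring
      · intro c' _ hc'
        rw [Set.indicator_of_notMem, zero_mul]
        rintro ⟨-, -, h⟩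
        rw [hc] at h
        exact hc' (Option.some.inj h).symm
      · simp
    · intro j _ hj
      refine Finset.sum_eq_zero fun c _ => ?_
      rw [Set.indicator_of_notMem (fun h => hj h.2.1), zero_mul]

theorem meanSize_pos : 0 < C.meanSize := by
  refine (integral_pos_iff_support_of_nonneg_ae ?_ C.sizeLaw_integrable).2 ?_
  · filter_upwards [C.sizeLaw_pos] with s hs using hs.le
  · have h : Function.support (fun s : ℝ => s) =ᵐ[C.sizeLaw] Set.univ := by
      filter_upwards [C.sizeLaw_pos] with s hs
      exact propext ⟨fun _ => trivial, fun _ => hs.ne'⟩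
    rw [measure_congr h, measure_univ]
    exact one_pos

/-- The mean payoff of miner `m` in the round that ends at event `k`. -/
noncomputable def minerTerm (T : Mechanism) (r : C.Rates) (m : C.Miner) (k : ℕ) : ℝ :=
  ∑ c, serveProb (C.eventLaw r).toMeasure kind c k
    * (C.meanSize * (C.power m * T.fee c - C.storageCost))

theorem tendsto_serveProb_kind (h : load r .low < C.blockRate) (c : FeeLevel) :
    Tendsto (serveProb (C.eventLaw r).toMeasure kind c) atTop
      (𝓝 (levelRate r c / C.totalRate r)) := by
  have hθ := totalRate_pos_real r
  rw [← measureReal_kind_some]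
  refine tendsto_serveProb _ ?_ ?_ c
  · rw [PriorityQueue.measureReal_kind_ne_none, measureReal_kind_some, measureReal_kind_some,
      measureReal_kind_none, ← add_div]
    gcongr
    exact h.le
  · rw [measureReal_kind_none]
    exact div_pos blockRate_pos_real hθ

theorem integral_tsum_minerBalance [∀ ω k t, Decidable (eventTime (C := C) ω k ≤ t)]
    (hX : C.IsMinerEquilibrium X) (hT : T.feeLow < T.feeHigh)
    (hfee : ∀ n c, 0 < r n c → C.storageCost ≤ T.fee c) (h : load r .low < C.blockRate)
    (m : C.Miner) {t : ℝ} (ht : 0 ≤ t) :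
    ∫ ω, ∑' k, (if eventTime ω k ≤ t then minerBalance T X m ω k else 0) ∂C.law r
      = ∑' k, eventProbUpTo (C.totalRate r) t k * minerTerm T r m k := by
  classical
  have hθ := totalRate_pos_real r
  set F : (FeeLevel → ℝ) → ℕ → C.History → ℝ := fun w k ω => ∑ j ∈ Finset.range k, ∑ c,
    occurred t k ω * (Set.indicator {e : ℕ → C.Event | kind (e k) = none
      ∧ j ∈ front kind e (queue kind e k) ∧ kind (e j) = some c} 1 (event ω)
      * (txSize ω j * w c)) with hF
  have hgi : ∀ k j c, Integrable (Set.indicator {e : ℕ → C.Event | kind (e k) = none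
      ∧ j ∈ front kind e (queue kind e k) ∧ kind (e j) = some c} (1 : (ℕ → C.Event) → ℝ))
      (eventSeqLaw r) := fun k j c =>
    (integrable_const (1 : ℝ)).indicator (measurableSet_served kind c k j)
  have hsi : ∀ w : ℝ, Integrable (fun s : ℝ => s * w) C.sizeLaw := fun w =>
    C.sizeLaw_integrable.mul_const w
  have hFi : ∀ w k, Integrable (F w k) (C.law r) := fun w k =>
    integrable_finsetSum _ fun j _ => integrable_finsetSum _ fun c _ =>
      integrable_law_mul r (hgi k j c) (hsi (w c)) t k j
  have hFint : ∀ w k, ∫ ω, F w k ω ∂C.law r = eventProbUpTo (C.totalRate r) t k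
      * ∑ c, serveProb (C.eventLaw r).toMeasure kind c k * (C.meanSize * w c) := by
    intro w k
    rw [hF]
    simp only
    rw [integral_finsetSum _ fun j _ => integrable_finsetSum _ fun c _ =>
      integrable_law_mul r (hgi k j c) (hsi (w c)) t k j]
    have h1 : ∀ j, ∫ ω, ∑ c, occurred t k ω * (Set.indicator {e : ℕ → C.Event | kind (e k) = none
        ∧ j ∈ front kind e (queue kind e k) ∧ kind (e j) = some c} 1 (event ω)
        * (txSize ω j * w c)) ∂C.law r
        = ∑ c, eventProbUpTo (C.totalRate r) t k * ((eventSeqLaw r).real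
          {e : ℕ → C.Event | kind (e k) = none ∧ j ∈ front kind e (queue kind e k)
            ∧ kind (e j) = some c} * (C.meanSize * w c)) := by
      intro j
      rw [integral_finsetSum _ fun c _ => integrable_law_mul r (hgi k j c) (hsi (w c)) t k j]
      refine Finset.sum_congr rfl fun c _ => ?_
      rw [integral_law_mul r (hgi k j c) (hsi (w c)) t k j,
        integral_indicator_one (measurableSet_served kind c k j), integral_mul_const, meanSize]
    simp only [h1]
    rw [Finset.sum_comm, Finset.mul_sum]
    refine Finset.sum_congr rfl fun c _ => ?_
    rw [serveProb, Finset.sum_mul, Finset.mul_sum]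
    rfl
  have hlim : ∀ w : FeeLevel → ℝ, ∃ B, ∀ k,
      |∑ c, serveProb (C.eventLaw r).toMeasure kind c k * (C.meanSize * w c)| ≤ B := by
    intro w
    have h1 : Tendsto (fun k => ∑ c, serveProb (C.eventLaw r).toMeasure kind c k
        * (C.meanSize * w c)) atTop (𝓝 (∑ c, levelRate r c / C.totalRate r
        * (C.meanSize * w c))) :=
      tendsto_finsetSum _ fun c _ => (tendsto_serveProb_kind r h c).mul_const _
    obtain ⟨B, hB⟩ := h1.abs.bddAbove_range
    exact ⟨B, fun k => hB ⟨k, rfl⟩⟩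
  set w : FeeLevel → ℝ := fun c => C.power m * T.fee c - C.storageCost with hw
  have hsum : Summable fun k => ∫ ω, ‖F w k ω‖ ∂C.law r := by
    obtain ⟨B, hB⟩ := hlim fun c => |w c|
    refine Summable.of_nonneg_of_le (fun k => integral_nonneg fun ω => norm_nonneg _) (fun k => ?_)
      (summable_eventProbUpTo_mul hθ ht hB)
    rw [← hFint]
    refine integral_mono_ae (hFi w k).norm (hFi _ k) ?_
    filter_upwards [ae_size_pos r] with ω hω
    refine (norm_sum_le _ _).trans (Finset.sum_le_sum fun j _ => (norm_sum_le _ _).trans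
      (Finset.sum_le_sum fun c _ => ?_))
    have hind : ‖Set.indicator {e : ℕ → C.Event | kind (e k) = none
        ∧ j ∈ front kind e (queue kind e k) ∧ kind (e j) = some c} (1 : (ℕ → C.Event) → ℝ)
        (event ω)‖ = Set.indicator {e : ℕ → C.Event | kind (e k) = none
        ∧ j ∈ front kind e (queue kind e k) ∧ kind (e j) = some c} 1 (event ω) :=
      Real.norm_of_nonneg (Set.indicator_nonneg (fun _ _ => zero_le_one) _)
    rw [norm_mul, norm_mul, norm_mul, Real.norm_of_nonneg (occurred_nonneg t k ω),
      Real.norm_of_nonneg (hω j).le, hind, Real.norm_eq_abs]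
  have hmain := integral_tsum_of_summable_integral_norm (hFi w) hsum
  simp only [hFint] at hmain
  rw [show (fun k => eventProbUpTo (C.totalRate r) t k * minerTerm T r m k)
    = fun k => eventProbUpTo (C.totalRate r) t k
      * ∑ c, serveProb (C.eventLaw r).toMeasure kind c k * (C.meanSize * w c) from rfl, hmain]
  refine integral_congr_ae ?_
  filter_upwards [ae_served r hfee] with ω hω
  refine tsum_congr fun k => ?_
  rw [minerBalance_eq hX hT hω, hF]
  simp only [occurred_eq]
  split_ifs <;> simp [hw]

/-! ### Time-average payoffs -/

/-- The long-run payoff of user `n` per unit time in a stable system. -/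
noncomputable def userRate (T : Mechanism) (r : C.Rates) (n : C.User) : ℝ :=
  balanceRate T r n - C.impatience
    * ∑ c, r n c * (C.blockRate / ((C.blockRate - load r c) * slack r c))

/-- The long-run payoff of miner `m` per unit time in a stable system. -/
noncomputable def minerRate (T : Mechanism) (r : C.Rates) (m : C.Miner) : ℝ :=
  ∑ c, levelRate r c * (C.meanSize * (C.power m * T.fee c - C.storageCost))

section Served

variable {r} (hX : C.IsMinerEquilibrium X) (hT : T.feeLow < T.feeHigh)
  (hfee : ∀ n c, 0 < r n c → C.storageCost ≤ T.fee c)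
include hX hT hfee

theorem minerPayoff_eq (h : load r .low < C.blockRate) (m : C.Miner) :
    minerPayoff T X r m = (minerRate T r m : EReal) := by
  classical
  have hθ := totalRate_pos_real r
  rw [minerPayoff]
  refine Tendsto.liminf_eq ?_
  refine (continuous_coe_real_ereal.tendsto _).comp ?_
  have h1 : Tendsto (minerTerm T r m) atTop (𝓝 (∑ c, levelRate r c / C.totalRate r
      * (C.meanSize * (C.power m * T.fee c - C.storageCost)))) :=
    tendsto_finsetSum _ fun c _ => (tendsto_serveProb_kind r h c).mul_const _
  have h2 := tendsto_tsum_eventProbUpTo_div hθ h1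
  have h3 : C.totalRate r * ∑ c, levelRate r c / C.totalRate r
      * (C.meanSize * (C.power m * T.fee c - C.storageCost)) = minerRate T r m := by
    rw [Finset.mul_sum, minerRate]
    refine Finset.sum_congr rfl fun c _ => ?_
    field_simp
  rw [h3] at h2
  refine h2.congr' ?_
  filter_upwards [eventually_ge_atTop (0 : ℝ)] with t ht
  rw [← integral_tsum_minerBalance r hX hT hfee h m ht]

/-- The queue at the low fee may be critical if user `n` uses only the high fee, which matters for
his deviations. -/
theorem userPayoff_eq (hslack : ∀ c, 0 < slack r c) {n : C.User}
    (hload : ∀ c, 0 < r n c → load r c < C.blockRate) :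
    userPayoff T X r n = (userRate T r n : EReal) := by
  classical
  have hθ := totalRate_pos_real r
  rw [userPayoff]
  refine Tendsto.liminf_eq ?_
  have h2 := tendsto_tsum_eventProbUpTo_div hθ (tendsto_waitTerm hload)
  have h3 : (C.totalRate r : ℝ) * (1 / C.totalRate r * ∑ c,
      (r n c * (load r c / (C.blockRate - load r c) + 1) / slack r c))
      = ∑ c, r n c * (C.blockRate / ((C.blockRate - load r c) * slack r c)) := by
    rw [← mul_assoc, mul_one_div_cancel hθ.ne', one_mul]
    refine Finset.sum_congr rfl fun c _ => ?_
    rcases eq_zero_or_pos (r n c) with h0 | h0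
    · simp [h0]
    have h4 : (C.blockRate : ℝ) - load r c ≠ 0 := (sub_pos.2 (hload c h0)).ne'
    have h5 := (hslack c).ne'
    field_simp
    ring
  rw [h3] at h2
  have h4 : Tendsto (fun t => ((balanceRate T r n - C.impatience
      * ((∑' k, eventProbUpTo (C.totalRate r) t k * waitTerm r n k) / t) : ℝ) : EReal)) atTop
      (𝓝 (userRate T r n : EReal)) :=
    (continuous_coe_real_ereal.tendsto _).comp ((h2.const_mul _).const_sub _)
  refine h4.congr' ?_
  filter_upwards [eventually_gt_atTop (0 : ℝ)] with t ht
  have hnn : 0 ≤ ∑' k, eventProbUpTo (C.totalRate r) t k * waitTerm r n k := by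
    refine tsum_nonneg fun k => mul_nonneg (eventProbUpTo_nonneg _ _ _) ?_
    refine mul_nonneg (by positivity) (Finset.sum_nonneg fun c _ => ?_)
    have := meanAhead_nonneg r c k
    have := hslack c
    positivity
  rw [expectedWaiting_eq hX hT hfee hslack hload ht.le,
    expectedBalance_eq r hX hT hfee hslack n ht.le,
    ← ENNReal.ofReal_mul (div_nonneg C.impatience_pos.le ht.le), EReal.coe_ennreal_ofReal,
    max_eq_left (mul_nonneg (div_nonneg C.impatience_pos.le ht.le) hnn), ← EReal.coe_sub,
    mul_div_cancel_left₀ _ ht.ne']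
  congr 2
  ring

/-- In a critical queue the waiting costs exceed all bounds. -/
theorem userPayoff_eq_bot_of_critical {n : C.User} {c : FeeLevel} (hr : 0 < r n c)
    (hs : 0 < slack r c) (hl : load r c = C.blockRate) : userPayoff T X r n = ⊥ := by
  classical
  have hθ := totalRate_pos_real r
  have hr' : (0 : ℝ) < r n c := hr
  set K : ℝ := C.totalRate r
      * meanReward r (fun x => |balanceFixed T n x|) fun x => |balancePerByte T n x| with hK
  have hle : ∀ J : ℝ, 0 ≤ J → userPayoff T X r n
      ≤ ((K - C.impatience * (r n c * (J + 1) / slack r c) : ℝ) : EReal) := by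
    intro J hJ
    have h1 : Tendsto (fun k => 1 / C.totalRate r
        * (r n c * (min (meanAhead r c k) J + 1) / slack r c)) atTop
        (𝓝 (1 / C.totalRate r * (r n c * (J + 1) / slack r c))) := by
      refine Tendsto.const_mul _ (Tendsto.div_const (Tendsto.const_mul _
        (Tendsto.add_const _ ?_)) _)
      refine tendsto_const_nhds.congr' ?_
      filter_upwards [(tendsto_meanAhead_atTop r hl).eventually_ge_atTop J] with k hk
      rw [min_eq_right hk]
    have h2 := tendsto_tsum_eventProbUpTo_div hθ h1
    rw [← mul_assoc, mul_one_div_cancel hθ.ne', one_mul] at h2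
    have h4 : Tendsto (fun t => ((K - C.impatience
        * ((∑' k, eventProbUpTo (C.totalRate r) t k * (1 / C.totalRate r
          * (r n c * (min (meanAhead r c k) J + 1) / slack r c))) / t) : ℝ) : EReal)) atTop
        (𝓝 ((K - C.impatience * (r n c * (J + 1) / slack r c) : ℝ) : EReal)) :=
      (continuous_coe_real_ereal.tendsto _).comp ((h2.const_mul _).const_sub _)
    rw [userPayoff, ← h4.liminf_eq]
    refine liminf_le_liminf ?_
    filter_upwards [eventually_gt_atTop (0 : ℝ)] with t ht
    have h5 := abs_expectedBalance_le r (T := T) (X := X) n ht.le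
    have h6 : expectedBalance T X r n t / t ≤ K := by
      rw [div_le_iff₀ ht, hK]
      calc _ ≤ _ := (le_abs_self _).trans h5
        _ = _ := by ring
    have h7 := le_expectedWaiting_of_slack_pos hX hT hfee (n := n) hs ht.le hJ
    have hnn : 0 ≤ ∑' k, eventProbUpTo (C.totalRate r) t k * (1 / C.totalRate r
          * (r n c * (min (meanAhead r c k) J + 1) / slack r c)) := by
      refine tsum_nonneg fun k => mul_nonneg (eventProbUpTo_nonneg _ _ _) ?_
      have := le_min (meanAhead_nonneg r c k) hJ
      positivity
    rw [EReal.coe_sub]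
    refine EReal.sub_le_sub (EReal.coe_le_coe_iff.2 h6) ?_
    have h8 : ((C.impatience * ((∑' k, eventProbUpTo (C.totalRate r) t k * (1 / C.totalRate r
          * (r n c * (min (meanAhead r c k) J + 1) / slack r c))) / t) : ℝ) : EReal)
        = ((ENNReal.ofReal (C.impatience / t) * ENNReal.ofReal
          (∑' k, eventProbUpTo (C.totalRate r) t k * (1 / C.totalRate r
          * (r n c * (min (meanAhead r c k) J + 1) / slack r c))) : ℝ≥0∞) : EReal) := by
      rw [← ENNReal.ofReal_mul (div_nonneg C.impatience_pos.le ht.le), EReal.coe_ennreal_ofReal,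
        max_eq_left (mul_nonneg (div_nonneg C.impatience_pos.le ht.le) hnn)]
      congr 1
      ring
    rw [h8, EReal.coe_ennreal_le_coe_ennreal_iff]
    gcongr
  rw [EReal.eq_bot_iff_forall_lt]
  intro y
  set b : ℝ := C.impatience * (r n c / slack r c) with hb
  have hb0 : 0 < b := mul_pos C.impatience_pos (div_pos hr' hs)
  refine lt_of_le_of_lt (hle (|K - y| / b) (by positivity)) (EReal.coe_lt_coe_iff.2 ?_)
  have h1 : C.impatience * (r n c * (|K - y| / b + 1) / slack r c) = |K - y| + b := by
    rw [show C.impatience * (r n c * (|K - y| / b + 1) / slack r c)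
      = b * (|K - y| / b + 1) by rw [hb]; ring, mul_add, mul_div_cancel₀ _ hb0.ne', mul_one]
  rw [h1]
  linarith [le_abs_self (K - y)]

end Served

variable {r}

/-- A user whose transactions are never included has infinite waiting costs. -/
theorem userPayoff_eq_bot_of_fee_lt (hX : C.IsMinerEquilibrium X) {n : C.User} {c : FeeLevel}
    (hr : 0 < r n c) (hc : T.fee c < C.storageCost) : userPayoff T X r n = ⊥ := by
  rw [userPayoff]
  refine Tendsto.liminf_eq (tendsto_const_nhds.congr' ?_)
  filter_upwards [eventually_gt_atTop (0 : ℝ)] with t ht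
  rw [expectedWaiting_eq_top hX hr hc ht, ENNReal.mul_top]
  · simp
  · simpa using div_pos C.impatience_pos ht

theorem bot_lt_userPayoff_of_rate_zero {n : C.User} (hr : ∀ c, r n c = 0) :
    ⊥ < userPayoff T X r n := by
  set K : ℝ := C.totalRate r
      * meanReward r (fun x => |balanceFixed T n x|) fun x => |balancePerByte T n x| with hK
  refine lt_of_lt_of_le (EReal.bot_lt_coe (-K)) ?_
  rw [userPayoff]
  refine le_liminf_of_le (by isBoundedDefault) ?_
  filter_upwards [eventually_gt_atTop (0 : ℝ)] with t ht
  rw [expectedWaiting_eq_zero hr, mul_zero, EReal.coe_ennreal_zero, sub_zero, EReal.coe_le_coe_iff,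
    le_div_iff₀ ht]
  have h5 := (abs_le.1 (abs_expectedBalance_le r (T := T) (X := X) n ht.le)).1
  calc _ = _ := by rw [hK]; ring
    _ ≤ _ := h5

end Blockchain

/-! ### Rates of one user against the rates of the others -/

namespace Blockchain

open Topology

variable {C : Blockchain} {r : C.Rates} {T : Mechanism} {X : C.MinerProfile}

theorem numUsers_pos : 0 < C.numUsers := Nat.add_pos_left C.numH_pos _

theorem card_user : Fintype.card C.User = C.numUsers := by
  simp [numUsers]

theorem feasibleRate_iff {a : FeeLevel → ℝ≥0} :
    C.FeasibleRate a ↔ (a .high + a .low : ℝ) ≤ C.blockRate / C.numUsers := by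
  rw [FeasibleRate, ← NNReal.coe_le_coe]
  push_cast
  rfl

/-- The rate at which user `n` generates transactions. -/
noncomputable def userLoad (r : C.Rates) (n : C.User) : ℝ := r n .high + r n .low

theorem userLoad_nonneg (n : C.User) : 0 ≤ userLoad r n :=
  add_nonneg (NNReal.coe_nonneg _) (NNReal.coe_nonneg _)

theorem load_low_eq_sum : load r .low = ∑ n, userLoad r n := by
  simp only [load, levelRate, userLoad, Finset.sum_add_distrib]

theorem load_low_le (hr : ∀ n, C.FeasibleRate (r n)) : load r .low ≤ C.blockRate := by
  rw [load_low_eq_sum]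
  refine (Finset.sum_le_card_nsmul Finset.univ _ _ fun n _ => feasibleRate_iff.1 (hr n)).trans
    (le_of_eq ?_)
  have : (C.numUsers : ℝ) ≠ 0 := by exact_mod_cast numUsers_pos.ne'
  rw [Finset.card_univ, card_user, nsmul_eq_mul, mul_div_cancel₀ _ this]

/-- The rate at which the users other than `n` generate transactions of a fee level. -/
noncomputable def othersRate (r : C.Rates) (n : C.User) (c : FeeLevel) : ℝ :=
  ∑ l ∈ Finset.univ.erase n, (r l c : ℝ)

theorem othersRate_nonneg (n : C.User) (c : FeeLevel) : 0 ≤ othersRate r n c :=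
  Finset.sum_nonneg fun _ _ => NNReal.coe_nonneg _

theorem levelRate_eq_add (n : C.User) (c : FeeLevel) :
    levelRate r c = r n c + othersRate r n c :=
  (Finset.add_sum_erase _ _ (Finset.mem_univ n)).symm

theorem levelRate_update (n : C.User) (a : FeeLevel → ℝ≥0) (c : FeeLevel) :
    levelRate (Function.update r n a) c = a c + othersRate r n c := by
  rw [levelRate_eq_add n, Function.update_self]
  congr 1
  refine Finset.sum_congr rfl fun l hl => ?_
  rw [Function.update_of_ne (Finset.ne_of_mem_erase hl)]

/-! ### Payoffs of the users -/

/-- What remains to user `n` of the utility of an included transaction after the mean fee and the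
waiting taxes. -/
noncomputable def netValue (T : Mechanism) (n : C.User) (c : FeeLevel) : ℝ :=
  C.util n - C.meanSize * T.fee c - taxPaid T n

/-- What user `n` receives per unit time as waiting taxes when all transactions are included. -/
noncomputable def taxIncome (T : Mechanism) (r : C.Rates) (n : C.User) : ℝ :=
  ∑ l ∈ Finset.univ.erase n, (∑ c, (r l c : ℝ)) * C.tax T l n

/-- The long-run payoff per unit time, apart from tax income, of user `n` with rates `a` against the
rates of the others in `r`. -/
noncomputable def ownRate (T : Mechanism) (r : C.Rates) (n : C.User) (a : FeeLevel → ℝ≥0) : ℝ :=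
  a .high * (netValue T n .high
      - C.impatience / (C.blockRate - (a .high + othersRate r n .high)))
    + a .low * (netValue T n .low
      - C.impatience * (C.blockRate
        / ((C.blockRate - (a .high + othersRate r n .high + (a .low + othersRate r n .low)))
          * (C.blockRate - (a .high + othersRate r n .high)))))

theorem userRate_update (n : C.User) (a : FeeLevel → ℝ≥0) :
    userRate T (Function.update r n a) n = ownRate T r n a + taxIncome T r n := by
  have h1 : ∑ l ∈ Finset.univ.erase n, (∑ c, (Function.update r n a l c : ℝ)) * C.tax T l n
      = taxIncome T r n := by
    refine Finset.sum_congr rfl fun l hl => ?_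
    rw [Function.update_of_ne (Finset.ne_of_mem_erase hl)]
  have h2 : (C.blockRate : ℝ) / ((C.blockRate - (a .high + othersRate r n .high)) * C.blockRate)
      = 1 / (C.blockRate - (a .high + othersRate r n .high)) := by
    have := (blockRate_pos_real (C := C)).ne'
    rw [mul_comm, ← div_div, div_self this]
  rw [userRate, balanceRate, h1]
  simp only [sum_feeLevel, load, slack, levelRate_update, Function.update_self, ownRate, netValue,
    h2]
  ring

theorem userRate_eq (n : C.User) : userRate T r n = ownRate T r n (r n) + taxIncome T r n := by
  rw [← userRate_update, Function.update_eq_self]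

theorem taxPaid_inl (i : Fin C.numH) : taxPaid T (.inl i : C.User) = C.totalTaxH T := by
  rw [taxPaid, Finset.sum_erase_eq_sub (Finset.mem_univ _), Fintype.sum_sum_type]
  simp only [tax, Finset.sum_const, Finset.card_univ, Fintype.card_fin, nsmul_eq_mul, totalTaxH]
  ring

theorem taxPaid_inr (i : Fin C.numL) : taxPaid T (.inr i : C.User) = C.totalTaxL T := by
  rw [taxPaid, Finset.sum_erase_eq_sub (Finset.mem_univ _), Fintype.sum_sum_type]
  simp only [tax, Finset.sum_const, Finset.card_univ, Fintype.card_fin, nsmul_eq_mul, totalTaxL]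
  ring

section Deviation

variable (hX : C.IsMinerEquilibrium X) (hT : T.feeLow < T.feeHigh)
include hX hT

theorem userPayoff_eq_of_stable (hfee : ∀ n c, 0 < r n c → C.storageCost ≤ T.fee c)
    (h : load r .low < C.blockRate) (n : C.User) :
    userPayoff T X r n = (userRate T r n : EReal) :=
  userPayoff_eq hX hT hfee (slack_pos_of_load_lt r h) fun c _ => load_lt_of_load_low_lt r h c

/-- If the block rate does not exceed the load or a fee in use does not pay for the storage, some
user waits infinitely long on average. -/
theorem exists_userPayoff_eq_bot (hr : ∀ n, C.FeasibleRate (r n))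
    (h : ¬((∀ n c, 0 < r n c → C.storageCost ≤ T.fee c) ∧ load r .low < C.blockRate)) :
    ∃ n, userPayoff T X r n = ⊥ := by
  by_cases hfee : ∀ n c, 0 < r n c → C.storageCost ≤ T.fee c
  · have hl : load r .low = C.blockRate :=
      le_antisymm (load_low_le hr) (not_lt.1 fun h' => h ⟨hfee, h'⟩)
    have hpos : ∀ c, 0 < levelRate r c → ∃ n, 0 < r n c := by
      intro c hc
      by_contra! h0
      refine hc.ne' (Finset.sum_eq_zero fun n _ => ?_)
      simpa using h0 n
    have hμ := blockRate_pos_real (C := C)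
    rcases (levelRate_nonneg r .low).eq_or_lt with h0 | h0
    · have h1 : load r .high = C.blockRate := by
        rw [← hl]; simp only [load]; linarith
      obtain ⟨n, hn⟩ := hpos .high (by simp only [load] at h1; linarith)
      exact ⟨n, userPayoff_eq_bot_of_critical hX hT hfee hn hμ h1⟩
    · obtain ⟨n, hn⟩ := hpos .low h0
      refine ⟨n, userPayoff_eq_bot_of_critical hX hT hfee hn ?_ hl⟩
      simp only [load] at hl
      simp only [slack]
      linarith
  · push Not at hfee
    obtain ⟨n, c, h1, h2⟩ := hfee
    exact ⟨n, userPayoff_eq_bot_of_fee_lt hX h1 h2⟩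

/-- A user who would wait infinitely long prefers to generate no transactions. -/
theorem IsUserEquilibrium.stable (hr : IsUserEquilibrium T X r) :
    (∀ n c, 0 < r n c → C.storageCost ≤ T.fee c) ∧ load r .low < C.blockRate := by
  by_contra h
  obtain ⟨n, hn⟩ := exists_userPayoff_eq_bot hX hT hr.1 h
  have h1 := hr.2.2.2 n (fun _ => 0) (by simp [FeasibleRate])
  rw [hn] at h1
  exact (bot_lt_userPayoff_of_rate_zero (fun c => by simp)).not_ge h1

theorem IsUserEquilibrium.ownRate_le (hr : IsUserEquilibrium T X r) {n : C.User}
    {a : FeeLevel → ℝ≥0} (ha : C.FeasibleRate a)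
    (hstable : a .high + othersRate r n .high + (a .low + othersRate r n .low) < C.blockRate)
    (hfee : ∀ c, C.storageCost ≤ T.fee c) : ownRate T r n a ≤ ownRate T r n (r n) := by
  have h1 := hr.2.2.2 n a ha
  rw [userPayoff_eq_of_stable hX hT (fun _ c _ => hfee c) (IsUserEquilibrium.stable hX hT hr).2,
    userPayoff_eq_of_stable hX hT (fun _ c _ => hfee c)
      (by simpa only [load, levelRate_update] using hstable), EReal.coe_le_coe_iff,
    userRate_update, userRate_eq] at h1
  linarith

end Deviation

/-! ### The social welfare -/

/-- The social welfare per unit time of a stable system: taxes and fees are transfers, so it is the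
utility net of the storage costs, less the waiting costs of an M/M/1 queue. -/
noncomputable def welfare (r : C.Rates) : ℝ :=
  ∑ n, userLoad r n * (C.util n - C.numMiners * C.meanSize * C.storageCost)
    - C.impatience * (load r .low / (C.blockRate - load r .low))

theorem sum_taxIncome : ∑ n, taxIncome T r n = ∑ n, userLoad r n * taxPaid T n := by
  simp only [taxIncome, taxPaid, sum_feeLevel, Finset.mul_sum, userLoad]
  refine Finset.sum_comm' fun x y => ?_
  simp [ne_comm]

theorem sum_minerRate : ∑ m, minerRate T r m
    = ∑ n, ∑ c, r n c * (C.meanSize * T.fee c)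
      - load r .low * (C.numMiners * C.meanSize * C.storageCost) := by
  have hpow : ∑ j, (C.power j : ℝ) = 1 := by exact_mod_cast C.sum_power
  have h1 : ∀ c, ∑ m, (levelRate r c : ℝ) * (C.meanSize * (C.power m * T.fee c - C.storageCost))
      = levelRate r c * (C.meanSize * T.fee c)
        - levelRate r c * (C.numMiners * C.meanSize * C.storageCost) := by
    intro c
    rw [← Finset.mul_sum, ← Finset.mul_sum, Finset.sum_sub_distrib, ← Finset.sum_mul, hpow]
    simp
    ring
  simp only [minerRate]
  rw [Finset.sum_comm]
  simp only [h1]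
  rw [Finset.sum_comm (f := fun n c => (r n c : ℝ) * (C.meanSize * T.fee c))]
  simp only [sum_feeLevel, ← Finset.sum_mul, load, levelRate]
  ring

theorem sum_userRate_add_sum_minerRate (h : load r .low < C.blockRate) :
    ∑ n, userRate T r n + ∑ m, minerRate T r m = welfare r := by
  have h1 : load r .low / (C.blockRate - load r .low)
      = ∑ n, ∑ c, r n c * (C.blockRate / ((C.blockRate - load r c) * slack r c)) := by
    have h2 := sub_pos.2 (load_lt_of_load_low_lt r h .high)
    have h3 := sub_pos.2 h
    rw [Finset.sum_comm]
    simp only [← Finset.sum_mul, sum_feeLevel]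
    change _ = levelRate r .high * _ + levelRate r .low * _
    simp only [load, slack] at h2 h3 ⊢
    have hμ := blockRate_pos_real (C := C)
    field_simp
    ring
  rw [sum_minerRate, welfare, h1]
  simp only [userRate, balanceRate]
  rw [Finset.sum_sub_distrib, Finset.sum_add_distrib, ← Finset.mul_sum]
  have h4 := sum_taxIncome (T := T) (r := r)
  simp only [taxIncome] at h4
  rw [h4, load_low_eq_sum, Finset.sum_mul]
  have h5 : ∑ n, ∑ c, r n c * (C.util n - C.meanSize * T.fee c - taxPaid T n)
      + ∑ n, userLoad r n * taxPaid T n + ∑ n, ∑ c, r n c * (C.meanSize * T.fee c)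
      = ∑ n, userLoad r n * C.util n := by
    rw [← Finset.sum_add_distrib, ← Finset.sum_add_distrib]
    refine Finset.sum_congr rfl fun n _ => ?_
    simp only [sum_feeLevel, userLoad]
    ring
  simp only [mul_sub, Finset.sum_sub_distrib] at h5 ⊢
  linarith

theorem coe_sum_ereal {ι : Type*} (s : Finset ι) (f : ι → ℝ) :
    ((∑ i ∈ s, f i : ℝ) : EReal) = ∑ i ∈ s, (f i : EReal) :=
  map_sum (⟨⟨(↑), EReal.coe_zero⟩, EReal.coe_add⟩ : ℝ →+ EReal) f s

theorem socialWelfare_eq (hX : C.IsMinerEquilibrium X) (hT : T.feeLow < T.feeHigh)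
    (hfee : ∀ n c, 0 < r n c → C.storageCost ≤ T.fee c) (h : load r .low < C.blockRate) :
    socialWelfare T X r = (welfare r : EReal) := by
  rw [← sum_userRate_add_sum_minerRate (T := T) h, EReal.coe_add, coe_sum_ereal, coe_sum_ereal,
    socialWelfare]
  congr 1
  · exact Finset.sum_congr rfl fun n _ => userPayoff_eq_of_stable hX hT hfee h n
  · exact Finset.sum_congr rfl fun m _ => minerPayoff_eq hX hT hfee h m

end Blockchain

/-! ### The best response of a user of the low fee -/

section BestResponse

open Topology

/-- The mean length `a / (y - a)` of an M/M/1 queue is a convex function of the load `a`. -/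
theorem queue_tangent_le {y a g : ℝ} (hy : 0 ≤ y) (ha : a < y) (hg : g < y) :
    g / (y - g) + y / (y - g) ^ 2 * (a - g) ≤ a / (y - a) := by
  have h1 := sub_pos.2 ha
  have h2 := sub_pos.2 hg
  have h3 : a / (y - a) - (g / (y - g) + y / (y - g) ^ 2 * (a - g))
      = y * (a - g) ^ 2 / ((y - a) * (y - g) ^ 2) := by
    field_simp
    ring
  have h4 : 0 ≤ y * (a - g) ^ 2 / ((y - a) * (y - g) ^ 2) := by positivity
  linarith

variable {v γ y a b : ℝ}

theorem queue_payoff_sub {x : ℝ} (hx : x < y) (ha : a < y) :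
    x * (v - γ / (y - x)) - a * (v - γ / (y - a))
      = (x - a) * (v - γ * y / ((y - x) * (y - a))) := by
  have h1 := (sub_pos.2 hx).ne'
  have h2 := (sub_pos.2 ha).ne'
  field_simp
  ring

theorem tendsto_queue_slope (ha : a < y) :
    Tendsto (fun x => γ * y / ((y - x) * (y - a))) (𝓝 a) (𝓝 (γ * y / (y - a) ^ 2)) := by
  have h2 := (sub_pos.2 ha).ne'
  rw [sq]
  exact tendsto_const_nhds.div ((tendsto_id.const_sub y).mul_const _) (mul_ne_zero h2 h2)

/-- The right first-order condition at a best response `a`, where `x * (v - γ / (y - x))` is the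
payoff of rate `x` at value `v` per transaction and remaining block rate `y`. -/
theorem le_of_queue_payoff_le_right (hab : a < b) (ha : a < y)
    (h : ∀ x, a < x → x < b → x < y → x * (v - γ / (y - x)) ≤ a * (v - γ / (y - a))) :
    v ≤ γ * y / (y - a) ^ 2 := by
  refine ge_of_tendsto ((tendsto_queue_slope ha).mono_left (nhdsWithin_le_nhds (s := Set.Ioi a))) ?_
  filter_upwards [Ioo_mem_nhdsGT (lt_min hab ha)] with x hx
  have hxy := hx.2.trans_le (min_le_right _ _)
  have h1 := h x hx.1 (hx.2.trans_le (min_le_left _ _)) hxy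
  rw [← sub_nonpos, queue_payoff_sub hxy ha] at h1
  have h2 := sub_pos.2 hx.1
  nlinarith

theorem le_of_queue_payoff_le_left (ha0 : 0 < a) (ha : a < y)
    (h : ∀ x, 0 < x → x < a → x * (v - γ / (y - x)) ≤ a * (v - γ / (y - a))) :
    γ * y / (y - a) ^ 2 ≤ v := by
  refine le_of_tendsto ((tendsto_queue_slope ha).mono_left (nhdsWithin_le_nhds (s := Set.Iio a))) ?_
  filter_upwards [Ioo_mem_nhdsLT ha0] with x hx
  have h1 := h x hx.1 hx.2
  rw [← sub_nonpos, queue_payoff_sub (hx.2.trans ha) ha] at h1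
  have h2 := sub_neg.2 hx.2
  nlinarith

/-- The first-order conditions are sufficient for a best response. -/
theorem queue_payoff_le (hγ : 0 ≤ γ) (hy : 0 ≤ y) (ha : a < y) (ha0 : 0 ≤ a)
    (hv : v ≤ γ * y / (y - a) ^ 2) (hv' : 0 < a → γ * y / (y - a) ^ 2 ≤ v) {x : ℝ} (hx0 : 0 ≤ x)
    (hx : x < y) : x * (v - γ / (y - x)) ≤ a * (v - γ / (y - a)) := by
  have h1 := mul_le_mul_of_nonneg_left (queue_tangent_le hy hx ha) hγ
  have h2 : (x - a) * (v - γ * y / (y - a) ^ 2) ≤ 0 := by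
    rcases ha0.eq_or_lt with h0 | h0
    · rw [← h0] at hv ⊢
      exact mul_nonpos_of_nonneg_of_nonpos (by linarith) (by linarith)
    · rw [le_antisymm hv (hv' h0)]
      simp
  have h3 : x * (v - γ / (y - x)) - a * (v - γ / (y - a)) = (x - a) * (v - γ * y / (y - a) ^ 2)
      + (γ * (a / (y - a) + y / (y - a) ^ 2 * (x - a)) - γ * (x / (y - x))) := by ring
  linarith

end BestResponse

/-! ### The equilibrium of the transaction generation game -/

namespace Blockchain

open Topology

variable {C : Blockchain} {r : C.Rates} {T : Mechanism} {X : C.MinerProfile}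

/-- The strategy that generates transactions only at the low fee, at rate `x`. -/
def lowRate (x : ℝ≥0) : FeeLevel → ℝ≥0
  | .high => 0
  | .low => x

/-- The rates in which user `n` generates transactions only at the low fee, at rate `g n`. -/
def lowRates (g : C.User → ℝ≥0) : C.Rates := fun n => lowRate (g n)

/-- The fees and taxes of the mechanism make `g` the rates of the users at the low fee: marginal
payoffs vanish at `g` (or are nonpositive where `g` vanishes), and the high fee costs at least as
much as waiting could save. -/
structure Implements (T : Mechanism) (g : C.User → ℝ≥0) : Prop where
  feasible : ∀ n : C.User, (g n : ℝ) ≤ C.blockRate / C.numUsers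
  sum_lt : ∑ n, (g n : ℝ) < C.blockRate
  fee_lt : T.feeLow < T.feeHigh
  storageCost_le : C.storageCost ≤ T.feeLow
  netValue_high_le : ∀ n : C.User, netValue T n .high ≤ C.impatience / C.blockRate
  netValue_low_le : ∀ n : C.User, netValue T n .low
    ≤ C.impatience * (C.blockRate - ∑ l, (g l : ℝ) + g n) / (C.blockRate - ∑ l, (g l : ℝ)) ^ 2
  le_netValue_low : ∀ n : C.User, 0 < g n →
    C.impatience * (C.blockRate - ∑ l, (g l : ℝ) + g n) / (C.blockRate - ∑ l, (g l : ℝ)) ^ 2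
      ≤ netValue T n .low

theorem Implements.storageCost_le_fee {g : C.User → ℝ≥0} (h : Implements T g) (c : FeeLevel) :
    C.storageCost ≤ T.fee c := by
  cases c with
  | high => exact h.storageCost_le.trans h.fee_lt.le
  | low => exact h.storageCost_le

theorem load_low_eq_add (n : C.User) :
    load r .low = r n .high + othersRate r n .high + (r n .low + othersRate r n .low) := by
  simp only [load, levelRate_eq_add n]

theorem ownRate_lowRate {n : C.User} (h : othersRate r n .high = 0) (x : ℝ≥0) :
    ownRate T r n (lowRate x) = x * (netValue T n .low
      - C.impatience / (C.blockRate - othersRate r n .low - x)) := by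
  have hμ := (blockRate_pos_real (C := C)).ne'
  have h1 : (C.blockRate : ℝ) / ((C.blockRate - (x + othersRate r n .low)) * C.blockRate)
      = 1 / (C.blockRate - othersRate r n .low - x) := by
    rw [mul_comm, ← div_div, div_self hμ, add_comm, sub_sub]
  simp only [ownRate, lowRate, h, NNReal.coe_zero, zero_mul, zero_add, sub_zero, h1, mul_one_div]

section Equilibrium

variable {g : C.User → ℝ≥0} (hX : C.IsMinerEquilibrium X) (hg : Implements T g)
include hX hg

/-- The high fee is dominated: it costs more than it saves in waiting, and dropping the transactions
at the high fee also speeds up the others. -/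
theorem IsUserEquilibrium.rate_high_eq_zero (hr : IsUserEquilibrium T X r) (n : C.User) :
    r n .high = 0 := by
  by_contra h0
  have hh : (0 : ℝ) < r n .high := NNReal.coe_pos.2 (pos_iff_ne_zero.2 h0)
  have hl : (0 : ℝ) ≤ r n .low := NNReal.coe_nonneg _
  have hoh := othersRate_nonneg (r := r) n .high
  have hol := othersRate_nonneg (r := r) n .low
  have hγ := C.impatience_pos
  have hμ := blockRate_pos_real (C := C)
  have hs := (hr.stable hX hg.fee_lt).2
  rw [load_low_eq_add n] at hs
  have hfeas : C.FeasibleRate (lowRate (r n .low)) := by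
    refine feasibleRate_iff.2 (le_trans ?_ (feasibleRate_iff.1 (hr.1 n)))
    simp only [lowRate, NNReal.coe_zero]
    linarith
  have h1 := hr.ownRate_le hX hg.fee_lt (a := lowRate (r n .low)) hfeas
    (by simp only [lowRate, NNReal.coe_zero]; linarith) hg.storageCost_le_fee
  simp only [ownRate, lowRate, NNReal.coe_zero, zero_mul, zero_add] at h1
  have h2 : netValue T n .high
      - C.impatience / (C.blockRate - (r n .high + othersRate r n .high)) < 0 := by
    refine sub_neg.2 ((hg.netValue_high_le n).trans_lt ?_)
    gcongr <;> linarith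
  have h3 : C.impatience * (C.blockRate / ((C.blockRate
        - (othersRate r n .high + (r n .low + othersRate r n .low)))
          * (C.blockRate - othersRate r n .high)))
      ≤ C.impatience * (C.blockRate / ((C.blockRate - (r n .high + othersRate r n .high
        + (r n .low + othersRate r n .low)))
          * (C.blockRate - (r n .high + othersRate r n .high)))) := by
    have h4 : 0 < C.blockRate - (r n .high + othersRate r n .high
        + (r n .low + othersRate r n .low)) := by linarith
    have h5 : 0 < C.blockRate - (r n .high + othersRate r n .high) := by linarith
    gcongr <;> linarith
  have h6 := mul_neg_of_pos_of_neg hh h2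
  have h7 := mul_le_mul_of_nonneg_left (sub_le_sub_left h3 (netValue T n .low)) hl
  linarith

/-- The marginal waiting costs of a user increase in his own load and in the total load, so that
only one vector of rates satisfies all first-order conditions. -/
theorem IsUserEquilibrium.eq_lowRates (hr : IsUserEquilibrium T X r) : r = lowRates g := by
  have hhigh := hr.rate_high_eq_zero hX hg
  have hγ := C.impatience_pos
  have hs := (hr.stable hX hg.fee_lt).2
  have hoh : ∀ n, othersRate r n .high = 0 := fun n =>
    Finset.sum_eq_zero fun l _ => by rw [hhigh l, NNReal.coe_zero]
  have hself : ∀ n, r n = lowRate (r n .low) := by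
    intro n
    funext c
    cases c
    · exact hhigh n
    · rfl
  set s : ℝ := ∑ n, (r n .low : ℝ) with hsdef
  have hload : load r .low = s := by
    rw [load_low_eq_sum]
    refine Finset.sum_congr rfl fun n _ => ?_
    rw [userLoad, hhigh n, NNReal.coe_zero, zero_add]
  rw [hload] at hs
  have hothers : ∀ n, C.blockRate - othersRate r n .low = C.blockRate - s + r n .low := by
    intro n
    have : s = r n .low + othersRate r n .low := levelRate_eq_add n .low
    rw [this]
    ring
  have hbest : ∀ n (x : ℝ≥0), (x : ℝ) ≤ C.blockRate / C.numUsers →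
      (x : ℝ) < C.blockRate - s + r n .low →
      x * (netValue T n .low - C.impatience / (C.blockRate - s + r n .low - x))
        ≤ r n .low * (netValue T n .low
          - C.impatience / (C.blockRate - s + r n .low - r n .low)) := by
    intro n x hx hx'
    have h1 := hr.ownRate_le hX hg.fee_lt (n := n) (a := lowRate x)
      (feasibleRate_iff.2 (by simpa only [lowRate, NNReal.coe_zero, zero_add] using hx))
      (by
        have := hothers n
        simp only [lowRate, NNReal.coe_zero, hoh]
        linarith) hg.storageCost_le_fee
    rw [hself n, ownRate_lowRate (hoh n), ownRate_lowRate (hoh n), hothers n] at h1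
    exact h1
  have hupper : ∀ n, (r n .low : ℝ) < C.blockRate / C.numUsers → netValue T n .low
      ≤ C.impatience * (C.blockRate - s + r n .low) / (C.blockRate - s) ^ 2 := by
    intro n hn
    have h1 := le_of_queue_payoff_le_right (γ := C.impatience) (v := netValue T n .low)
      (y := C.blockRate - s + r n .low) hn (by linarith) fun x hx hxb hxy => by
        have hx0 : 0 ≤ x := (NNReal.coe_nonneg _).trans hx.le
        exact hbest n ⟨x, hx0⟩ hxb.le hxy
    rwa [add_sub_cancel_right] at h1
  have hlower : ∀ n, 0 < (r n .low : ℝ) →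
      C.impatience * (C.blockRate - s + r n .low) / (C.blockRate - s) ^ 2 ≤ netValue T n .low := by
    intro n hn
    have h1 := le_of_queue_payoff_le_left (γ := C.impatience) (v := netValue T n .low)
      (y := C.blockRate - s + r n .low) hn (by linarith) fun x hx hxa => by
        have h2 := feasibleRate_iff.1 (hr.1 n)
        rw [hhigh n, NNReal.coe_zero, zero_add] at h2
        exact hbest n ⟨x, hx.le⟩ (hxa.le.trans h2)
          (show x < _ by linarith)
    rwa [add_sub_cancel_right] at h1
  set s' : ℝ := ∑ n, (g n : ℝ) with hs'def
  have hs' : s' < C.blockRate := hg.sum_lt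
  -- `(μ - s + a) / (μ - s) ^ 2 = 1 / (μ - s) + a / (μ - s) ^ 2` increases with `s` and `a`
  have hmono : ∀ s₁ s₂ a₁ a₂ : ℝ, s₁ ≤ s₂ → s₂ < C.blockRate → 0 ≤ a₁ → a₁ < a₂ →
      C.impatience * (C.blockRate - s₁ + a₁) / (C.blockRate - s₁) ^ 2
        < C.impatience * (C.blockRate - s₂ + a₂) / (C.blockRate - s₂) ^ 2 := by
    intro s₁ s₂ a₁ a₂ h1 h2 h3 h4
    have h5 : 0 < C.blockRate - s₂ := sub_pos.2 h2
    have h6 : 0 < C.blockRate - s₁ := by linarith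
    have h7 : ∀ s a : ℝ, 0 < C.blockRate - s →
        C.impatience * (C.blockRate - s + a) / (C.blockRate - s) ^ 2
          = C.impatience / (C.blockRate - s) + C.impatience * a / (C.blockRate - s) ^ 2 := by
      intro s a h
      field_simp
    rw [h7 _ _ h5, h7 _ _ h6]
    refine add_lt_add_of_le_of_lt (by gcongr) (lt_of_lt_of_le
      (b := C.impatience * a₂ / (C.blockRate - s₁) ^ 2) (by gcongr) ?_)
    have : 0 ≤ a₂ := h3.trans h4.le
    gcongr
  have h1 : s' ≤ s → ∀ n, (r n .low : ℝ) ≤ g n := by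
    intro h n
    by_contra! h2
    have h3 := hlower n ((NNReal.coe_nonneg _).trans_lt h2)
    have h4 := hmono _ _ _ _ h hs (NNReal.coe_nonneg _) h2
    have h5 := hg.netValue_low_le n
    linarith
  have h2 : s ≤ s' → ∀ n, (g n : ℝ) ≤ r n .low := by
    intro h n
    by_contra! h2
    have h3 := hupper n (h2.trans_le (hg.feasible n))
    have h4 := hmono _ _ _ _ h hs' (NNReal.coe_nonneg _) h2
    have h5 := hg.le_netValue_low n (zero_le.trans_lt (NNReal.coe_lt_coe.1 h2))
    linarith
  have h3 : ∀ n, (r n .low : ℝ) = g n := by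
    rcases le_total s' s with h | h
    · have h4 := h1 h
      have h5 : s = s' := le_antisymm (Finset.sum_le_sum fun n _ => h4 n) h
      exact fun n => le_antisymm (h4 n) (h2 h5.le n)
    · have h4 := h2 h
      have h5 : s' = s := le_antisymm (Finset.sum_le_sum fun n _ => h4 n) h
      exact fun n => le_antisymm (h1 h5.le n) (h4 n)
  funext n
  rw [hself n, lowRates, NNReal.coe_injective (h3 n)]

/-- A deviation to any use of the high fee can be improved by dropping it, and at the low fee the
payoff of a user is concave in his rate. A deviation that makes his own queue critical costs him an
infinite waiting time. -/
theorem isUserEquilibrium_lowRates (hH : ∀ i j, g (.inl i) = g (.inl j))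
    (hL : ∀ i j, g (.inr i) = g (.inr j)) : IsUserEquilibrium T X (lowRates g) := by
  have hγ := C.impatience_pos
  have hμ := blockRate_pos_real (C := C)
  have hfee : ∀ (r : C.Rates) n c, 0 < r n c → C.storageCost ≤ T.fee c :=
    fun _ _ c _ => hg.storageCost_le_fee c
  have hfeas : ∀ n, C.FeasibleRate (lowRates g n) := fun n =>
    feasibleRate_iff.2 (by simpa [lowRates, lowRate] using hg.feasible n)
  refine ⟨hfeas, fun i j => by simp only [lowRates, hH i j],
    fun i j => by simp only [lowRates, hL i j], fun n a ha => ?_⟩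
  have hoh : othersRate (lowRates g) n .high = 0 :=
    Finset.sum_eq_zero fun l _ => NNReal.coe_zero
  set s : ℝ := ∑ l, (g l : ℝ) with hs
  set o : ℝ := othersRate (lowRates g) n .low with ho
  have hos : s = g n + o := levelRate_eq_add (r := lowRates g) n .low
  have hsμ : s < C.blockRate := hg.sum_lt
  have hstable : load (lowRates g) .low < C.blockRate := by
    rw [load_low_eq_add n, hoh, ← ho]
    simp only [lowRates, lowRate, NNReal.coe_zero]
    linarith
  have hah : (0 : ℝ) ≤ a .high := NNReal.coe_nonneg _
  have hal : (0 : ℝ) ≤ a .low := NNReal.coe_nonneg _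
  have hgn : (0 : ℝ) ≤ g n := NNReal.coe_nonneg _
  have hoo : 0 ≤ o := othersRate_nonneg _ _
  -- there are at least two users, so that a single user cannot use up the block rate
  have hahμ : (a .high : ℝ) < C.blockRate := by
    have h1 := feasibleRate_iff.1 ha
    have h2 : (C.blockRate : ℝ) / C.numUsers < C.blockRate := by
      refine div_lt_self hμ ?_
      have := C.numH_pos
      have := C.numL_pos
      have : 1 < C.numUsers := by rw [numUsers]; omega
      exact_mod_cast this
    linarith
  have hle : (a .high : ℝ) + (a .low + o) ≤ C.blockRate := by
    have h1 := load_low_le (r := Function.update (lowRates g) n a) fun l => by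
      rcases eq_or_ne l n with rfl | hl
      · rwa [Function.update_self]
      · rw [Function.update_of_ne hl]
        exact hfeas l
    simp only [load, levelRate_update, hoh] at h1
    linarith
  have hhigh : levelRate (Function.update (lowRates g) n a) .high = a .high := by
    rw [levelRate_update, hoh, add_zero]
  have hlow : load (Function.update (lowRates g) n a) .low = a .high + (a .low + o) := by
    simp only [load, levelRate_update, hoh, add_zero]
    rfl
  have hslack : ∀ c, 0 < slack (Function.update (lowRates g) n a) c := by
    intro c
    cases c
    · exact hμ
    · simp only [slack, hhigh]
      linarith
  by_cases hcrit : 0 < a .low ∧ load (Function.update (lowRates g) n a) .low = C.blockRate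
  · rw [userPayoff_eq_bot_of_critical hX hg.fee_lt (hfee _) (n := n) (c := .low)
      (by rw [Function.update_self]; exact hcrit.1) (hslack _) hcrit.2]
    exact bot_le
  have hlt : 0 < a .low → (a .high : ℝ) + (a .low + o) < C.blockRate := fun h0 =>
    lt_of_le_of_ne hle fun h1 => hcrit ⟨h0, hlow.trans h1⟩
  rw [userPayoff_eq_of_stable hX hg.fee_lt (hfee _) hstable,
    userPayoff_eq hX hg.fee_lt (hfee _) hslack, EReal.coe_le_coe_iff, userRate_update, userRate_eq]
  · gcongr
    have h1 : ownRate T (lowRates g) n (lowRates g n) = g n * (netValue T n .low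
        - C.impatience / (C.blockRate - o - g n)) := ownRate_lowRate hoh (g n)
    rw [h1]
    have hy : C.blockRate - o = C.blockRate - s + g n := by rw [hos]; ring
    have h2 : a .low * (netValue T n .low - C.impatience / (C.blockRate - o - a .low))
        ≤ g n * (netValue T n .low - C.impatience / (C.blockRate - o - g n)) := by
      rcases hal.eq_or_lt with h0 | h0
      · rw [← h0, zero_mul]
        have h3 := queue_payoff_le (γ := C.impatience) (v := netValue T n .low)
          (y := C.blockRate - o) (a := g n) (x := 0) hγ.le (by linarith) (by linarith) hgn
          (by rw [hy, add_sub_cancel_right]; exact hg.netValue_low_le n)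
          (fun h => by rw [hy, add_sub_cancel_right]; exact hg.le_netValue_low n h) le_rfl
          (by linarith)
        rwa [zero_mul] at h3
      · exact queue_payoff_le hγ.le (by linarith) (by linarith) hgn
          (by rw [hy, add_sub_cancel_right]; exact hg.netValue_low_le n)
          (fun h => by rw [hy, add_sub_cancel_right]; exact hg.le_netValue_low n h) hal
          (by linarith [hlt h0])
    refine le_trans ?_ h2
    simp only [ownRate, hoh, add_zero, ← ho]
    have h3 : a .high * (netValue T n .high - C.impatience / (C.blockRate - a .high)) ≤ 0 := by
      refine mul_nonpos_of_nonneg_of_nonpos hah (sub_nonpos.2 ((hg.netValue_high_le n).trans ?_))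
      have := sub_pos.2 hahμ
      gcongr
      linarith
    have h4 : a .low * (netValue T n .low - C.impatience * (C.blockRate
          / ((C.blockRate - (a .high + (a .low + o))) * (C.blockRate - a .high))))
        ≤ a .low * (netValue T n .low - C.impatience / (C.blockRate - o - a .low)) := by
      rcases hal.eq_or_lt with h0 | h0
      · rw [← h0, zero_mul, zero_mul]
      have h5 := sub_pos.2 (hlt h0)
      have h6 := sub_pos.2 hahμ
      have h7 : 0 < C.blockRate - o - a .low := by linarith
      gcongr
      rw [← mul_div_assoc, div_le_div_iff₀ h7 (mul_pos h5 h6), mul_assoc]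
      refine mul_le_mul_of_nonneg_left ?_ hγ.le
      rw [mul_comm (C.blockRate : ℝ)]
      exact mul_le_mul (by linarith) (by linarith) h6.le h7.le
    linarith
  · intro c hc
    rw [Function.update_self] at hc
    cases c
    · simp only [load, hhigh]
      exact hahμ
    · rw [hlow]
      exact hlt hc

end Equilibrium

end Blockchain

/-! ### Optimality of a mechanism that implements the welfare maximum -/

namespace Blockchain

variable {C : Blockchain} {r : C.Rates} {T : Mechanism} {X : C.MinerProfile}

theorem userLoad_lowRates (g : C.User → ℝ≥0) (n : C.User) : userLoad (lowRates g) n = g n := by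
  simp [userLoad, lowRates, lowRate]

theorem load_lowRates (g : C.User → ℝ≥0) : load (lowRates g) .low = ∑ n, (g n : ℝ) := by
  simp only [load_low_eq_sum, userLoad_lowRates]

/-- Rates that satisfy the first-order conditions for a maximum of the welfare, which is concave,
maximize it. -/
theorem welfare_le_welfare_lowRates {g : C.User → ℝ≥0} {c : ℝ}
    (hsum : ∑ n, (g n : ℝ) < C.blockRate)
    (hc : c = C.impatience * (C.blockRate / (C.blockRate - ∑ n, (g n : ℝ)) ^ 2))
    (hle : ∀ n : C.User, (g n : ℝ) < C.blockRate / C.numUsers →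
      C.util n - C.numMiners * C.meanSize * C.storageCost ≤ c)
    (hge : ∀ n : C.User, 0 < g n → c ≤ C.util n - C.numMiners * C.meanSize * C.storageCost)
    (hr : ∀ n, C.FeasibleRate (r n)) (h : load r .low < C.blockRate) :
    welfare r ≤ welfare (lowRates g) := by
  rw [welfare, welfare, load_lowRates]
  simp only [userLoad_lowRates]
  have h1 := mul_le_mul_of_nonneg_left (queue_tangent_le blockRate_pos_real.le h hsum)
    C.impatience_pos.le
  have h2 : ∑ n, (userLoad r n - g n)
      * (C.util n - C.numMiners * C.meanSize * C.storageCost - c) ≤ 0 := by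
    refine Finset.sum_nonpos fun n _ => ?_
    rcases le_total (userLoad r n) (g n) with h3 | h3
    · rcases eq_zero_or_pos (g n) with h4 | h4
      · have : userLoad r n - g n = 0 := by
          have := userLoad_nonneg (r := r) n
          rw [h4, NNReal.coe_zero] at h3 ⊢
          linarith
        rw [this, zero_mul]
      · exact mul_nonpos_of_nonpos_of_nonneg (by linarith) (by linarith [hge n h4])
    · rcases h3.eq_or_lt with h4 | h4
      · rw [h4, sub_self, zero_mul]
      · have h5 := hle n (h4.trans_le (feasibleRate_iff.1 (hr n)))
        exact mul_nonpos_of_nonneg_of_nonpos (by linarith) (by linarith)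
  simp only [mul_sub, sub_mul, Finset.sum_sub_distrib, ← Finset.sum_mul] at h2 ⊢
  rw [← load_low_eq_sum] at h2 ⊢
  rw [mul_add, ← mul_assoc, ← hc] at h1
  linarith

/-- A mechanism that implements the maximum of the welfare, with a low fee that covers the storage
costs of all miners, is optimal. -/
theorem Implements.isOptimal {g : C.User → ℝ≥0} (hg : Implements T g)
    (hfee : T.feeLow = C.numMiners * C.storageCost)
    (hH : ∀ i j, g (.inl i) = g (.inl j)) (hL : ∀ i j, g (.inr i) = g (.inr j)) {c : ℝ}
    (hc : c = C.impatience * (C.blockRate / (C.blockRate - ∑ n, (g n : ℝ)) ^ 2))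
    (hle : ∀ n : C.User, (g n : ℝ) < C.blockRate / C.numUsers →
      C.util n - C.numMiners * C.meanSize * C.storageCost ≤ c)
    (hge : ∀ n : C.User, 0 < g n → c ≤ C.util n - C.numMiners * C.meanSize * C.storageCost) :
    C.IsOptimal T := by
  refine ⟨⟨hg.fee_lt, ?_⟩, ?_, ?_⟩
  · rw [hfee]
    exact mul_nonneg (Nat.cast_nonneg _) C.storageCost_nonneg
  · obtain ⟨X, hX⟩ := exists_isMinerEquilibrium (C := C)
    refine ⟨X, lowRates g, hX, isUserEquilibrium_lowRates hX hg hH hL, fun r' hr' n => ?_⟩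
    rw [hr'.eq_lowRates hX hg]
  · rintro X r ⟨hX, hr⟩
    obtain ⟨-, hstable⟩ := hr.stable hX hg.fee_lt
    obtain rfl := hr.eq_lowRates hX hg
    refine ⟨fun n hn => ?_, fun T' X' r' hT' hr' _ => ?_⟩
    · simp only [lowRates, lowRate, zero_add, NNReal.coe_zero, zero_mul] at hn ⊢
      rw [mul_div_cancel_left₀ _ (NNReal.coe_pos.2 hn).ne', hfee]
    · rw [socialWelfare_eq hX hg.fee_lt (fun _ c _ => hg.storageCost_le_fee c) hstable]
      obtain ⟨h1, h2⟩ := hr'.2.stable hr'.1 hT'.1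
      rw [socialWelfare_eq hr'.1 hT'.1 h1 h2, EReal.coe_le_coe_iff]
      exact welfare_le_welfare_lowRates hg.sum_lt hc hle hge hr'.2.1 h2

theorem one_le_numMiners : 1 ≤ C.numMiners := by
  have h : ∑ m, C.power m ≠ 0 := by rw [C.sum_power]; exact one_ne_zero
  obtain ⟨m, -, -⟩ := Finset.exists_ne_zero_of_sum_ne_zero h
  exact Nat.one_le_of_lt m.isLt

theorem storageCost_le_numMiners_mul : C.storageCost ≤ C.numMiners * C.storageCost :=
  le_mul_of_one_le_left C.storageCost_nonneg (by exact_mod_cast one_le_numMiners)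

end Blockchain

/-! ### The closed forms of the optimal rates -/

/-- The first-order conditions for the maximum of the welfare at the closed forms of the optimal
rates, where `p` and `q` are the numbers of users of the two types and `A` and `B` their utilities
net of the storage costs. -/
theorem closedForm_firstOrder {μ γ p q A B g h : ℝ} (hμ : 0 < μ) (hγ : 0 < γ) (hp : 0 < p)
    (hq : 0 < q) (hA : γ / μ < A) (hBA : B ≤ A)
    (hg : g = min (μ / (p + q)) (1 / p * (μ - √(γ * μ / A))))
    (hh : (B ≤ γ * (p + q) ^ 2 / (q ^ 2 * μ) ∧ h = 0) ∨
      (γ * (p + q) ^ 2 / (q ^ 2 * μ) < B ∧ h = μ / (p + q) - 1 / q * √(γ * μ / B))) :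
    0 < g ∧ g ≤ μ / (p + q) ∧ 0 ≤ h ∧ h ≤ μ / (p + q) ∧ p * g + q * h < μ ∧
      (g < μ / (p + q) → A ≤ γ * (μ / (μ - (p * g + q * h)) ^ 2)) ∧
      γ * (μ / (μ - (p * g + q * h)) ^ 2) ≤ A ∧
      B ≤ γ * (μ / (μ - (p * g + q * h)) ^ 2) ∧
      (0 < h → γ * (μ / (μ - (p * g + q * h)) ^ 2) ≤ B) := by
  have hA0 : 0 < A := (div_pos hγ hμ).trans hA
  have hpq : 0 < p + q := add_pos hp hq
  set s := √(γ * μ / A) with hs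
  have hs2 : s ^ 2 = γ * μ / A := Real.sq_sqrt (by positivity)
  have hs0 : 0 < s := Real.sqrt_pos.2 (by positivity)
  have hcs : γ * (μ / s ^ 2) = A := by
    rw [hs2]
    field_simp
  have hsμ : s < μ := by
    refine lt_of_pow_lt_pow_left₀ 2 hμ.le ?_
    rw [hs2, div_lt_iff₀ hA0]
    rw [div_lt_iff₀ hμ] at hA
    nlinarith
  have hg0 : 0 < g := by
    rw [hg]
    exact lt_min (by positivity) (mul_pos (by positivity) (sub_pos.2 hsμ))
  have hgle : g ≤ μ / (p + q) := hg.trans_le (min_le_left _ _)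
  have hgle' : g ≤ 1 / p * (μ - s) := hg.trans_le (min_le_right _ _)
  have hpg : p * g ≤ μ - s := by
    calc p * g ≤ p * (1 / p * (μ - s)) := by gcongr
      _ = μ - s := by field_simp
  rcases hh with ⟨hB, rfl⟩ | ⟨hB, hh⟩
  · have h1 : 0 < μ - p * g := by linarith
    have h2 : γ * (μ / (μ - p * g) ^ 2) ≤ A := by
      rw [← hcs]
      gcongr
      linarith
    have h3 : g < μ / (p + q) → γ * (μ / (μ - p * g) ^ 2) = A := by
      intro h
      have h4 : g = 1 / p * (μ - s) := by
        rcases min_choice (μ / (p + q)) (1 / p * (μ - s)) with h5 | h5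
        · exact absurd (hg.trans h5) h.ne
        · exact hg.trans h5
      rw [← hcs, h4]
      congr 3
      field_simp
      ring
    refine ⟨hg0, hgle, le_rfl, by positivity, by linarith, ?_, ?_, ?_,
      fun h => absurd h (lt_irrefl _)⟩ <;> rw [mul_zero, add_zero]
    · exact fun h => (h3 h).ge
    · exact h2
    · rcases hgle.eq_or_lt with h4 | h4
      · refine hB.trans (le_of_eq ?_)
        have h5 : μ - p * g = q * μ / (p + q) := by
          rw [h4]
          field_simp
          ring
        rw [h5]
        field_simp
      · exact hBA.trans (h3 h4).ge
  · have hB0 : 0 < B := lt_trans (by positivity) hB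
    set u := √(γ * μ / B) with hu
    have hu2 : u ^ 2 = γ * μ / B := Real.sq_sqrt (by positivity)
    have hu0 : 0 < u := Real.sqrt_pos.2 (by positivity)
    have hcu : γ * (μ / u ^ 2) = B := by
      rw [hu2]
      field_simp
    have hsu : s ≤ u := Real.sqrt_le_sqrt (by gcongr)
    have huμ : u < q * μ / (p + q) := by
      refine lt_of_pow_lt_pow_left₀ 2 (by positivity) ?_
      rw [hu2, div_lt_iff₀ hB0, div_pow]
      rw [div_lt_iff₀ (by positivity)] at hB
      rw [div_mul_eq_mul_div, lt_div_iff₀ (by positivity)]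
      nlinarith
    -- type-H users, whose utility is not smaller, use their full rate
    have hgeq : g = μ / (p + q) := by
      rw [hg]
      refine min_eq_left ?_
      rw [one_div_mul_eq_div, le_div_iff₀ hp]
      have : μ / (p + q) * p = μ - q * μ / (p + q) := by
        field_simp
        ring
      linarith
    have hload : μ - (p * g + q * h) = u := by
      rw [hgeq, hh]
      field_simp
      ring
    rw [hload, hcu]
    have h1 : 0 < h := by
      rw [hh, sub_pos, one_div_mul_eq_div, div_lt_iff₀ hq]
      calc u < q * μ / (p + q) := huμ
        _ = _ := by ring
    refine ⟨hg0, hgle, h1.le, ?_, by linarith, fun h => absurd hgeq h.ne, hBA, le_rfl,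
      fun _ => le_rfl⟩
    rw [hh]
    have : 0 ≤ 1 / q * u := by positivity
    linarith

namespace Blockchain

variable {C : Blockchain}

/-- The optimal rates of the users when type-H transactions are worth more than their costs in an
empty system. -/
noncomputable def optimalRate (C : Blockchain) : C.User → ℝ≥0
  | .inl _ => C.g₁.toNNReal
  | .inr _ => C.g₂.toNNReal

theorem numUsers_cast : (C.numUsers : ℝ) = C.numH + C.numL := by
  simp [numUsers]

theorem g₂_cases : (C.utilL - C.numMiners * C.meanSize * C.storageCost
      ≤ C.impatience * (C.numH + C.numL) ^ 2 / (C.numL ^ 2 * C.blockRate) ∧ C.g₂ = 0) ∨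
    (C.impatience * (C.numH + C.numL) ^ 2 / (C.numL ^ 2 * C.blockRate)
      < C.utilL - C.numMiners * C.meanSize * C.storageCost ∧
      C.g₂ = C.blockRate / (C.numH + C.numL) - 1 / C.numL * √(C.impatience * C.blockRate
        / (C.utilL - C.numMiners * C.meanSize * C.storageCost))) := by
  rw [g₂]
  split_ifs with h
  · exact .inl ⟨by linarith, rfl⟩
  · exact .inr ⟨by linarith [not_le.1 h], rfl⟩

variable {T : Mechanism}

/-- If no transaction is worth its storage and waiting costs even in an empty system, it is optimal
to leave the chain unused, which a low fee at the storage costs and vanishing total taxes achieve. -/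
theorem isOptimal_of_utilH_le
    (hR : C.utilH ≤ C.numMiners * C.meanSize * C.storageCost + C.impatience / C.blockRate)
    (hhigh : T.feeHigh = C.numMiners * C.storageCost + C.impatience / (C.meanSize * C.blockRate))
    (hlow : T.feeLow = C.numMiners * C.storageCost)
    (hH : C.totalTaxH T = 0) (hL : C.totalTaxL T = 0) : C.IsOptimal T := by
  have hμ := blockRate_pos_real (C := C)
  have hs := meanSize_pos (C := C)
  have hγ := C.impatience_pos
  have hpay : ∀ n : C.User, taxPaid T n = 0 := by
    rintro (i | i)
    · rw [taxPaid_inl, hH]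
    · rw [taxPaid_inr, hL]
  have hutil : ∀ n : C.User,
      C.util n - C.numMiners * C.meanSize * C.storageCost ≤ C.impatience / C.blockRate := by
    have := C.utilL_le_utilH
    rintro (i | i) <;> simp only [util] <;> linarith
  have hfee : C.meanSize * T.feeHigh = C.numMiners * C.meanSize * C.storageCost
      + C.impatience / C.blockRate := by
    rw [hhigh]
    field_simp
  have hfee' : C.meanSize * T.feeLow = C.numMiners * C.meanSize * C.storageCost := by
    rw [hlow]
    ring
  have hc : C.impatience / C.blockRate
      = C.impatience * (C.blockRate / (C.blockRate - ∑ n : C.User, ((0 : ℝ≥0) : ℝ)) ^ 2) := by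
    simp only [NNReal.coe_zero, Finset.sum_const_zero, sub_zero]
    field_simp
  refine Implements.isOptimal (g := fun _ => 0) ⟨fun n => ?_, ?_, ?_, ?_, fun n => ?_, fun n => ?_,
    fun n h => absurd h (lt_irrefl _)⟩ hlow (fun _ _ => rfl) (fun _ _ => rfl) hc
    (fun n _ => hutil n) (fun n h => absurd h (lt_irrefl _))
  · simp only [NNReal.coe_zero]
    positivity
  · simpa using hμ
  · rw [hhigh, hlow]
    have : 0 < C.impatience / (C.meanSize * C.blockRate) := by positivity
    linarith
  · rw [hlow]
    exact storageCost_le_numMiners_mul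
  · have := hutil n
    have : 0 < C.impatience / C.blockRate := by positivity
    rw [netValue, hpay]
    simp only [Mechanism.fee]
    linarith
  · have h1 : C.impatience * (C.blockRate - ∑ l : C.User, ((0 : ℝ≥0) : ℝ) + (0 : ℝ≥0))
        / (C.blockRate - ∑ l : C.User, ((0 : ℝ≥0) : ℝ)) ^ 2 = C.impatience / C.blockRate := by
      simp only [NNReal.coe_zero, Finset.sum_const_zero, sub_zero, add_zero]
      field_simp
    rw [h1, netValue, hpay]
    simp only [Mechanism.fee]
    have := hutil n
    linarith

/-- Taxes that make the marginal payoff of each user vanish at the optimal rates implement them. -/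
theorem isOptimal_of_lt_utilH
    (hR : C.numMiners * C.meanSize * C.storageCost + C.impatience / C.blockRate < C.utilH)
    (hhigh : T.feeHigh = C.utilH / C.meanSize - C.impatience / (C.meanSize * C.blockRate))
    (hlow : T.feeLow = C.numMiners * C.storageCost)
    (hH : C.totalTaxH T = C.utilH - T.feeLow * C.meanSize
      - C.impatience * (C.blockRate - (C.numH - 1) * C.g₁ - C.numL * C.g₂)
        / (C.blockRate - C.numH * C.g₁ - C.numL * C.g₂) ^ 2)
    (hL : C.totalTaxL T = C.utilL - T.feeLow * C.meanSize
      - C.impatience * (C.blockRate - C.numH * C.g₁ - (C.numL - 1) * C.g₂)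
        / (C.blockRate - C.numH * C.g₁ - C.numL * C.g₂) ^ 2) : C.IsOptimal T := by
  have hμ := blockRate_pos_real (C := C)
  have hs := meanSize_pos (C := C)
  have hγ := C.impatience_pos
  have hp : (0 : ℝ) < C.numH := by exact_mod_cast C.numH_pos
  have hq : (0 : ℝ) < C.numL := by exact_mod_cast C.numL_pos
  have hHL := C.utilL_le_utilH
  obtain ⟨h1, h2, h3, h4, h5, h6, h7, h8, h9⟩ := closedForm_firstOrder
    (A := C.utilH - C.numMiners * C.meanSize * C.storageCost)
    (B := C.utilL - C.numMiners * C.meanSize * C.storageCost) (g := C.g₁) (h := C.g₂) hμ hγ hp hq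
    (by linarith) (by linarith) rfl g₂_cases
  have hg₁ : ((C.g₁.toNNReal : ℝ≥0) : ℝ) = C.g₁ := Real.coe_toNNReal _ h1.le
  have hg₂ : ((C.g₂.toNNReal : ℝ≥0) : ℝ) = C.g₂ := Real.coe_toNNReal _ h3
  have hsum : ∑ n, (C.optimalRate n : ℝ) = C.numH * C.g₁ + C.numL * C.g₂ := by
    rw [Fintype.sum_sum_type]
    simp [optimalRate, hg₁, hg₂]
  have hfee : C.meanSize * T.feeHigh = C.utilH - C.impatience / C.blockRate := by
    rw [hhigh]
    field_simp
  have hfee' : C.meanSize * T.feeLow = C.numMiners * C.meanSize * C.storageCost := by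
    rw [hlow]
    ring
  have hnet : ∀ n : C.User, netValue T n .low
      = C.impatience * (C.blockRate - ∑ l, (C.optimalRate l : ℝ) + C.optimalRate n)
        / (C.blockRate - ∑ l, (C.optimalRate l : ℝ)) ^ 2 := by
    rw [hsum]
    rintro (i | i)
    · rw [netValue, taxPaid_inl, hH]
      simp only [optimalRate, hg₁, Mechanism.fee, util, sub_add_eq_sub_sub]
      rw [show (C.blockRate : ℝ) - C.numH * C.g₁ - C.numL * C.g₂ + C.g₁
        = C.blockRate - (C.numH - 1) * C.g₁ - C.numL * C.g₂ by ring]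
      ring
    · rw [netValue, taxPaid_inr, hL]
      simp only [optimalRate, hg₂, Mechanism.fee, util, sub_add_eq_sub_sub]
      rw [show (C.blockRate : ℝ) - C.numH * C.g₁ - C.numL * C.g₂ + C.g₂
        = C.blockRate - C.numH * C.g₁ - (C.numL - 1) * C.g₂ by ring]
      ring
  have hnet_le : ∀ n : C.User, netValue T n .low
      ≤ C.utilH - C.numMiners * C.meanSize * C.storageCost := by
    intro n
    rw [hnet, mul_div_assoc]
    rw [← hsum] at h7 h5
    refine le_trans ?_ h7
    have h10 : (C.optimalRate n : ℝ) ≤ ∑ l, (C.optimalRate l : ℝ) :=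
      Finset.single_le_sum (fun l _ => NNReal.coe_nonneg _) (Finset.mem_univ n)
    gcongr
    linarith
  refine Implements.isOptimal (g := C.optimalRate) ⟨?_, by rw [hsum]; exact h5, ?_, ?_, fun n => ?_,
    fun n => (hnet n).le, fun n _ => (hnet n).ge⟩ hlow (fun _ _ => rfl) (fun _ _ => rfl) rfl ?_ ?_
  · rw [numUsers_cast]
    rintro (i | i)
    · simpa only [optimalRate, hg₁] using h2
    · simpa only [optimalRate, hg₂] using h4
  · refine lt_of_mul_lt_mul_left ?_ hs.le
    rw [hfee, hfee']
    linarith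
  · rw [hlow]
    exact storageCost_le_numMiners_mul
  · have h10 := hnet_le n
    rw [netValue] at h10 ⊢
    simp only [Mechanism.fee] at h10 ⊢
    linarith
  · rw [hsum, numUsers_cast]
    rintro (i | i)
    · simpa only [optimalRate, hg₁, util] using h6
    · intro _
      simpa only [util] using h8
  · rw [hsum]
    rintro (i | i)
    · intro _
      simpa only [util] using h7
    · intro h
      simp only [optimalRate, Real.toNNReal_pos] at h
      simpa only [util] using h9 h

/-- Taxes paid only to users of the other type realize any totals. -/
theorem exists_mechanism (a b x y : ℝ) : ∃ T : Mechanism, T.feeHigh = a ∧ T.feeLow = b ∧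
    C.totalTaxH T = x ∧ C.totalTaxL T = y := by
  have hp : (C.numH : ℝ) ≠ 0 := by exact_mod_cast C.numH_pos.ne'
  have hq : (C.numL : ℝ) ≠ 0 := by exact_mod_cast C.numL_pos.ne'
  refine ⟨⟨a, b, 0, x / C.numL, y / C.numH, 0⟩, rfl, rfl, ?_, ?_⟩
  · simp only [totalTaxH]
    field_simp
    ring
  · simp only [totalTaxL]
    field_simp
    ring

end Blockchain

theorem theorem3 (C : Blockchain) :
    (C.utilH ≤ C.numMiners * C.meanSize * C.storageCost + C.impatience / C.blockRate →
      (∃ T : Mechanism,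
        T.feeHigh = C.numMiners * C.storageCost + C.impatience / (C.meanSize * C.blockRate) ∧
        T.feeLow = C.numMiners * C.storageCost ∧
        C.totalTaxH T = 0 ∧ C.totalTaxL T = 0) ∧
      ∀ T : Mechanism,
        T.feeHigh = C.numMiners * C.storageCost + C.impatience / (C.meanSize * C.blockRate) →
        T.feeLow = C.numMiners * C.storageCost →
        C.totalTaxH T = 0 → C.totalTaxL T = 0 →
        C.IsOptimal T) ∧
    (C.numMiners * C.meanSize * C.storageCost + C.impatience / C.blockRate < C.utilH →
      (∃ T : Mechanism,
        T.feeHigh = C.utilH / C.meanSize - C.impatience / (C.meanSize * C.blockRate) ∧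
        T.feeLow = C.numMiners * C.storageCost ∧
        C.totalTaxH T = C.utilH - T.feeLow * C.meanSize
          - C.impatience * (C.blockRate - (C.numH - 1) * C.g₁ - C.numL * C.g₂)
            / (C.blockRate - C.numH * C.g₁ - C.numL * C.g₂) ^ 2 ∧
        C.totalTaxL T = C.utilL - T.feeLow * C.meanSize
          - C.impatience * (C.blockRate - C.numH * C.g₁ - (C.numL - 1) * C.g₂)
            / (C.blockRate - C.numH * C.g₁ - C.numL * C.g₂) ^ 2) ∧
      ∀ T : Mechanism,
        T.feeHigh = C.utilH / C.meanSize - C.impatience / (C.meanSize * C.blockRate) →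
        T.feeLow = C.numMiners * C.storageCost →
        C.totalTaxH T = C.utilH - T.feeLow * C.meanSize
          - C.impatience * (C.blockRate - (C.numH - 1) * C.g₁ - C.numL * C.g₂)
            / (C.blockRate - C.numH * C.g₁ - C.numL * C.g₂) ^ 2 →
        C.totalTaxL T = C.utilL - T.feeLow * C.meanSize
          - C.impatience * (C.blockRate - C.numH * C.g₁ - (C.numL - 1) * C.g₂)
            / (C.blockRate - C.numH * C.g₁ - C.numL * C.g₂) ^ 2 →
        C.IsOptimal T) := by
  refine ⟨fun hR => ⟨Blockchain.exists_mechanism _ _ _ _,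
    fun T hhigh hlow hH hL => Blockchain.isOptimal_of_utilH_le hR hhigh hlow hH hL⟩,
    fun hR => ⟨?_, fun T hhigh hlow hH hL => Blockchain.isOptimal_of_lt_utilH hR hhigh hlow hH hL⟩⟩
  -- the taxes are given in terms of the low fee
  obtain ⟨T, hhigh, hlow, hH, hL⟩ := Blockchain.exists_mechanism (C := C)
    (C.utilH / C.meanSize - C.impatience / (C.meanSize * C.blockRate))
    (C.numMiners * C.storageCost)
    (C.utilH - C.numMiners * C.storageCost * C.meanSize
      - C.impatience * (C.blockRate - (C.numH - 1) * C.g₁ - C.numL * C.g₂)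
        / (C.blockRate - C.numH * C.g₁ - C.numL * C.g₂) ^ 2)
    (C.utilL - C.numMiners * C.storageCost * C.meanSize
      - C.impatience * (C.blockRate - C.numH * C.g₁ - (C.numL - 1) * C.g₂)
        / (C.blockRate - C.numH * C.g₁ - C.numL * C.g₂) ^ 2)
  refine ⟨T, hhigh, hlow, ?_, ?_⟩
  · rw [hH, hlow]
  · rw [hL, hlow]
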